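/- Let $M$ be a smooth manifold of dimension $n$ (Hausdorff, second countable, without boundary) and let $L\subset TM\oplus T^*M$ be a Dirac structure on $M$, i.e. a smooth maximal isotropic subbundle whose sections are closed under the Courant bracket. For a Poisson manifold $(P,\Pi)$ write $\sharp\colon T^*P\to TP$ for the contraction with $\Pi$ and $L_P=\{(\sharp\xi,\xi)\}$. Say that $(M,L)$ \emph{embeds coisotropically} in $(P,\Pi)$ if there is a smooth embedding $i\colon M\to P$ such that $\sharp N^*i(M)\subset T\,i(M)$, where $N^*i(M)$ is the conormal bundle, and $i^*L_P=L$, where $(i^*L_P)_x=\{(v,\xi\circ d_xi) : (d_xi(v),\xi)\in (L_P)_{i(x)}\}$. (1) If $M$ is connected, then $(M,L)$ embeds coisotropically in some Poisson manifold if and only if $L\cap TM$ has constant rank. (2) For arbitrary $M$, if $(M,L)$ embeds coisotropically in some Poisson manifold, then the rank of $L\cap TM$ is locally constant. (3) For arbitrary $M$, suppose that $E:=L\cap TM$ has constant rank $k$. Then $(M,L)$ embeds coisotropically in some Poisson manifold. More precisely, $E$ has a smooth complement in $TM$, the family of dual spaces $E^*$ is a smooth vector bundle $\pi\colon E^*\to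 M$ of rank $k$ for which the restriction map $T^*M\to E^*$ is smooth, and the following holds for every smooth distribution $V$ with $TM=E\oplus V$. Let $i_V\colon E^*\to T^*M$ be the map that extends a linear form on $E_x$ by zero on $V_x$, let $\omega_{T^*M}$ be the canonical symplectic form of $T^*M$, and for a $2$-form $B$ let $\tau_B(L')=\{(X,\xi+i_XB):(X,\xi)\in L'\}$. Then there is an open neighbourhood $U$ of the zero section of $E^*$ on which $\tau_{i_V^*\omega_{T^*M}}(\pi^*L)$ is the graph $\{(\sharp\xi,\xi)\}$ of a Poisson structure, and the zero section $M\to U$ embeds $(M,L)$ coisotropically in this Poisson manifold. -/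

import Mathlib

open scoped Manifold ContDiff Bundle Topology
open Bundle Set TopologicalSpace

noncomputable section

namespace DiracGeom

universe u v w

/-! ### Dirac linear algebra -/

section Linear

variable {T T' : Type*} [TopologicalSpace T] [AddCommGroup T] [Module ℝ T]
  [TopologicalSpace T'] [AddCommGroup T'] [Module ℝ T']

/-- The pullback `A^*b` of a bilinear form `b` by a linear map `A`. A bilinear form is written as
the map `v ↦ i_v b = b (v, ·)`. -/
def pullbackTensor (A : T →L[ℝ] T') (b : T' →ₗ[ℝ] (T' →L[ℝ] ℝ)) : T →ₗ[ℝ] (T →L[ℝ] ℝ) where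
  toFun v := (b (A v)).comp A
  map_add' v w := by ext; simp
  map_smul' c v := by ext; simp

/-- The pullback of a subspace `L ⊆ T' ⊕ T'^*` (a Dirac structure on `T'`) by a linear map
`A : T → T'`, namely `{(v, A^* ξ) | (A v, ξ) ∈ L}`. -/
def pullbackDirac (A : T →L[ℝ] T') (L : Submodule ℝ (T' × (T' →L[ℝ] ℝ))) :
    Submodule ℝ (T × (T →L[ℝ] ℝ)) where
  carrier := {p | ∃ ξ : T' →L[ℝ] ℝ, (A p.1, ξ) ∈ L ∧ p.2 = ξ.comp A}
  zero_mem' := ⟨0, by rw [Prod.fst_zero, map_zero]; exact L.zero_mem, by simp⟩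
  add_mem' := by
    rintro p q ⟨ξ, hξ, hp⟩ ⟨η, hη, hq⟩
    exact ⟨ξ + η, by simpa using L.add_mem hξ hη, by simp [hp, hq]⟩
  smul_mem' := by
    rintro c p ⟨ξ, hξ, hp⟩
    exact ⟨c • ξ, by simpa using L.smul_mem c hξ, by simp [hp]⟩

/-- The gauge transformation `τ_B L = {(X, ξ + i_X B) | (X, ξ) ∈ L}`. -/
def gaugeTransform (B : T →ₗ[ℝ] (T →L[ℝ] ℝ)) (L : Submodule ℝ (T × (T →L[ℝ] ℝ))) :
    Submodule ℝ (T × (T →L[ℝ] ℝ)) :=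
  L.map ((LinearMap.fst ℝ T (T →L[ℝ] ℝ)).prod
    (LinearMap.snd ℝ T (T →L[ℝ] ℝ) + B ∘ₗ LinearMap.fst ℝ T (T →L[ℝ] ℝ)))

end Linear

/-! ### Vector fields, `1`-forms and the Courant bracket -/

section Forms

variable {E : Type u} [NormedAddCommGroup E] [NormedSpace ℝ E]
  {H : Type v} [TopologicalSpace H] (I : ModelWithCorners ℝ E H)
  {M : Type w} [TopologicalSpace M] [ChartedSpace H M]

/-- The cotangent space `T*ₓM`. -/
abbrev Cotangent (x : M) : Type u := TangentSpace I x →L[ℝ] Bundle.Trivial M ℝ x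

variable (M) in
/-- The total space of the cotangent bundle `T*M`, with Mathlib's structure of a manifold on the
bundle of continuous linear maps from `TM` to the trivial line bundle. -/
abbrev CotangentBundle : Type (max u w) :=
  TotalSpace (E →L[ℝ] ℝ) (fun x : M => Cotangent I x)

/-- The vector field `X` is smooth on `U`. -/
def SmoothVectorFieldOn [IsManifold I ∞ M] (X : Π x : M, TangentSpace I x) (U : Set M) : Prop :=
  ContMDiffOn I (I.prod 𝓘(ℝ, E)) ∞ (fun x => (⟨x, X x⟩ : TangentBundle I M)) U

/-- The `1`-form `α` is smooth on `U`. -/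
def SmoothOneFormOn [IsManifold I ∞ M] (α : Π x : M, Cotangent I x) (U : Set M) : Prop :=
  ContMDiffOn I (I.prod 𝓘(ℝ, E →L[ℝ] ℝ)) ∞ (fun x => (⟨x, α x⟩ : CotangentBundle I M)) U

/-- The differential of a function. -/
def d0 (f : M → ℝ) (x : M) : Cotangent I x :=
  (mfderiv I 𝓘(ℝ, ℝ) f x : TangentSpace I x →L[ℝ] ℝ)

/-- A `1`-form read in the preferred chart at `x₀`: its pullback by the inverse of that chart. -/
def oneFormInChart (α : Π x : M, Cotangent I x) (x₀ : M) (y : E) : E →L[ℝ] ℝ :=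
  (α ((extChartAt I x₀).symm y)).comp
    (mfderivWithin 𝓘(ℝ, E) I (extChartAt I x₀).symm (range I) y :
      E →L[ℝ] TangentSpace I ((extChartAt I x₀).symm y))

/-- The exterior derivative of a `1`-form `α` at `x`, as the map `v ↦ i_v dα`. It is computed in
the preferred chart at `x`, by `da (v, w) = D_v (a (w)) - D_w (a (v))` for a `1`-form `a` on a
vector space and constant `v`, `w`, and pulled back to `M`. -/
def d1 (α : Π x : M, Cotangent I x) (x : M) : TangentSpace I x →ₗ[ℝ] Cotangent I x :=
  let D : E →L[ℝ] E →L[ℝ] ℝ :=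
    fderivWithin ℝ (oneFormInChart I α x) (range I) (extChartAt I x x)
  pullbackTensor (mfderiv I 𝓘(ℝ, E) (extChartAt I x) x : TangentSpace I x →L[ℝ] E)
    ((D - D.flip : E →L[ℝ] E →L[ℝ] ℝ) : E →ₗ[ℝ] (E →L[ℝ] ℝ))

/-- The Courant bracket of sections of `TM ⊕ T*M`,
`[(X, α), (Y, β)] = ([X, Y], ℒ_X β - ℒ_Y α + ½ d(α(Y) - β(X)))`,
where Cartan's formula `ℒ_X β = i_X dβ + d(β(X))` has been inserted, so that the second component
reads `i_X dβ - i_Y dα + ½ d(β(X) - α(Y))`. -/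
def courantBracket (X : Π x : M, TangentSpace I x) (α : Π x : M, Cotangent I x)
    (Y : Π x : M, TangentSpace I x) (β : Π x : M, Cotangent I x) (x : M) :
    TangentSpace I x × Cotangent I x :=
  (VectorField.mlieBracket I X Y x,
    d1 I β x (X x) - d1 I α x (Y x)
      + (1 / 2 : ℝ) • d0 I (fun y => (β y (X y) - α y (Y y) : ℝ)) x)

/-- `V` is a smooth distribution (a smooth subbundle of `TM`): near each point it has a frame of
smooth vector fields. -/
def IsSmoothDistribution [IsManifold I ∞ M] (V : Π x : M, Submodule ℝ (TangentSpace I x)) :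
    Prop :=
  ∀ x₀ : M, ∃ U : Set M, IsOpen U ∧ x₀ ∈ U ∧
    ∃ (r : ℕ) (X : Fin r → Π x : M, TangentSpace I x),
      (∀ i, SmoothVectorFieldOn I (X i) U) ∧
      ∀ x ∈ U, LinearIndependent ℝ (fun i => X i x) ∧
        V x = Submodule.span ℝ (range fun i => X i x)

/-- The canonical `1`-form on `T*M`, whose value at the covector `p` is `p ∘ dπ`. -/
def canonicalOneForm [IsManifold I ∞ M] (p : CotangentBundle I M) :
    Cotangent (I.prod 𝓘(ℝ, E →L[ℝ] ℝ)) p :=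
  p.2.comp (mfderiv (I.prod 𝓘(ℝ, E →L[ℝ] ℝ)) I
    (TotalSpace.proj : CotangentBundle I M → M) p)

/-- The canonical symplectic form on `T*M`, the differential of the canonical `1`-form
(in coordinates, `∑ dpᵢ ∧ dqᵢ`). -/
def canonicalSymplecticForm [IsManifold I ∞ M] (p : CotangentBundle I M) :
    TangentSpace (I.prod 𝓘(ℝ, E →L[ℝ] ℝ)) p →ₗ[ℝ] Cotangent (I.prod 𝓘(ℝ, E →L[ℝ] ℝ)) p :=
  d1 (I.prod 𝓘(ℝ, E →L[ℝ] ℝ)) (canonicalOneForm I) p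

end Forms

/-! ### Dirac structures and Poisson structures -/

section Structures

variable {E : Type u} [NormedAddCommGroup E] [NormedSpace ℝ E]
  {H : Type v} [TopologicalSpace H] (I : ModelWithCorners ℝ E H)
  (M : Type w) [TopologicalSpace M] [ChartedSpace H M] [IsManifold I ∞ M]

/-- A Dirac structure on `M`: a smooth subbundle `L` of `TM ⊕ T*M` which is isotropic, of rank
`dim M` (hence maximal isotropic), and whose (local) sections are closed under the Courant
bracket. -/
structure DiracStructure where
  /-- The fibre of `L` at a point. -/
  fiber : Π x : M, Submodule ℝ (TangentSpace I x × Cotangent I x)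
  isotropic : ∀ x, ∀ a ∈ fiber x, ∀ b ∈ fiber x, (a.2 b.1 + b.2 a.1 : ℝ) = 0
  finrank_fiber : ∀ x, Module.finrank ℝ (fiber x) = Module.finrank ℝ E
  smooth : ∀ x₀ : M, ∃ U : Set M, IsOpen U ∧ x₀ ∈ U ∧
    ∃ (X : Fin (Module.finrank ℝ E) → Π x : M, TangentSpace I x)
      (α : Fin (Module.finrank ℝ E) → Π x : M, Cotangent I x),
      (∀ i, SmoothVectorFieldOn I (X i) U ∧ SmoothOneFormOn I (α i) U) ∧
      ∀ x ∈ U, fiber x = Submodule.span ℝ (range fun i => (X i x, α i x))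
  integrable : ∀ (U : Set M), IsOpen U →
    ∀ (X : Π x : M, TangentSpace I x) (α : Π x : M, Cotangent I x)
      (Y : Π x : M, TangentSpace I x) (β : Π x : M, Cotangent I x),
      SmoothVectorFieldOn I X U → SmoothOneFormOn I α U →
      SmoothVectorFieldOn I Y U → SmoothOneFormOn I β U →
      (∀ x ∈ U, (X x, α x) ∈ fiber x) → (∀ x ∈ U, (Y x, β x) ∈ fiber x) →
      ∀ x ∈ U, courantBracket I X α Y β x ∈ fiber x

variable {M} in
/-- The bracket `{f, g} = Π(df, dg) = dg (♯ df)` of functions. -/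
def bracketOf (sharp : Π x : M, Cotangent I x →L[ℝ] TangentSpace I x) (f g : M → ℝ) (x : M) : ℝ :=
  d0 I g x (sharp x (d0 I f x))

/-- A Poisson structure on `M`: a smooth bivector field `Π`, given through its contraction
`♯ : T*M → TM` (so `Π (ξ, η) = η (♯ ξ)`), with `[Π, Π] = 0`. The value of the Schouten bracket
`[Π, Π]` on `(df, dg, dh)` is, up to a nonzero constant, the left hand side of the Jacobi identity
for the bracket of functions. -/
structure PoissonStructure where
  /-- The contraction `♯ : T*M → TM` with the bivector field. -/
  sharp : Π x : M, Cotangent I x →L[ℝ] TangentSpace I x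
  skew : ∀ x (ξ η : Cotangent I x), (η (sharp x ξ) : ℝ) = - ξ (sharp x η)
  smooth : ContMDiff I (I.prod 𝓘(ℝ, (E →L[ℝ] ℝ) →L[ℝ] E)) ∞
    (fun x => (⟨x, sharp x⟩ :
      TotalSpace ((E →L[ℝ] ℝ) →L[ℝ] E) (fun x : M => Cotangent I x →L[ℝ] TangentSpace I x)))
  jacobi : ∀ f g h : M → ℝ, ContMDiff I 𝓘(ℝ, ℝ) ∞ f → ContMDiff I 𝓘(ℝ, ℝ) ∞ g →
    ContMDiff I 𝓘(ℝ, ℝ) ∞ h → ∀ x,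
      bracketOf I sharp f (bracketOf I sharp g h) x
        + bracketOf I sharp g (bracketOf I sharp h f) x
        + bracketOf I sharp h (bracketOf I sharp f g) x = 0

variable {I M}

/-- The Dirac structure `L_P = {(♯ξ, ξ)}` of a Poisson structure, at a point. -/
def PoissonStructure.graph (S : PoissonStructure I M) (x : M) :
    Submodule ℝ (TangentSpace I x × Cotangent I x) :=
  LinearMap.range ((S.sharp x : Cotangent I x →ₗ[ℝ] TangentSpace I x).prod LinearMap.id)

namespace DiracStructure

variable (L : DiracStructure I M)

/-- The characteristic subspace `(L ∩ TM)ₓ = {v | (v, 0) ∈ Lₓ}`. -/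
def char (x : M) : Submodule ℝ (TangentSpace I x) :=
  (L.fiber x).comap (LinearMap.inl ℝ (TangentSpace I x) (Cotangent I x))

/-- The rank of `L ∩ TM` at a point. -/
def charRank (x : M) : ℕ := Module.finrank ℝ (L.char x)

/-- `i : M → P` is a coisotropic embedding of the Dirac manifold `(M, L)` in the Poisson manifold
`P`: a smooth embedding with `♯ N*i(M) ⊆ T i(M)` and `i^* L_P = L`. -/
structure IsCoisotropicEmbedding
    {E' : Type*} [NormedAddCommGroup E'] [NormedSpace ℝ E']
    {H' : Type*} [TopologicalSpace H'] {J : ModelWithCorners ℝ E' H'}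
    {P : Type*} [TopologicalSpace P] [ChartedSpace H' P] [IsManifold J ∞ P]
    (S : PoissonStructure J P) (i : M → P) : Prop where
  isSmoothEmbedding : Manifold.IsSmoothEmbedding I J ∞ i
  coisotropic : ∀ x (ξ : Cotangent J (i x)), ξ.comp (mfderiv I J i x) = 0 →
    ∃ v : TangentSpace I x, mfderiv I J i x v = S.sharp (i x) ξ
  pullback_eq : ∀ x, pullbackDirac (mfderiv I J i x) (S.graph (i x)) = L.fiber x

/-- The Dirac manifold `(M, L)` can be embedded coisotropically in some Poisson manifold `P`
(finite dimensional, Hausdorff, second countable and without boundary). -/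
def EmbedsCoisotropically : Prop :=
  ∃ (E' : Type u) (_ : NormedAddCommGroup E') (_ : NormedSpace ℝ E') (_ : FiniteDimensional ℝ E')
    (H' : Type v) (_ : TopologicalSpace H') (J : ModelWithCorners ℝ E' H') (_ : J.Boundaryless)
    (P : Type (max u w)) (_ : TopologicalSpace P) (_ : T2Space P) (_ : SecondCountableTopology P)
    (_ : ChartedSpace H' P) (_ : IsManifold J ∞ P)
    (S : PoissonStructure J P) (i : M → P), L.IsCoisotropicEmbedding S i

/-! ### The Poisson structure on a neighbourhood of the zero section of `(L ∩ TM)*` -/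

/-- The fibre of `E* = (L ∩ TM)*`. -/
abbrev CharDual (x : M) : Type u := L.char x →L[ℝ] ℝ

/-- The total space of `E* = (L ∩ TM)*`, when `L ∩ TM` has rank `k`. -/
abbrev CharDualTotal (k : ℕ) : Type (max u w) :=
  TotalSpace (EuclideanSpace ℝ (Fin k)) L.CharDual

/-- The structure of a smooth vector bundle of rank `k` on `E* = (L ∩ TM)*`, normalized by the
requirement that the restriction map `T*M → E*` be smooth. The restriction map being fibrewise
linear and onto, there is at most one such smooth structure. -/
class CharDualBundle (k : ℕ) where
  topology : TopologicalSpace (L.CharDualTotal k)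
  fiberBundle : FiberBundle (EuclideanSpace ℝ (Fin k)) L.CharDual
  vectorBundle : VectorBundle ℝ (EuclideanSpace ℝ (Fin k)) L.CharDual
  contMDiffVectorBundle : ContMDiffVectorBundle ∞ (EuclideanSpace ℝ (Fin k)) L.CharDual I
  contMDiff_restrict : ContMDiff (I.prod 𝓘(ℝ, E →L[ℝ] ℝ)) (I.prod 𝓘(ℝ, EuclideanSpace ℝ (Fin k))) ∞
    (fun p : CotangentBundle I M =>
      (⟨p.1, p.2.comp (L.char p.1).subtypeL⟩ : L.CharDualTotal k))

attribute [reducible] CharDualBundle.topology CharDualBundle.fiberBundle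

attribute [instance] CharDualBundle.topology CharDualBundle.fiberBundle
  CharDualBundle.vectorBundle CharDualBundle.contMDiffVectorBundle

/-- `V` is a smooth distribution with `TM = (L ∩ TM) ⊕ V`. -/
structure IsSmoothComplement (V : Π x : M, Submodule ℝ (TangentSpace I x)) : Prop where
  smooth : IsSmoothDistribution I V
  isCompl : ∀ x, IsCompl (L.char x) (V x)

variable {L}

/-- The map `i : E* → T*M` given by a complement `V` of `E = L ∩ TM`: it extends a linear form on
`E` by zero on `V`. -/
def splittingMap [FiniteDimensional ℝ E] (k : ℕ) {V : Π x : M, Submodule ℝ (TangentSpace I x)}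
    (hV : L.IsSmoothComplement V) (p : L.CharDualTotal k) : CotangentBundle I M :=
  haveI : FiniteDimensional ℝ (TangentSpace I p.1) := inferInstanceAs (FiniteDimensional ℝ E)
  haveI : T2Space (TangentSpace I p.1) := inferInstanceAs (T2Space E)
  ⟨p.1, p.2.comp (LinearMap.toContinuousLinearMap
    ((L.char p.1).projectionOnto (V p.1) (hV.isCompl p.1)))⟩

/-- The Dirac structure `τ_B (π^* L)` on `E*`, with `π : E* → M` the projection and
`B = i^* ω_{T*M}` the pullback of the canonical symplectic form by `i : E* → T*M`. -/
def gaugedDirac [FiniteDimensional ℝ E] (k : ℕ) [L.CharDualBundle k]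
    {V : Π x : M, Submodule ℝ (TangentSpace I x)} (hV : L.IsSmoothComplement V)
    (p : L.CharDualTotal k) :
    Submodule ℝ (TangentSpace (I.prod 𝓘(ℝ, EuclideanSpace ℝ (Fin k))) p ×
      Cotangent (I.prod 𝓘(ℝ, EuclideanSpace ℝ (Fin k))) p) :=
  gaugeTransform
    (pullbackTensor
      (mfderiv (I.prod 𝓘(ℝ, EuclideanSpace ℝ (Fin k))) (I.prod 𝓘(ℝ, E →L[ℝ] ℝ))
        (splittingMap k hV) p)
      (canonicalSymplecticForm I (splittingMap k hV p)))
    (pullbackDirac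
      (mfderiv (I.prod 𝓘(ℝ, EuclideanSpace ℝ (Fin k))) I
        (TotalSpace.proj : L.CharDualTotal k → M) p)
      (L.fiber p.1))

/-- On the open neighbourhood `U` of the zero section of `E*`, the Dirac structure `τ_B (π^* L)`
is the graph of a Poisson structure, and the zero section embeds `(M, L)` coisotropically in
that Poisson manifold. -/
def IsPoissonNeighbourhood [FiniteDimensional ℝ E] (k : ℕ) [L.CharDualBundle k]
    {V : Π x : M, Submodule ℝ (TangentSpace I x)} (hV : L.IsSmoothComplement V)
    (U : Opens (L.CharDualTotal k)) : Prop :=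
  ∃ (h0 : ∀ x : M, zeroSection (EuclideanSpace ℝ (Fin k)) L.CharDual x ∈ U)
    (S : PoissonStructure (I.prod 𝓘(ℝ, EuclideanSpace ℝ (Fin k))) U),
    (∀ p : U, S.graph p = pullbackDirac
      (mfderiv (I.prod 𝓘(ℝ, EuclideanSpace ℝ (Fin k))) (I.prod 𝓘(ℝ, EuclideanSpace ℝ (Fin k)))
        (Subtype.val : U → L.CharDualTotal k) p)
      (gaugedDirac k hV p.1)) ∧
    L.IsCoisotropicEmbedding S
      (fun x => (⟨zeroSection (EuclideanSpace ℝ (Fin k)) L.CharDual x, h0 x⟩ : U))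

end DiracStructure

end Structures

end DiracGeom

end

open scoped Manifold ContDiff Bundle Topology
open Bundle Set TopologicalSpace

noncomputable section

namespace DiracGeom

universe u v w

set_option linter.unusedSectionVars false
set_option synthInstance.maxHeartbeats 200000
set_option maxHeartbeats 1000000

/-! ### Linear algebra of families of linear maps -/

section LinearFamilies

variable {R : Type*} [NormedAddCommGroup R] [NormedSpace ℝ R] [FiniteDimensional ℝ R]
  {S : Type*} [NormedAddCommGroup S] [NormedSpace ℝ S] [FiniteDimensional ℝ S]

/-! Necessity. Near a point `L` is the range of a smooth injective frame, and `L ∩ TM` is the kernel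
of its covector component, so its rank is upper semicontinuous. If `i` is a coisotropic embedding,
`i^*L_P = L` says that `v ∈ L ∩ TM` exactly when `di(v) = ♯ξ` for some conormal `ξ`, and coisotropy
says that every such `♯ξ` is tangent to `i(M)`. Hence `L ∩ TM ≅ ♯N^*i(M)` is also the image of a
continuous family of linear maps, and its rank is lower semicontinuous. So the rank is locally
constant (`eventually_charRank_le`, `IsCoisotropicEmbedding.eventually_le_charRank`).

Sufficiency. When the rank is constant, kernels of smooth families have smooth frames
(`exists_smooth_kernel_frame`). These frames give the bundle structure on `E^* = (L ∩ TM)^*`, and a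
partition of unity on projections onto `L ∩ TM` gives a complement. For any complement `V`, put `D =
τ_B(π^*L)` on `E^*`, with `B = i_V^*ω`. Three facts make `D` Poisson near the zero section.

Integrability is expressed by the Courant tensor `⟨[a, b], c⟩` of a frame. It vanishes for `L`, is
unchanged by pullback along a projection, and changes under a gauge transformation by `dB`, which is
zero because `B` is the differential of the pulled-back canonical 1-form (`courantTensor_pullback`,
`courantTensor_gauge`, `eventually_gaugeForm`).

An isotropic family of half dimension that meets the tangent spaces trivially is the graph of a
bivector, and for a graph the vanishing of the Courant tensor is the Jacobi identity
(`exists_poissonStructure`, `jacobi_of_courantTensor_eq_zero`).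

Trivial intersection with the tangent space is an open condition, and on the zero section it holds
because `B` pairs the fibre directions nondegenerately with `L ∩ TM` (`isOpen_transversal`,
`zeroSec_transversal`). The same computation gives coisotropy of the zero section, and `D` pulls
back to `L` because `B` vanishes on pairs of vectors tangent to the zero section. -/

theorem isInvertible_of_bijective {A : R →L[ℝ] S} (h : Function.Bijective A) :
    A.IsInvertible :=
  ⟨(LinearEquiv.ofBijective (A : R →ₗ[ℝ] S) h).toContinuousLinearEquiv, by ext; rfl⟩

theorem exists_clm_leftInverse {A : R →L[ℝ] S} (h : Function.Injective A) :
    ∃ B : S →L[ℝ] R, ∀ v, B (A v) = v := by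
  obtain ⟨B, hB⟩ := (A : R →ₗ[ℝ] S).exists_leftInverse_of_injective
    (LinearMap.ker_eq_bot.2 h)
  exact ⟨LinearMap.toContinuousLinearMap B, fun v => congrArg (fun f => f v) hB⟩

/-- `Q` retracts `S` onto the range of `A`, and `p` identifies the kernel with `ℝ^k`, so together
they detect both parts of `R`. Invertibility is an open condition, so the bordered map stays
invertible when `A` moves while `Q` and `p` stay fixed. Kernel dimensions and kernel frames are both
controlled this way. -/
theorem exists_bordering (A : R →L[ℝ] S) {k : ℕ}
    (hk : Module.finrank ℝ (LinearMap.ker (A : R →ₗ[ℝ] S)) = k) :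
    ∃ (Q : S →L[ℝ] LinearMap.range (A : R →ₗ[ℝ] S)) (p : R →L[ℝ] EuclideanSpace ℝ (Fin k)),
      ((Q.comp A).prod p).IsInvertible := by
  obtain ⟨q, hq⟩ := Submodule.exists_isCompl (LinearMap.ker (A : R →ₗ[ℝ] S))
  obtain ⟨Q, hQ⟩ := LinearMap.exists_leftInverse_of_injective
    (LinearMap.range (A : R →ₗ[ℝ] S)).subtype (by simp)
  let e : LinearMap.ker (A : R →ₗ[ℝ] S) ≃ₗ[ℝ] EuclideanSpace ℝ (Fin k) :=
    LinearEquiv.ofFinrankEq _ _ (by simpa using hk)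
  let p : R →ₗ[ℝ] EuclideanSpace ℝ (Fin k) :=
    e.toLinearMap ∘ₗ (LinearMap.ker (A : R →ₗ[ℝ] S)).projectionOnto q hq
  refine ⟨LinearMap.toContinuousLinearMap Q, LinearMap.toContinuousLinearMap p,
    isInvertible_of_bijective ?_⟩
  have hQA : ∀ v, Q (A v) = ⟨A v, ⟨v, rfl⟩⟩ := fun v =>
    congrArg (fun f => f (⟨A v, ⟨v, rfl⟩⟩ : LinearMap.range (A : R →ₗ[ℝ] S))) hQ
  have hinj : Function.Injective
      (((LinearMap.toContinuousLinearMap Q).comp A).prod (LinearMap.toContinuousLinearMap p)) := by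
    rw [injective_iff_map_eq_zero]
    intro v hv
    have h1 : Q (A v) = 0 := congrArg Prod.fst hv
    have h2 : p v = 0 := congrArg Prod.snd hv
    rw [hQA] at h1
    have h3 : v ∈ LinearMap.ker (A : R →ₗ[ℝ] S) := congrArg Subtype.val h1
    have h4 : (LinearMap.ker (A : R →ₗ[ℝ] S)).projectionOnto q hq v = 0 := by
      simpa [p] using h2
    rw [show v = ((⟨v, h3⟩ : LinearMap.ker (A : R →ₗ[ℝ] S)) : R) from rfl,
      Submodule.projectionOnto_apply_left] at h4
    exact congrArg Subtype.val h4
  refine ⟨hinj, ?_⟩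
  have hd : Module.finrank ℝ R = Module.finrank ℝ
      (LinearMap.range (A : R →ₗ[ℝ] S) × EuclideanSpace ℝ (Fin k)) := by
    rw [Module.finrank_prod, finrank_euclideanSpace_fin, ← hk]
    exact ((A : R →ₗ[ℝ] S).finrank_range_add_finrank_ker).symm
  exact (LinearMap.injective_iff_surjective_of_finrank_eq_finrank hd
    (f := ((((LinearMap.toContinuousLinearMap Q).comp A).prod
      (LinearMap.toContinuousLinearMap p) : R →L[ℝ] _) : R →ₗ[ℝ] _))).1 hinj

theorem contDiff_bordering {T T' : Type*} [NormedAddCommGroup T] [NormedSpace ℝ T]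
    [NormedAddCommGroup T'] [NormedSpace ℝ T'] (Q : S →L[ℝ] T) (p : R →L[ℝ] T') :
    ContDiff ℝ ∞ (fun B : R →L[ℝ] S => (Q.comp B).prod p) := by
  rw [contDiff_clm_apply_iff]
  intro v
  simp only [ContinuousLinearMap.prod_apply, ContinuousLinearMap.comp_apply]
  fun_prop

theorem isOpen_isInvertible : IsOpen {A : R →L[ℝ] S | A.IsInvertible} := by
  have : {A : R →L[ℝ] S | A.IsInvertible} = range ((↑) : (R ≃L[ℝ] S) → R →L[ℝ] S) := by
    ext A; rfl
  rw [this]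
  have := FiniteDimensional.complete ℝ R
  exact ContinuousLinearEquiv.isOpen

/-- The dimension of the kernel is upper semicontinuous. -/
theorem eventually_finrank_ker_le {X : Type*} [TopologicalSpace X] {A : X → R →L[ℝ] S} {x₀ : X}
    (hA : ContinuousAt A x₀) :
    ∀ᶠ x in 𝓝 x₀, Module.finrank ℝ (LinearMap.ker (A x : R →ₗ[ℝ] S)) ≤
      Module.finrank ℝ (LinearMap.ker (A x₀ : R →ₗ[ℝ] S)) := by
  obtain ⟨Q, p, h⟩ := exists_bordering (A x₀) rfl
  have hc : ContinuousAt (fun x => (Q.comp (A x)).prod p) x₀ :=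
    (contDiff_bordering Q p).continuous.continuousAt.comp hA
  filter_upwards [hc.eventually (isOpen_isInvertible.mem_nhds h)] with x hx
  have hinj : Function.Injective ((Q.comp (A x)).prod p) := by
    obtain ⟨e, he⟩ := hx
    rw [← he]; exact e.injective
  -- A kernel vector `v` of `A x` has bordered image `(0, p v)`, so `p` is injective on the kernel.
  let f : LinearMap.ker (A x : R →ₗ[ℝ] S) →ₗ[ℝ] EuclideanSpace ℝ
      (Fin (Module.finrank ℝ (LinearMap.ker (A x₀ : R →ₗ[ℝ] S)))) :=
    (p : R →ₗ[ℝ] _) ∘ₗ (LinearMap.ker (A x : R →ₗ[ℝ] S)).subtype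
  have hf : Function.Injective f := by
    rw [injective_iff_map_eq_zero]
    rintro ⟨v, hv⟩ h0
    have h0' : p v = 0 := h0
    have hv' : A x v = 0 := hv
    have := hinj (a₁ := v) (a₂ := 0) (by simp [h0', hv'])
    exact Subtype.ext this
  simpa using LinearMap.finrank_le_finrank_of_injective hf

theorem contDiffAt_clm_apply_iff {D T : Type*} [NormedAddCommGroup D] [NormedSpace ℝ D]
    [NormedAddCommGroup T] [NormedSpace ℝ T] {f : D → R →L[ℝ] T} {z : D} {n : WithTop ℕ∞} :
    ContDiffAt ℝ n f z ↔ ∀ y, ContDiffAt ℝ n (fun x => f x y) z := by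
  refine ⟨fun h y => h.clm_apply contDiffAt_const, fun h => ?_⟩
  let e₁ := ContinuousLinearEquiv.ofFinrankEq (𝕜 := ℝ) (E := R)
    (F := Fin (Module.finrank ℝ R) → ℝ) (Module.finrank_fin_fun ℝ).symm
  let e₂ := (e₁.arrowCongr (1 : T ≃L[ℝ] T)).trans (ContinuousLinearEquiv.piRing (Fin _))
  rw [← Function.id_comp f, ← e₂.symm_comp_self]
  exact e₂.symm.contDiff.contDiffAt.comp z (contDiffAt_pi.mpr fun i => h _)

variable {E : Type*} [NormedAddCommGroup E] [NormedSpace ℝ E]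
  {H : Type*} [TopologicalSpace H] {I : ModelWithCorners ℝ E H}
  {M : Type*} [TopologicalSpace M] [ChartedSpace H M]

theorem contMDiffAt_clm_inverse {n : WithTop ℕ∞} {A : M → R →L[ℝ] S} {x : M}
    (hA : ContMDiffAt I 𝓘(ℝ, R →L[ℝ] S) n A x) (h : (A x).IsInvertible) :
    ContMDiffAt I 𝓘(ℝ, S →L[ℝ] R) n (fun y => (A y).inverse) x := by
  have := FiniteDimensional.complete ℝ R
  exact (h.contDiffAt_map_inverse).contMDiffAt.comp x hA

/-- The kernels of a smooth family of linear maps of constant rank have a smooth frame. -/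
theorem exists_smooth_kernel_frame {A : M → R →L[ℝ] S} {U : Set M} {x₀ : M} {k : ℕ}
    (hU : IsOpen U) (hx : x₀ ∈ U) (hA : ContMDiffOn I 𝓘(ℝ, R →L[ℝ] S) ∞ A U)
    (hk : ∀ x ∈ U, Module.finrank ℝ (LinearMap.ker (A x : R →ₗ[ℝ] S)) = k) :
    ∃ U' ⊆ U, IsOpen U' ∧ x₀ ∈ U' ∧ ∃ K : M → EuclideanSpace ℝ (Fin k) →L[ℝ] R,
      ContMDiffOn I 𝓘(ℝ, EuclideanSpace ℝ (Fin k) →L[ℝ] R) ∞ K U' ∧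
      ∀ x ∈ U', Function.Injective (K x) ∧ ∀ v, A x v = 0 ↔ ∃ c, K x c = v := by
  obtain ⟨Q, p, h⟩ := exists_bordering (A x₀) (hk x₀ hx)
  let Ψ : M → R →L[ℝ] (LinearMap.range (A x₀ : R →ₗ[ℝ] S) × EuclideanSpace ℝ (Fin k)) :=
    fun x => (Q.comp (A x)).prod p
  have hΨ : ContMDiffOn I 𝓘(ℝ, R →L[ℝ] _) ∞ Ψ U :=
    (contDiff_bordering Q p).contMDiff.comp_contMDiffOn hA
  -- The frame is the second block of the inverse of the bordered family. Its range contains the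
  -- kernel, and the constant rank hypothesis forces equality.
  refine ⟨U ∩ Ψ ⁻¹' {B | B.IsInvertible}, inter_subset_left,
    hΨ.continuousOn.isOpen_inter_preimage hU isOpen_isInvertible, ⟨hx, h⟩,
    fun x => (Ψ x).inverse.comp (ContinuousLinearMap.inr ℝ _ _), ?_, ?_⟩
  · intro x hx
    have h1 := contMDiffAt_clm_inverse (hΨ.contMDiffAt (hU.mem_nhds hx.1)) hx.2
    have h2 : ContDiff ℝ ∞ (fun B : (LinearMap.range (A x₀ : R →ₗ[ℝ] S) ×
        EuclideanSpace ℝ (Fin k)) →L[ℝ] R => B.comp (ContinuousLinearMap.inr ℝ _ _)) := by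
      rw [contDiff_clm_apply_iff]
      intro v
      simp only [ContinuousLinearMap.comp_apply]
      fun_prop
    exact (h2.contMDiff.contMDiffAt.comp x h1).contMDiffWithinAt
  · rintro x ⟨hxU, hinv⟩
    have hl : ∀ v, (Ψ x).inverse (Ψ x v) = v := fun v => by
      rw [← ContinuousLinearMap.comp_apply, hinv.inverse_comp_self]; rfl
    have hr : ∀ v, Ψ x ((Ψ x).inverse v) = v := fun v => by
      rw [← ContinuousLinearMap.comp_apply, hinv.self_comp_inverse]; rfl
    set K := (Ψ x).inverse.comp (ContinuousLinearMap.inr ℝ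
      (LinearMap.range (A x₀ : R →ₗ[ℝ] S)) (EuclideanSpace ℝ (Fin k))) with hK
    have hinj : Function.Injective K := by
      intro c d hcd
      have := congrArg (Ψ x) hcd
      simp only [hK, ContinuousLinearMap.comp_apply, hr] at this
      exact congrArg Prod.snd this
    have hle : LinearMap.ker (A x : R →ₗ[ℝ] S) ≤
        LinearMap.range (K : EuclideanSpace ℝ (Fin k) →ₗ[ℝ] R) := by
      intro v hv
      have hv' : A x v = 0 := hv
      refine ⟨p v, ?_⟩
      have : Ψ x v = (0, p v) := by simp [Ψ, hv']
      show (Ψ x).inverse (0, p v) = v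
      rw [← this, hl]
    have heq := Submodule.eq_of_le_of_finrank_eq hle (by
      rw [hk x hxU, LinearMap.finrank_range_of_inj hinj]; simp)
    refine ⟨hinj, fun v => ?_⟩
    rw [show A x v = 0 ↔ v ∈ LinearMap.ker (A x : R →ₗ[ℝ] S) from Iff.rfl, heq]
    rfl

end LinearFamilies

/-! ### The Courant tensor of a frame on a vector space -/

section Euclidean

variable {F : Type*} [NormedAddCommGroup F] [NormedSpace ℝ F]
  {R : Type*} [NormedAddCommGroup R] [NormedSpace ℝ R]

/-- The symmetric pairing on `F ⊕ F^*`. -/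
def pairing (a b : F × (F →L[ℝ] ℝ)) : ℝ := b.2 a.1 + a.2 b.1

/-- The Courant tensor `⟨[a, b], c⟩` of a family of isotropic subspaces of `F ⊕ F^*`, which are
the ranges of the maps `G z`. -/
def courantTensor (G : F → R →L[ℝ] F × (F →L[ℝ] ℝ)) (z : F) (a b c : R) : ℝ :=
  pairing (fderiv ℝ G z (G z a).1 b) (G z c) + pairing (fderiv ℝ G z (G z b).1 c) (G z a) +
    pairing (fderiv ℝ G z (G z c).1 a) (G z b)

theorem hasFDerivAt_apply_const {S : Type*} [NormedAddCommGroup S] [NormedSpace ℝ S]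
    {G : F → R →L[ℝ] S} {z : F} (hG : DifferentiableAt ℝ G z) (b : R) :
    HasFDerivAt (fun y => G y b) ((fderiv ℝ G z).flip b) z :=
  (hG.hasFDerivAt.clm_apply (hasFDerivAt_const b z)).congr_fderiv (by ext; simp)

/-- For the graph of `P` the Courant tensor is the cyclic sum of `γ (DP(Pα) β)`, which is the
Schouten bracket of `P` with itself. The other terms of the Jacobi expression contain second
derivatives of the functions and cancel by their symmetry. -/
theorem jacobi_of_courantTensor_eq_zero {G : F → R →L[ℝ] F × (F →L[ℝ] ℝ)}
    {P : F → (F →L[ℝ] ℝ) →L[ℝ] F} {z : F} (hG : DifferentiableAt ℝ G z)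
    (hP : DifferentiableAt ℝ P z) (hgr : ∀ᶠ y in 𝓝 z, ∀ c, (G y c).1 = P y (G y c).2)
    (hskew : ∀ ξ η : F →L[ℝ] ℝ, η (P z ξ) = - ξ (P z η))
    (hsurj : ∀ ξ, ∃ c, (G z c).2 = ξ) (hT : ∀ a b c, courantTensor G z a b c = 0)
    {f g h : F → ℝ} (hf : ContDiffAt ℝ 2 f z) (hg : ContDiffAt ℝ 2 g z)
    (hh : ContDiffAt ℝ 2 h z) :
    fderiv ℝ (fun y => fderiv ℝ h y (P y (fderiv ℝ g y))) z (P z (fderiv ℝ f z)) +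
      fderiv ℝ (fun y => fderiv ℝ f y (P y (fderiv ℝ h y))) z (P z (fderiv ℝ g z)) +
      fderiv ℝ (fun y => fderiv ℝ g y (P y (fderiv ℝ f y))) z (P z (fderiv ℝ h z)) = 0 := by
  -- Differentiate `(G c).1 = P (G c).2`. The terms that contain the derivative of the covector
  -- component cancel by skewness, and only the derivative of `P` survives.
  have key : ∀ v c d, pairing (fderiv ℝ G z v c) (G z d) =
      (G z d).2 (fderiv ℝ P z v (G z c).2) := by
    intro v c d
    have h1 := hasFDerivAt_apply_const hG c
    have h2 : HasFDerivAt (fun y => (G y c).1) _ z := h1.fst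
    have h3 : HasFDerivAt (fun y => P y (G y c).2) _ z := hP.hasFDerivAt.clm_apply h1.snd
    have h4 := h2.unique (h3.congr_of_eventuallyEq (hgr.mono fun y hy => hy c))
    have h5 := congrArg (fun L => L v) h4
    simp only [ContinuousLinearMap.comp_apply, ContinuousLinearMap.flip_apply,
      add_apply, ContinuousLinearMap.coe_fst',
      ContinuousLinearMap.coe_snd'] at h5
    rw [pairing, h5, (hgr.self_of_nhds) d, map_add, hskew (G z d).2]
    ring
  have J : ∀ α β γ : F →L[ℝ] ℝ, γ (fderiv ℝ P z (P z α) β) + α (fderiv ℝ P z (P z β) γ) +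
      β (fderiv ℝ P z (P z γ) α) = 0 := by
    intro α β γ
    obtain ⟨a, rfl⟩ := hsurj α
    obtain ⟨b, rfl⟩ := hsurj β
    obtain ⟨c, rfl⟩ := hsurj γ
    have := hT a b c
    rwa [courantTensor, key, key, key, hgr.self_of_nhds a, hgr.self_of_nhds b,
      hgr.self_of_nhds c] at this
  have D : ∀ g h : F → ℝ, ContDiffAt ℝ 2 g z → ContDiffAt ℝ 2 h z → ∀ v,
      fderiv ℝ (fun y => fderiv ℝ h y (P y (fderiv ℝ g y))) z v =
        fderiv ℝ (fderiv ℝ h) z v (P z (fderiv ℝ g z)) +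
        fderiv ℝ h z (fderiv ℝ P z v (fderiv ℝ g z)) -
        fderiv ℝ (fderiv ℝ g) z v (P z (fderiv ℝ h z)) := by
    intro g h hg hh v
    have hg' := ((hg.fderiv_right (m := 1) (by norm_num)).differentiableAt (by norm_num)).hasFDerivAt
    have hh' := ((hh.fderiv_right (m := 1) (by norm_num)).differentiableAt (by norm_num)).hasFDerivAt
    rw [(hh'.clm_apply (hP.hasFDerivAt.clm_apply hg')).fderiv]
    simp only [ContinuousLinearMap.comp_apply, ContinuousLinearMap.flip_apply,
      add_apply, map_add]
    rw [hskew (fderiv ℝ (fderiv ℝ g) z v)]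
    ring
  have hs : ∀ g : F → ℝ, ContDiffAt ℝ 2 g z → ∀ v w,
      fderiv ℝ (fderiv ℝ g) z v w = fderiv ℝ (fderiv ℝ g) z w v :=
    fun g hg v w => (hg.isSymmSndFDerivAt (by simp)) v w
  rw [D g h hg hh, D h f hh hf, D f g hf hg, hs h hh, hs f hf, hs g hg (P z (fderiv ℝ h z))]
  linarith [J (fderiv ℝ f z) (fderiv ℝ g z) (fderiv ℝ h z)]

/-- In each pairing the terms that contain `B` undifferentiated cancel by antisymmetry. What remains
is `DB` on the vector components, whose cyclic sum is `dB = 0`. -/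
theorem courantTensor_gauge {G G' : F → R →L[ℝ] F × (F →L[ℝ] ℝ)} {B : F → F →L[ℝ] F →L[ℝ] ℝ}
    {z : F} (hG : DifferentiableAt ℝ G z) (hG' : DifferentiableAt ℝ G' z)
    (hB : DifferentiableAt ℝ B z)
    (hGG' : ∀ᶠ y in 𝓝 z, ∀ c, G' y c = ((G y c).1, (G y c).2 + B y (G y c).1))
    (hanti : ∀ v w, B z v w = - B z w v)
    (hclosed : ∀ u v w, fderiv ℝ B z u v w + fderiv ℝ B z v w u + fderiv ℝ B z w u v = 0)
    (a b c : R) : courantTensor G' z a b c = courantTensor G z a b c := by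
  have key : ∀ v c d, pairing (fderiv ℝ G' z v c) (G' z d) =
      pairing (fderiv ℝ G z v c) (G z d) + fderiv ℝ B z v (G z c).1 (G z d).1 := by
    intro v c d
    have h1 := hasFDerivAt_apply_const hG c
    have h3 := (h1.fst.prodMk (h1.snd.add (hB.hasFDerivAt.clm_apply h1.fst)))
    have h4 := (hasFDerivAt_apply_const hG' c).unique
      (h3.congr_of_eventuallyEq (hGG'.mono fun y hy => hy c))
    have h5 : fderiv ℝ G' z v c = _ := congrArg (fun L => L v) h4
    rw [h5, hGG'.self_of_nhds d]
    simp only [pairing, ContinuousLinearMap.prod_apply, ContinuousLinearMap.comp_apply,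
      ContinuousLinearMap.flip_apply, add_apply, ContinuousLinearMap.coe_fst',
      ContinuousLinearMap.coe_snd']
    rw [hanti (G z d).1]
    ring
  have h1 : ∀ c, (G' z c).1 = (G z c).1 := fun c => by rw [hGG'.self_of_nhds c]
  simp only [courantTensor, key, h1]
  linarith [hclosed (G z a).1 (G z b).1 (G z c).1]

/-- The exterior derivative of a `1`-form on a vector space. -/
def vecD1 (θ : F → F →L[ℝ] ℝ) (z : F) : F →L[ℝ] F →L[ℝ] ℝ := fderiv ℝ θ z - (fderiv ℝ θ z).flip

theorem vecD1_apply (θ : F → F →L[ℝ] ℝ) (z v w : F) :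
    vecD1 θ z v w = fderiv ℝ θ z v w - fderiv ℝ θ z w v := rfl

theorem contDiffAt_vecD1 [FiniteDimensional ℝ F] {θ : F → F →L[ℝ] ℝ} {z : F} {m n : WithTop ℕ∞}
    (h : ContDiffAt ℝ n θ z) (hmn : m + 1 ≤ n) : ContDiffAt ℝ m (vecD1 θ) z := by
  have h1 : ContDiffAt ℝ m (fderiv ℝ θ) z := h.fderiv_right hmn
  refine contDiffAt_clm_apply_iff.2 fun v => contDiffAt_clm_apply_iff.2 fun w => ?_
  exact ((h1.clm_apply contDiffAt_const).clm_apply contDiffAt_const).sub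
    ((h1.clm_apply contDiffAt_const).clm_apply contDiffAt_const)

/-- This is `d ∘ d = 0`: the six second derivatives of `θ` cancel in pairs. -/
theorem fderiv_vecD1_cyclic [FiniteDimensional ℝ F] {θ : F → F →L[ℝ] ℝ} {z : F}
    (h : ContDiffAt ℝ 2 θ z) (u v w : F) :
    fderiv ℝ (vecD1 θ) z u v w + fderiv ℝ (vecD1 θ) z v w u + fderiv ℝ (vecD1 θ) z w u v = 0 := by
  have hd := (h.fderiv_right (m := 1) (by norm_num)).differentiableAt (by norm_num)
  have hD : DifferentiableAt ℝ (vecD1 θ) z :=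
    (contDiffAt_vecD1 (m := 1) h (by norm_num)).differentiableAt (by norm_num)
  have hs : ∀ v w, fderiv ℝ (fderiv ℝ θ) z v w = fderiv ℝ (fderiv ℝ θ) z w v :=
    fun v w => (h.isSymmSndFDerivAt (by simp)) v w
  have e2 : ∀ (f : F → F →L[ℝ] F →L[ℝ] ℝ), DifferentiableAt ℝ f z → ∀ v w,
      HasFDerivAt (fun y => f y v w) (((fderiv ℝ f z).flip v).flip w) z := fun f hf v w =>
    ((hasFDerivAt_apply_const hf v).clm_apply (hasFDerivAt_const w z)).congr_fderiv (by ext; simp)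
  have e : ∀ u v w, fderiv ℝ (vecD1 θ) z u v w =
      fderiv ℝ (fderiv ℝ θ) z u v w - fderiv ℝ (fderiv ℝ θ) z u w v := by
    intro u v w
    exact congrArg (fun L => L u) ((e2 _ hD v w).unique ((e2 _ hd v w).sub (e2 _ hd w v)))
  rw [e, e, e, hs u v, hs v w, hs w u]
  ring

variable {F' : Type*} [NormedAddCommGroup F'] [NormedSpace ℝ F']

/-- The second derivative of `h` enters symmetrically and drops out of the antisymmetrization. -/
theorem vecD1_pullback {h : F → F'} {a : F' → F' →L[ℝ] ℝ} {z : F}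
    (ha : DifferentiableAt ℝ a (h z)) (hh : ContDiffAt ℝ 2 h z) (v w : F) :
    vecD1 (fun y => (a (h y)).comp (fderiv ℝ h y)) z v w =
      vecD1 a (h z) (fderiv ℝ h z v) (fderiv ℝ h z w) := by
  have hd := ((hh.fderiv_right (m := 1) (by norm_num)).differentiableAt (by norm_num)).hasFDerivAt
  have h0 := (hh.differentiableAt (by norm_num)).hasFDerivAt
  have h1 : HasFDerivAt (fun y => (a (h y)).comp (fderiv ℝ h y)) _ z :=
    (ha.hasFDerivAt.comp z h0).clm_comp hd
  have hs : fderiv ℝ (fderiv ℝ h) z v w = fderiv ℝ (fderiv ℝ h) z w v :=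
    (hh.isSymmSndFDerivAt (by simp)) v w
  rw [vecD1_apply, vecD1_apply, h1.fderiv]
  simp [hs]

/-- The frame does not depend on the fibre variable, and its covectors do not see the fibre
directions. Each pairing is therefore computed on the base. -/
theorem courantTensor_pullback {g : F → R →L[ℝ] F × (F →L[ℝ] ℝ)}
    {G : F × F' → (R × F') →L[ℝ] (F × F') × (F × F' →L[ℝ] ℝ)} {z : F × F'}
    (hg : DifferentiableAt ℝ g z.1) (hG : DifferentiableAt ℝ G z)
    (hGg : ∀ᶠ y in 𝓝 z, ∀ c, G y c =
      (((g y.1 c.1).1, c.2), (g y.1 c.1).2.comp (ContinuousLinearMap.fst ℝ F F')))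
    (a b c : R × F') : courantTensor G z a b c = courantTensor g z.1 a.1 b.1 c.1 := by
  have key : ∀ v c d, pairing (fderiv ℝ G z v c) (G z d) =
      pairing (fderiv ℝ g z.1 v.1 c.1) (g z.1 d.1) := by
    intro v c d
    have h1 : HasFDerivAt (fun y : F × F' => g y.1 c.1) _ z :=
      (hasFDerivAt_apply_const hg c.1).comp z hasFDerivAt_fst
    have h3 := ((h1.fst.prodMk (hasFDerivAt_const c.2 z)).prodMk
      (h1.snd.clm_comp (hasFDerivAt_const (ContinuousLinearMap.fst ℝ F F') z)))
    have h4 := (hasFDerivAt_apply_const hG c).unique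
      (h3.congr_of_eventuallyEq (hGg.mono fun y hy => hy c))
    have h5 : fderiv ℝ G z v c = _ := congrArg (fun L => L v) h4
    rw [h5, hGg.self_of_nhds d]
    simp [pairing]
  have h1 : ∀ c, (G z c).1.1 = (g z.1 c.1).1 := fun c => by rw [hGg.self_of_nhds c]
  simp only [courantTensor, key, h1]

end Euclidean

/-! ### Vector fields and forms in a chart -/

section Charts

variable {E : Type u} [NormedAddCommGroup E] [NormedSpace ℝ E]
  {H : Type v} [TopologicalSpace H] (I : ModelWithCorners ℝ E H)
  {M : Type w} [TopologicalSpace M] [ChartedSpace H M] [IsManifold I ∞ M]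

/-- The trivialization of the tangent bundle near `x₀`, at the point `x`. -/
def toModel (x₀ x : M) : TangentSpace I x →L[ℝ] E :=
  (trivializationAt E (TangentSpace I : M → Type u) x₀).continuousLinearMapAt ℝ x

/-- The inverse of the trivialization of the tangent bundle near `x₀`, at the point `x`. -/
def ofModel (x₀ x : M) : E →L[ℝ] TangentSpace I x :=
  (trivializationAt E (TangentSpace I : M → Type u) x₀).symmL ℝ x

variable {I}

theorem toModel_ofModel {x₀ x : M} (hx : x ∈ (chartAt H x₀).source) (v : E) :
    toModel I x₀ x (ofModel I x₀ x v) = v :=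
  (trivializationAt E (TangentSpace I : M → Type u) x₀).continuousLinearMapAt_symmL
    (by simpa using hx) v

theorem ofModel_toModel {x₀ x : M} (hx : x ∈ (chartAt H x₀).source) (v : TangentSpace I x) :
    ofModel I x₀ x (toModel I x₀ x v) = v :=
  (trivializationAt E (TangentSpace I : M → Type u) x₀).symmL_continuousLinearMapAt
    (by simpa using hx) v

theorem toModel_eq_mfderiv {x₀ x : M} (hx : x ∈ (chartAt H x₀).source) :
    toModel I x₀ x = (mfderiv I 𝓘(ℝ, E) (extChartAt I x₀) x : TangentSpace I x →L[ℝ] E) :=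
  TangentBundle.continuousLinearMapAt_trivializationAt hx

theorem ofModel_eq_mfderiv [I.Boundaryless] {x₀ x : M} (hx : x ∈ (chartAt H x₀).source) :
    ofModel I x₀ x = (mfderiv 𝓘(ℝ, E) I (extChartAt I x₀).symm (extChartAt I x₀ x) :
      E →L[ℝ] TangentSpace I ((extChartAt I x₀).symm (extChartAt I x₀ x))) := by
  have := TangentBundle.symmL_trivializationAt (I := I) hx
  rw [I.range_eq_univ, mfderivWithin_univ] at this
  exact this

/-- The tangent space at `x` is the model space by way of the preferred chart at `x`, so no
transition map appears at the centre of that chart. Pointwise identities are therefore checked at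
chart centres. -/
theorem toModel_self (x : M) : toModel I x x = ContinuousLinearMap.id ℝ E := by
  rw [toModel_eq_mfderiv (mem_chart_source H x)]
  exact mfderiv_extChartAt_self

theorem ofModel_self (x : M) : ofModel I x x = ContinuousLinearMap.id ℝ E := by
  ext v
  have h := toModel_ofModel (I := I) (mem_chart_source H x) v
  rw [toModel_self] at h
  exact h

theorem smoothVectorFieldOn_iff {X : Π x : M, TangentSpace I x} {U : Set M} {x₀ : M}
    (hU : IsOpen U) (hUs : U ⊆ (chartAt H x₀).source) :
    SmoothVectorFieldOn I X U ↔ ContMDiffOn I 𝓘(ℝ, E) ∞ (fun x => toModel I x₀ x (X x)) U := by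
  have h := (trivializationAt E (TangentSpace I : M → Type u) x₀).contMDiffOn_section_iff
    (IB := I) (n := ∞) (s := X) (a := U) hU (by simpa using hUs)
  refine h.trans (contMDiffOn_congr fun x hx => ?_)
  have hb : x ∈ (trivializationAt E (TangentSpace I : M → Type u) x₀).baseSet := by
    simpa using hUs hx
  exact ((trivializationAt E (TangentSpace I : M → Type u) x₀).continuousLinearMapAt_apply_of_mem
    ℝ hb (X x)).symm

variable (I) in
/-- A covector at `x` read in the trivialization near `x₀`. -/
def covectorToModel (x₀ x : M) (α : Cotangent I x) : E →L[ℝ] ℝ := α.comp (ofModel I x₀ x)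

theorem covectorToModel_apply (x₀ x : M) (α : Cotangent I x) (v : E) :
    covectorToModel I x₀ x α v = α (ofModel I x₀ x v) := rfl

theorem trivializationAt_cotangent {x₀ x : M} (hx : x ∈ (chartAt H x₀).source)
    (α : Cotangent I x) :
    (trivializationAt (E →L[ℝ] ℝ) (fun x : M => Cotangent I x) x₀ ⟨x, α⟩).2 =
      covectorToModel I x₀ x α := by
  rw [hom_trivializationAt_apply]
  rw [ContinuousLinearMap.inCoordinates_eq (by simpa using hx) (by simp)]
  ext v
  simp [covectorToModel, ofModel,
    (trivializationAt E (TangentSpace I : M → Type u) x₀).symmL_apply (R := ℝ) (by simpa using hx)]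

theorem smoothOneFormOn_iff {α : Π x : M, Cotangent I x} {U : Set M} {x₀ : M}
    (hU : IsOpen U) (hUs : U ⊆ (chartAt H x₀).source) :
    SmoothOneFormOn I α U ↔
      ContMDiffOn I 𝓘(ℝ, E →L[ℝ] ℝ) ∞
        (fun x => covectorToModel I x₀ x (α x)) U := by
  have h := (trivializationAt (E →L[ℝ] ℝ) (fun x : M => Cotangent I x) x₀).contMDiffOn_section_iff
    (IB := I) (n := ∞) (s := α) (a := U) hU (by simpa using hUs)
  refine h.trans ?_
  refine contMDiffOn_congr fun x hx => ?_
  exact trivializationAt_cotangent (hUs hx) (α x)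

theorem contDiffAt_comp_extChartAt_symm [I.Boundaryless] {S : Type*} [NormedAddCommGroup S]
    [NormedSpace ℝ S] {f : M → S} {x₀ : M} (hf : ContMDiffAt I 𝓘(ℝ, S) ∞ f x₀) :
    ContDiffAt ℝ ∞ (fun u => f ((extChartAt I x₀).symm u)) (extChartAt I x₀ x₀) := by
  rw [← contMDiffAt_iff_contDiffAt]
  have h1 : ContMDiffAt 𝓘(ℝ, E) I ∞ (extChartAt I x₀).symm (extChartAt I x₀ x₀) :=
    (contMDiffOn_extChartAt_symm x₀).contMDiffAt (extChartAt_target_mem_nhds x₀)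
  exact ContMDiffAt.comp (extChartAt I x₀ x₀) (by simpa using hf) h1

theorem eventually_extChartAt_symm_mem [I.Boundaryless] {x₀ : M} {U : Set M} (hU : U ∈ 𝓝 x₀) :
    ∀ᶠ u in 𝓝 (extChartAt I x₀ x₀), (extChartAt I x₀).symm u ∈ U := by
  have := continuousAt_extChartAt_symm (I := I) x₀
  exact this.eventually (by simpa using hU)

theorem eventually_extChartAt_symm_mem_source [I.Boundaryless] (x₀ : M) :
    ∀ᶠ u in 𝓝 (extChartAt I x₀ x₀), (extChartAt I x₀).symm u ∈ (chartAt H x₀).source ∧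
      extChartAt I x₀ ((extChartAt I x₀).symm u) = u := by
  filter_upwards [extChartAt_target_mem_nhds (I := I) x₀] with u hu
  refine ⟨?_, (extChartAt I x₀).right_inv hu⟩
  simpa using (extChartAt I x₀).map_target hu

variable (I) in
/-- A vector field read in the preferred chart at `x₀`. -/
def vectorFieldInChart (X : Π x : M, TangentSpace I x) (x₀ : M) (u : E) : E :=
  toModel I x₀ ((extChartAt I x₀).symm u) (X ((extChartAt I x₀).symm u))

theorem oneFormInChart_eq [I.Boundaryless] (α : Π x : M, Cotangent I x) (x₀ : M) :
    ∀ᶠ u in 𝓝 (extChartAt I x₀ x₀), oneFormInChart I α x₀ u =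
      covectorToModel I x₀ ((extChartAt I x₀).symm u) (α ((extChartAt I x₀).symm u)) := by
  filter_upwards [eventually_extChartAt_symm_mem_source (I := I) x₀] with u hu
  have h := ofModel_eq_mfderiv (I := I) hu.1
  rw [hu.2] at h
  rw [oneFormInChart, I.range_eq_univ, mfderivWithin_univ, covectorToModel, h]

theorem contDiffAt_vectorFieldInChart [I.Boundaryless] {X : Π x : M, TangentSpace I x} {U : Set M}
    {x₀ : M} (hX : SmoothVectorFieldOn I X U) (hU : U ∈ 𝓝 x₀) :
    ContDiffAt ℝ ∞ (vectorFieldInChart I X x₀) (extChartAt I x₀ x₀) := by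
  have h1 : SmoothVectorFieldOn I X (interior U ∩ (chartAt H x₀).source) :=
    hX.mono (inter_subset_left.trans interior_subset)
  rw [smoothVectorFieldOn_iff (isOpen_interior.inter (chartAt H x₀).open_source)
    inter_subset_right] at h1
  exact contDiffAt_comp_extChartAt_symm (h1.contMDiffAt
    (Filter.inter_mem (interior_mem_nhds.2 hU) (chart_source_mem_nhds H x₀)))

theorem contDiffAt_oneFormInChart [I.Boundaryless] {α : Π x : M, Cotangent I x} {U : Set M}
    {x₀ : M} (hα : SmoothOneFormOn I α U) (hU : U ∈ 𝓝 x₀) :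
    ContDiffAt ℝ ∞ (oneFormInChart I α x₀) (extChartAt I x₀ x₀) := by
  have h1 : SmoothOneFormOn I α (interior U ∩ (chartAt H x₀).source) :=
    hα.mono (inter_subset_left.trans interior_subset)
  rw [smoothOneFormOn_iff (isOpen_interior.inter (chartAt H x₀).open_source)
    inter_subset_right] at h1
  exact (contDiffAt_comp_extChartAt_symm (h1.contMDiffAt
    (Filter.inter_mem (interior_mem_nhds.2 hU) (chart_source_mem_nhds H x₀)))).congr_of_eventuallyEq
    (oneFormInChart_eq α x₀)

theorem eventually_oneFormInChart_apply [I.Boundaryless] (α : Π x : M, Cotangent I x)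
    (X : Π x : M, TangentSpace I x) (x₀ : M) :
    ∀ᶠ u in 𝓝 (extChartAt I x₀ x₀), oneFormInChart I α x₀ u (vectorFieldInChart I X x₀ u) =
      α ((extChartAt I x₀).symm u) (X ((extChartAt I x₀).symm u)) := by
  filter_upwards [eventually_extChartAt_symm_mem_source (I := I) x₀, oneFormInChart_eq α x₀]
    with u hu h
  rw [h, covectorToModel_apply, vectorFieldInChart, ofModel_toModel hu.1]

theorem d1_apply [I.Boundaryless] (α : Π x : M, Cotangent I x) (x : M) (v w : E) :
    (d1 I α x : E →ₗ[ℝ] (E →L[ℝ] ℝ)) v w =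
      vecD1 (oneFormInChart I α x) (extChartAt I x x) v w := by
  have h : (mfderiv I 𝓘(ℝ, E) (extChartAt I x) x : TangentSpace I x →L[ℝ] E) =
    ContinuousLinearMap.id ℝ E := mfderiv_extChartAt_self
  simp only [d1]
  rw [h, I.range_eq_univ, fderivWithin_univ]
  rfl

theorem d0_apply [I.Boundaryless] {f : M → ℝ} {x : M} (hf : MDifferentiableAt I 𝓘(ℝ, ℝ) f x)
    (v : E) : (d0 I f x : E →L[ℝ] ℝ) v =
      fderiv ℝ (fun u => f ((extChartAt I x).symm u)) (extChartAt I x x) v := by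
  rw [d0, hf.mfderiv, I.range_eq_univ, fderivWithin_univ]
  rfl

theorem mlieBracket_eq [I.Boundaryless] (X Y : Π x : M, TangentSpace I x) (x : M) :
    (VectorField.mlieBracket I X Y x : E) =
      VectorField.lieBracket ℝ (vectorFieldInChart I X x) (vectorFieldInChart I Y x)
        (extChartAt I x x) := by
  have h : (mfderiv I 𝓘(ℝ, E) (extChartAt I x) x : TangentSpace I x →L[ℝ] E) =
    ContinuousLinearMap.id ℝ E := mfderiv_extChartAt_self
  have key : ∀ Z : Π x : M, TangentSpace I x,
      (VectorField.mpullbackWithin 𝓘(ℝ, E) I (extChartAt I x).symm Z (range I) : E → E)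
        =ᶠ[𝓝 (extChartAt I x x)] vectorFieldInChart I Z x := by
    intro Z
    filter_upwards [eventually_extChartAt_symm_mem_source (I := I) x] with u hu
    have h2 := ofModel_eq_mfderiv (I := I) hu.1
    rw [hu.2] at h2
    have h3 : (ofModel I x ((extChartAt I x).symm u)).inverse =
        toModel I x ((extChartAt I x).symm u) :=
      ContinuousLinearMap.inverse_eq (by ext v; exact ofModel_toModel hu.1 v)
        (by ext v; exact toModel_ofModel hu.1 v)
    rw [VectorField.mpullbackWithin_apply, I.range_eq_univ, mfderivWithin_univ, ← h2]
    exact congrArg (fun A => A (Z ((extChartAt I x).symm u))) h3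
  have h4 : ∀ (A : E →L[ℝ] E) (V W V' W' : E → E), A = ContinuousLinearMap.id ℝ E →
      V =ᶠ[𝓝 (extChartAt I x x)] V' → W =ᶠ[𝓝 (extChartAt I x x)] W' →
      A.inverse (VectorField.lieBracketWithin ℝ V W
        ((extChartAt I x).symm ⁻¹' univ ∩ range I) (extChartAt I x x)) =
      VectorField.lieBracket ℝ V' W' (extChartAt I x x) := by
    rintro A V W V' W' rfl hV hW
    rw [preimage_univ, univ_inter, I.range_eq_univ, VectorField.lieBracketWithin_univ,
      ContinuousLinearMap.inverse_id]
    exact hV.lieBracket_vectorField_eq hW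
  exact h4 _ _ _ _ _ h (key X) (key Y)

end Charts

/-! ### Finite families of vectors as linear maps. -/

section FrameMap

variable {S : Type*} [NormedAddCommGroup S] [NormedSpace ℝ S]

/-- The map `c ↦ ∑ cᵢ wᵢ` of a finite family of vectors. -/
def frameCLM {m : ℕ} (w : Fin m → S) : (Fin m → ℝ) →L[ℝ] S :=
  LinearMap.toContinuousLinearMap (Fintype.linearCombination ℝ w)

theorem frameCLM_apply {m : ℕ} (w : Fin m → S) (c : Fin m → ℝ) :
    frameCLM w c = ∑ i, c i • w i := rfl

theorem contDiff_frameCLM {m : ℕ} : ContDiff ℝ ∞ (frameCLM : (Fin m → S) → _) := by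
  rw [contDiff_clm_apply_iff]
  intro c
  simp only [frameCLM_apply]
  fun_prop

end FrameMap

/-! ### Sections of a Dirac structure in a chart. -/

section Charts

variable {E : Type u} [NormedAddCommGroup E] [NormedSpace ℝ E]
  {H : Type v} [TopologicalSpace H] {I : ModelWithCorners ℝ E H}
  {M : Type w} [TopologicalSpace M] [ChartedSpace H M] [IsManifold I ∞ M] [I.Boundaryless]

theorem vectorFieldInChart_self (X : Π x : M, TangentSpace I x) (x : M) :
    vectorFieldInChart I X x (extChartAt I x x) = (X x : E) := by
  have h : ∀ y : M, y = x → toModel I x y (X y) = (X x : E) := by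
    rintro _ rfl; rw [toModel_self]; rfl
  exact h _ (extChartAt_to_inv x)

theorem oneFormInChart_self (α : Π x : M, Cotangent I x) (x : M) :
    oneFormInChart I α x (extChartAt I x x) = (α x : E →L[ℝ] ℝ) := by
  rw [(oneFormInChart_eq α x).self_of_nhds]
  have h : ∀ y : M, y = x → covectorToModel I x y (α y) = (α x : E →L[ℝ] ℝ) := by
    rintro _ rfl; rw [covectorToModel, ofModel_self]; rfl
  exact h _ (extChartAt_to_inv x)

theorem mdifferentiableAt_of_comp_symm {S : Type*} [NormedAddCommGroup S] [NormedSpace ℝ S]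
    {f : M → S} {x : M}
    (hf : DifferentiableAt ℝ (fun u => f ((extChartAt I x).symm u)) (extChartAt I x x)) :
    MDifferentiableAt I 𝓘(ℝ, S) f x := by
  have h1 : MDifferentiableAt I 𝓘(ℝ, E) (extChartAt I x) x :=
    mdifferentiableAt_extChartAt (mem_chart_source H x)
  have h2 := hf.mdifferentiableAt.comp x h1
  refine h2.congr_of_eventuallyEq ?_
  filter_upwards [extChartAt_source_mem_nhds (I := I) x] with y hy
  exact congrArg f ((extChartAt I x).left_inv hy).symm

variable (I) in
/-- A section of `TM ⊕ T^*M` read in the preferred chart at `x₀`. -/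
def sectionInChart (X : Π x : M, TangentSpace I x) (α : Π x : M, Cotangent I x) (x₀ : M) (u : E) :
    E × (E →L[ℝ] ℝ) :=
  (vectorFieldInChart I X x₀ u, oneFormInChart I α x₀ u)

variable (L : DiracStructure I M)

/-- Closedness and isotropy give `⟨[a, b], c⟩ = 0`. Differentiating the relations `⟨a, c⟩ = 0` and
`⟨a, b⟩ = 0` turns this expression into a sum that is cyclic in the three sections and contains no
exterior derivative. -/
theorem DiracStructure.courant_eq_zero {U : Set M} (hU : IsOpen U) {x₀ : M} (hx : x₀ ∈ U)
    {X Y Z : Π x : M, TangentSpace I x} {α β γ : Π x : M, Cotangent I x}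
    (hX : SmoothVectorFieldOn I X U) (hα : SmoothOneFormOn I α U)
    (hY : SmoothVectorFieldOn I Y U) (hβ : SmoothOneFormOn I β U)
    (hZ : SmoothVectorFieldOn I Z U) (hγ : SmoothOneFormOn I γ U)
    (ha : ∀ x ∈ U, (X x, α x) ∈ L.fiber x) (hb : ∀ x ∈ U, (Y x, β x) ∈ L.fiber x)
    (hc : ∀ x ∈ U, (Z x, γ x) ∈ L.fiber x) {u : E} (hu : u = extChartAt I x₀ x₀) :
    pairing (fderiv ℝ (sectionInChart I Y β x₀) u (vectorFieldInChart I X x₀ u))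
        (sectionInChart I Z γ x₀ u) +
      pairing (fderiv ℝ (sectionInChart I Z γ x₀) u (vectorFieldInChart I Y x₀ u))
        (sectionInChart I X α x₀ u) +
      pairing (fderiv ℝ (sectionInChart I X α x₀) u (vectorFieldInChart I Z x₀ u))
        (sectionInChart I Y β x₀ u) = 0 := by
  have hUn := hU.mem_nhds hx
  have dV : ∀ {X : Π x : M, TangentSpace I x}, SmoothVectorFieldOn I X U →
      HasFDerivAt (vectorFieldInChart I X x₀) (fderiv ℝ (vectorFieldInChart I X x₀) u) u :=
    fun h => hu ▸ ((contDiffAt_vectorFieldInChart h hUn).differentiableAt (by simp)).hasFDerivAt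
  have dF : ∀ {α : Π x : M, Cotangent I x}, SmoothOneFormOn I α U →
      HasFDerivAt (oneFormInChart I α x₀) (fderiv ℝ (oneFormInChart I α x₀) u) u :=
    fun h => hu ▸ ((contDiffAt_oneFormInChart h hUn).differentiableAt (by simp)).hasFDerivAt
  have dS : ∀ {X : Π x : M, TangentSpace I x} {α : Π x : M, Cotangent I x},
      SmoothVectorFieldOn I X U → SmoothOneFormOn I α U → ∀ v : E,
      fderiv ℝ (sectionInChart I X α x₀) u v =
        (fderiv ℝ (vectorFieldInChart I X x₀) u v, fderiv ℝ (oneFormInChart I α x₀) u v) :=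
    fun h h' v => congrArg (fun A => A v) ((dV h).prodMk (dF h')).fderiv
  have dP : ∀ {X : Π x : M, TangentSpace I x} {α : Π x : M, Cotangent I x},
      SmoothVectorFieldOn I X U → SmoothOneFormOn I α U →
      HasFDerivAt (fun w => oneFormInChart I α x₀ w (vectorFieldInChart I X x₀ w))
        ((oneFormInChart I α x₀ u).comp (fderiv ℝ (vectorFieldInChart I X x₀) u) +
          (fderiv ℝ (oneFormInChart I α x₀) u).flip (vectorFieldInChart I X x₀ u)) u :=
    fun h h' => (dF h').clm_apply (dV h)
  -- isotropy, differentiated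
  have iso : ∀ {X Y : Π x : M, TangentSpace I x} {α β : Π x : M, Cotangent I x},
      SmoothVectorFieldOn I X U → SmoothOneFormOn I α U →
      SmoothVectorFieldOn I Y U → SmoothOneFormOn I β U →
      (∀ x ∈ U, (X x, α x) ∈ L.fiber x) → (∀ x ∈ U, (Y x, β x) ∈ L.fiber x) → ∀ v : E,
      fderiv ℝ (oneFormInChart I α x₀) u v (vectorFieldInChart I Y x₀ u) +
      oneFormInChart I α x₀ u (fderiv ℝ (vectorFieldInChart I Y x₀) u v) +
      fderiv ℝ (oneFormInChart I β x₀) u v (vectorFieldInChart I X x₀ u) +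
      oneFormInChart I β x₀ u (fderiv ℝ (vectorFieldInChart I X x₀) u v) = 0 := by
    intro X Y α β hX hα hY hβ ha hb v
    have h1 := (dP hY hα).add (dP hX hβ)
    have h2 := h1.unique ((hasFDerivAt_const (0 : ℝ) u).congr_of_eventuallyEq (by
      rw [hu]
      filter_upwards [eventually_oneFormInChart_apply α Y x₀,
        eventually_oneFormInChart_apply β X x₀, eventually_extChartAt_symm_mem hUn]
        with w h1 h2 h3
      simp only [Pi.add_apply]
      rw [h1, h2]
      exact L.isotropic _ _ (ha _ h3) _ (hb _ h3)))
    have h3 := congrArg (fun A => A v) h2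
    simp only [add_apply, ContinuousLinearMap.comp_apply,
      ContinuousLinearMap.flip_apply, zero_apply] at h3
    linarith
  have hint := L.isotropic x₀ _ (L.integrable U hU X α Y β hX hα hY hβ ha hb x₀ hx) _ (hc x₀ hx)
  set f : M → ℝ := fun y => (β y (X y) - α y (Y y) : ℝ) with hf
  have h1 := (dP hX hβ).sub (dP hY hα)
  have hev : (fun w => f ((extChartAt I x₀).symm w)) =ᶠ[𝓝 u]
      (fun w => oneFormInChart I β x₀ w (vectorFieldInChart I X x₀ w)) -
      (fun w => oneFormInChart I α x₀ w (vectorFieldInChart I Y x₀ w)) := by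
    rw [hu]
    filter_upwards [eventually_oneFormInChart_apply α Y x₀,
        eventually_oneFormInChart_apply β X x₀] with w h1 h2
    simp only [Pi.sub_apply]
    rw [h1, h2]
  have h2 := h1.congr_of_eventuallyEq hev
  have hd0 : ∀ v : E, (d0 I f x₀ : E →L[ℝ] ℝ) v = _ := fun v => by
    rw [d0_apply (mdifferentiableAt_of_comp_symm (hu ▸ h2.differentiableAt)), ← hu, h2.fderiv]
  have e1 : ∀ (V : E) (η₁ η₂ η₃ ζ : E →L[ℝ] ℝ) (W : E) (a b c d : ℝ), η₁ W = a → η₂ W = b →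
      η₃ W = c → ζ V = d → (η₁ - η₂ + (1 / 2 : ℝ) • η₃) W + ζ V = 0 →
      a - b + 1 / 2 * c + d = 0 := by
    rintro V η₁ η₂ η₃ ζ W a b c d rfl rfl rfl rfl h
    simpa using h
  have sV : ∀ X : Π x : M, TangentSpace I x, vectorFieldInChart I X x₀ u = (X x₀ : E) :=
    fun X => by rw [hu, vectorFieldInChart_self]
  have sF : oneFormInChart I γ x₀ u = (γ x₀ : E →L[ℝ] ℝ) := by rw [hu, oneFormInChart_self]
  have hd1 : ∀ (β : Π x : M, Cotangent I x) (X Z : Π x : M, TangentSpace I x),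
      (d1 I β x₀ : E →ₗ[ℝ] (E →L[ℝ] ℝ)) (X x₀) (Z x₀) =
      vecD1 (oneFormInChart I β x₀) u (vectorFieldInChart I X x₀ u)
        (vectorFieldInChart I Z x₀ u) := fun β X Z => by
    rw [sV, sV, hu]; exact d1_apply β x₀ (X x₀) (Z x₀)
  have hbr : (γ x₀ : E →L[ℝ] ℝ) (VectorField.mlieBracket I X Y x₀ : E) =
      oneFormInChart I γ x₀ u (VectorField.lieBracket ℝ (vectorFieldInChart I X x₀)
        (vectorFieldInChart I Y x₀) u) := by
    rw [sF, hu]; exact congrArg (γ x₀ : E →L[ℝ] ℝ) (mlieBracket_eq X Y x₀)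
  have hmain := e1 _ _ _ _ (γ x₀) (Z x₀) _ _ _ _ (hd1 β X Z) (hd1 α Y Z) (hd0 (Z x₀)) hbr hint
  rw [← sV Z] at hmain
  simp only [vecD1_apply, VectorField.lieBracket, map_sub, add_apply, sub_apply,
    ContinuousLinearMap.comp_apply, ContinuousLinearMap.flip_apply] at hmain
  -- The relation `⟨a, c⟩ = 0` is differentiated along `Y`, and `⟨a, b⟩ = 0` along `Z`. The second
  -- absorbs the term with the factor `1/2`.
  have i1 := iso hX hα hZ hγ ha hc (vectorFieldInChart I Y x₀ u)
  have i2 := iso hY hβ hX hα hb ha (vectorFieldInChart I Z x₀ u)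
  rw [dS hY hβ, dS hZ hγ, dS hX hα]
  simp only [pairing, sectionInChart]
  linarith

end Charts

/-! ### Frames with vanishing Courant tensor, and naturality of the exterior derivative. -/

section Charts

variable {E : Type u} [NormedAddCommGroup E] [NormedSpace ℝ E]
  {H : Type v} [TopologicalSpace H] {I : ModelWithCorners ℝ E H}
  {M : Type w} [TopologicalSpace M] [ChartedSpace H M] [IsManifold I ∞ M]

variable (I) in
/-- An element of `TM ⊕ T^*M` read in the trivialization near `x₀`. -/
def pairToModel (x₀ x : M) : (TangentSpace I x × Cotangent I x) →ₗ[ℝ] E × (E →L[ℝ] ℝ) where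
  toFun p := (toModel I x₀ x p.1, covectorToModel I x₀ x p.2)
  map_add' p q := by
    refine Prod.ext (map_add _ _ _) ?_
    ext v; rfl
  map_smul' c p := by
    refine Prod.ext (map_smul _ _ _) ?_
    ext v; rfl

theorem covectorToModel_toModel {x₀ x : M} (hx : x ∈ (chartAt H x₀).source) (α : Cotangent I x)
    (v : TangentSpace I x) : covectorToModel I x₀ x α (toModel I x₀ x v) = α v := by
  rw [covectorToModel_apply, ofModel_toModel hx]

theorem covectorToModel_comp_toModel {x₀ x : M} (hx : x ∈ (chartAt H x₀).source)
    (ξ : E →L[ℝ] ℝ) :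
    covectorToModel I x₀ x (ξ.comp (toModel I x₀ x) : TangentSpace I x →L[ℝ] ℝ) = ξ := by
  ext v
  rw [covectorToModel_apply]
  exact congrArg ξ (toModel_ofModel hx v)

theorem pairToModel_injective {x₀ x : M} (hx : x ∈ (chartAt H x₀).source) :
    Function.Injective (pairToModel I x₀ x) := by
  rintro ⟨v, α⟩ ⟨w, β⟩ h
  have h1 : toModel I x₀ x v = toModel I x₀ x w := congrArg Prod.fst h
  have h2 : covectorToModel I x₀ x α = covectorToModel I x₀ x β := congrArg Prod.snd h
  refine Prod.ext ?_ ?_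
  · exact (ofModel_toModel hx v).symm.trans ((congrArg _ h1).trans (ofModel_toModel hx w))
  · ext z
    exact (covectorToModel_toModel hx α z).symm.trans
      ((congrArg (fun ξ => ξ (toModel I x₀ x z)) h2).trans (covectorToModel_toModel hx β z))

variable [I.Boundaryless]

/-- Near each point, a Dirac structure has a smooth frame in the chart at that point, whose Courant
tensor vanishes. -/
theorem DiracStructure.exists_frame (L : DiracStructure I M) (x₀ : M) :
    ∃ U : Set M, IsOpen U ∧ x₀ ∈ U ∧ U ⊆ (chartAt H x₀).source ∧
    ∃ G : M → (Fin (Module.finrank ℝ E) → ℝ) →L[ℝ] E × (E →L[ℝ] ℝ),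
      ContMDiffOn I 𝓘(ℝ, (Fin (Module.finrank ℝ E) → ℝ) →L[ℝ] E × (E →L[ℝ] ℝ)) ∞ G U ∧
      (∀ x ∈ U, Function.Injective (G x) ∧
        ∀ p, p ∈ L.fiber x ↔ ∃ c, G x c = pairToModel I x₀ x p) ∧
      ∀ a b c, courantTensor (fun u => G ((extChartAt I x₀).symm u)) (extChartAt I x₀ x₀)
        a b c = 0 := by
  obtain ⟨U₀, hU₀, hx₀, X, α, hs, hsp⟩ := L.smooth x₀
  have hU := hU₀.inter (chartAt H x₀).open_source
  set U := U₀ ∩ (chartAt H x₀).source with hUdef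
  have hxU : x₀ ∈ U := ⟨hx₀, mem_chart_source H x₀⟩
  have hUs : U ⊆ (chartAt H x₀).source := inter_subset_right
  let G : M → (Fin (Module.finrank ℝ E) → ℝ) →L[ℝ] E × (E →L[ℝ] ℝ) := fun x =>
    frameCLM fun i => (toModel I x₀ x (X i x), covectorToModel I x₀ x (α i x))
  have hG : ContMDiffOn I 𝓘(ℝ, (Fin (Module.finrank ℝ E) → ℝ) →L[ℝ] E × (E →L[ℝ] ℝ)) ∞ G U := by
    refine (contDiff_frameCLM (S := E × (E →L[ℝ] ℝ))).contMDiff.comp_contMDiffOn ?_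
    rw [contMDiffOn_pi_space]
    intro i
    exact ((smoothVectorFieldOn_iff hU hUs).1 ((hs i).1.mono inter_subset_left)).prodMk_space
      ((smoothOneFormOn_iff hU hUs).1 ((hs i).2.mono inter_subset_left))
  have hGc : ∀ x c, G x c = pairToModel I x₀ x (∑ i, c i • (X i x, α i x)) := by
    intro x c
    rw [map_sum]
    simp only [map_smul]
    rfl
  refine ⟨U, hU, hxU, hUs, G, hG, fun x hx => ⟨?_, fun p => ?_⟩, fun a b c => ?_⟩
  -- As many sections as the rank of the fibre span it, so they are independent.
  · have hli : LinearIndependent ℝ (fun i => (X i x, α i x)) := by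
      rw [linearIndependent_iff_card_eq_finrank_span, Set.finrank, ← hsp x hx.1,
        L.finrank_fiber]
      simp
    rw [injective_iff_map_eq_zero]
    intro c hc
    rw [hGc, map_eq_zero_iff _ (pairToModel_injective (hUs hx))] at hc
    exact funext fun i => Fintype.linearIndependent_iff.1 hli c hc i
  · rw [hsp x hx.1, Submodule.mem_span_range_iff_exists_fun]
    simp only [hGc, (pairToModel_injective (hUs hx)).eq_iff]
  -- The tensor is computed only at the centre of the chart. This is enough, since every point is
  -- the centre of its own preferred chart.
  · set u := extChartAt I x₀ x₀ with hu
    have hGd : ContDiffAt ℝ ∞ (fun u => G ((extChartAt I x₀).symm u)) u :=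
      contDiffAt_comp_extChartAt_symm (hG.contMDiffAt (hU.mem_nhds hxU))
    -- constant coefficient sections
    let Xs : (Fin (Module.finrank ℝ E) → ℝ) → Π x : M, TangentSpace I x :=
      fun c x => ∑ i, c i • X i x
    let αs : (Fin (Module.finrank ℝ E) → ℝ) → Π x : M, Cotangent I x :=
      fun c x => ∑ i, c i • α i x
    have hsum : ∀ c x, (Xs c x, αs c x) = ∑ i, c i • (X i x, α i x) := by
      intro c x
      refine Prod.ext ?_ ?_
      · rw [Prod.fst_sum]; rfl
      · rw [Prod.snd_sum]; rfl
    have hmem : ∀ c, ∀ x ∈ U, (Xs c x, αs c x) ∈ L.fiber x := by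
      intro c x hx
      rw [hsum, hsp x hx.1]
      exact Submodule.sum_mem _ fun i _ => Submodule.smul_mem _ _ (Submodule.subset_span ⟨i, rfl⟩)
    have hGs : ∀ c x, G x c = (toModel I x₀ x (Xs c x), covectorToModel I x₀ x (αs c x)) := by
      intro c x; rw [hGc, ← hsum]; rfl
    have hGc' : ∀ c, ContMDiffOn I 𝓘(ℝ, E × (E →L[ℝ] ℝ)) ∞ (fun x => G x c) U := fun c =>
      hG.clm_apply contMDiffOn_const
    have hXs : ∀ c, SmoothVectorFieldOn I (Xs c) U := fun c =>
      (smoothVectorFieldOn_iff hU hUs).2 ((contDiff_fst.contMDiff.comp_contMDiffOn (hGc' c)).congr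
        fun x _ => (congrArg Prod.fst (hGs c x)).symm)
    have hαs : ∀ c, SmoothOneFormOn I (αs c) U := fun c =>
      (smoothOneFormOn_iff hU hUs).2 ((contDiff_snd.contMDiff.comp_contMDiffOn (hGc' c)).congr
        fun x _ => (congrArg Prod.snd (hGs c x)).symm)
    have hsec : ∀ c, (fun u => G ((extChartAt I x₀).symm u) c) =ᶠ[𝓝 u]
        sectionInChart I (Xs c) (αs c) x₀ := by
      intro c
      filter_upwards [oneFormInChart_eq (αs c) x₀] with w hw
      rw [hGs, sectionInChart, hw]
      rfl
    have hfd : ∀ c v, fderiv ℝ (fun u => G ((extChartAt I x₀).symm u)) u v c =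
        fderiv ℝ (sectionInChart I (Xs c) (αs c) x₀) u v := by
      intro c v
      rw [← (hsec c).fderiv_eq,
        (hasFDerivAt_apply_const (hGd.differentiableAt (by simp)) c).fderiv]
      rfl
    have := L.courant_eq_zero hU hxU (hXs a) (hαs a) (hXs b) (hαs b) (hXs c) (hαs c)
      (hmem a) (hmem b) (hmem c) hu
    have hsec' : ∀ c, G ((extChartAt I x₀).symm u) c = sectionInChart I (Xs c) (αs c) x₀ u :=
      fun c => (hsec c).self_of_nhds
    rw [courantTensor, hfd, hfd, hfd]
    simp only [hsec']
    exact this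

/-- Naturality of the exterior derivative: `d (f^* α) = f^* dα`. -/
theorem d1_comp {F : Type*} [NormedAddCommGroup F] [NormedSpace ℝ F] {f : F → M} {z : F}
    (hf : ContMDiffAt 𝓘(ℝ, F) I 2 f z) {α : Π x : M, Cotangent I x}
    (hα : DifferentiableAt ℝ (oneFormInChart I α (f z)) (extChartAt I (f z) (f z))) (v w : F) :
    d1 I α (f z) (mfderiv 𝓘(ℝ, F) I f z v) (mfderiv 𝓘(ℝ, F) I f z w) =
      vecD1 (fun y => ((α (f y)).comp (mfderiv 𝓘(ℝ, F) I f y : F →L[ℝ] TangentSpace I (f y)) :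
        F →L[ℝ] ℝ)) z v w := by
  set q := f z with hq
  set h : F → E := fun y => extChartAt I q (f y) with hh
  have hsrc : ∀ᶠ y in 𝓝 z, f y ∈ (chartAt H q).source :=
    hf.continuousAt.eventually (chart_source_mem_nhds H q)
  have hh2 : ContDiffAt ℝ 2 h z := by
    rw [← contMDiffAt_iff_contDiffAt]
    exact (contMDiffAt_extChartAt (I := I) (n := 2) (x := q)).comp z hf
  have hdiff : ∀ᶠ y in 𝓝 z, MDifferentiableAt 𝓘(ℝ, F) I f y := by
    filter_upwards [(contMDiffAt_iff_contMDiffAt_nhds (by simp)).1 hf] with y hy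
    exact hy.mdifferentiableAt (by simp)
  have hfd : ∀ᶠ y in 𝓝 z, ∀ v, fderiv ℝ h y v =
      toModel I q (f y) (mfderiv 𝓘(ℝ, F) I f y v) := by
    filter_upwards [hsrc, hdiff] with y h1 h2 v
    have h3 := mfderiv_comp y (mdifferentiableAt_extChartAt (I := I) h1) h2
    rw [← mfderiv_eq_fderiv, toModel_eq_mfderiv h1]
    exact congrArg (fun A => A v) h3
  -- In the chart at `q` the map `f` becomes `h`, and the form becomes a pullback between vector
  -- spaces. The equality is needed on a neighbourhood because both sides are then differentiated.
  have hform : (fun y => ((α (f y)).comp (mfderiv 𝓘(ℝ, F) I f y : F →L[ℝ] TangentSpace I (f y)) :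
        F →L[ℝ] ℝ)) =ᶠ[𝓝 z] fun y => (oneFormInChart I α q (h y)).comp (fderiv ℝ h y) := by
    have hc : ∀ᶠ y in 𝓝 z, oneFormInChart I α q (h y) =
        covectorToModel I q ((extChartAt I q).symm (h y)) (α ((extChartAt I q).symm (h y))) :=
      (hh2.continuousAt).eventually (oneFormInChart_eq α q)
    filter_upwards [hc, hsrc, hfd] with y h1 h2 h3
    have h4 : (extChartAt I q).symm (h y) = f y :=
      (extChartAt I q).left_inv (by simpa using h2)
    rw [h1, h4]
    ext v
    rw [ContinuousLinearMap.comp_apply, h3 v, covectorToModel_toModel h2]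
    rfl
  have e1 : ∀ v, fderiv ℝ h z v = (mfderiv 𝓘(ℝ, F) I f z v : E) := by
    intro v
    rw [hfd.self_of_nhds v, ← hq, toModel_self]
    rfl
  have e2 := vecD1_pullback (a := oneFormInChart I α q) (h := h) (z := z) hα hh2 v w
  rw [e1, e1] at e2
  have e3 : vecD1 (fun y => ((α (f y)).comp
      (mfderiv 𝓘(ℝ, F) I f y : F →L[ℝ] TangentSpace I (f y)) : F →L[ℝ] ℝ)) z =
      vecD1 (fun y => (oneFormInChart I α q (h y)).comp (fderiv ℝ h y)) z := by
    rw [vecD1, vecD1, hform.fderiv_eq]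
  rw [e3, e2]
  exact d1_apply α q _ _

end Charts

/-! ### Differentials of immersions. -/

section Immersion

variable {E : Type*} [NormedAddCommGroup E] [NormedSpace ℝ E]
  {H : Type*} [TopologicalSpace H] {I : ModelWithCorners ℝ E H} [I.Boundaryless]
  {M : Type*} [TopologicalSpace M] [ChartedSpace H M] [IsManifold I ∞ M]
  {E' : Type*} [NormedAddCommGroup E'] [NormedSpace ℝ E']
  {H' : Type*} [TopologicalSpace H'] {J : ModelWithCorners ℝ E' H'}
  {P : Type*} [TopologicalSpace P] [ChartedSpace H' P] [IsManifold J ∞ P]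

/-- In suitable charts `i` is the inclusion of a factor of a product. Projecting onto that factor
gives a differentiable local left inverse `g`, and the chain rule applies to `g ∘ i = id`. -/
theorem mfderiv_injective_of_isImmersionAt {i : M → P} {x : M}
    (h : Manifold.IsImmersionAt I J ∞ i x) : Function.Injective (mfderiv I J i x) := by
  obtain ⟨F, _, _, h⟩ := h
  let g : P → M := fun p => (h.domChart.extend I).symm (h.equiv.symm (h.codChart.extend J p)).1
  have hev : ∀ᶠ y in 𝓝 x, g (i y) = y := by
    filter_upwards [h.domChart.open_source.mem_nhds h.mem_domChart_source] with y hy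
    have h1 := h.writtenInCharts ((h.domChart.extend I).map_source (by simpa using hy))
    simp only [Function.comp_apply] at h1
    rw [(h.domChart.extend I).left_inv (by simpa using hy)] at h1
    simp only [g, h1, ContinuousLinearEquiv.symm_apply_apply]
    exact (h.domChart.extend I).left_inv (by simpa using hy)
  have hi : MDifferentiableAt I J i x := (h.contMDiffAt).mdifferentiableAt (by simp)
  have h1 : MDifferentiableAt J 𝓘(ℝ, E') (h.codChart.extend J) (i x) :=
    (h.codChart.contMDiffAt_extend h.codChart_mem_maximalAtlas h.mem_codChart_source).mdifferentiableAt
      (by simp)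
  have h3 : (h.equiv.symm (h.codChart.extend J (i x))).1 = h.domChart.extend I x := by
    have h1 := h.writtenInCharts ((h.domChart.extend I).map_source
      (by simpa using h.mem_domChart_source))
    simp only [Function.comp_apply] at h1
    rw [(h.domChart.extend I).left_inv (by simpa using h.mem_domChart_source)] at h1
    rw [h1]; simp
  have h2 : MDifferentiableAt 𝓘(ℝ, E) I (h.domChart.extend I).symm
      (h.equiv.symm (h.codChart.extend J (i x))).1 := by
    rw [h3]
    refine ((contMDiffOn_extend_symm h.domChart_mem_maximalAtlas).contMDiffAt ?_).mdifferentiableAt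
      (by simp)
    rw [← h.domChart.extend_target']
    exact (h.domChart.isOpen_extend_target (I := I)).mem_nhds
      ((h.domChart.extend I).map_source (by simpa using h.mem_domChart_source))
  have h4 : MDifferentiableAt 𝓘(ℝ, E') 𝓘(ℝ, E) (fun v => (h.equiv.symm v).1)
      (h.codChart.extend J (i x)) :=
    ((ContinuousLinearMap.fst ℝ E F).comp
      (h.equiv.symm : E' →L[ℝ] E × F)).differentiableAt.mdifferentiableAt
  have hg : MDifferentiableAt J I g (i x) :=
    MDifferentiableAt.comp (i x) (g := fun v => (h.domChart.extend I).symm (h.equiv.symm v).1)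
      (f := h.codChart.extend J) (MDifferentiableAt.comp _ h2 h4) h1
  have hc := mfderiv_comp x hg hi
  have hid : mfderiv I I (g ∘ i) x = mfderiv I I id x :=
    Filter.EventuallyEq.mfderiv_eq (hev.mono fun y hy => hy)
  rw [mfderiv_id] at hid
  intro v w hvw
  have e : ∀ v, mfderiv I I (g ∘ i) x v = v := fun v => by rw [hid]; rfl
  rw [hc] at e
  exact (e v).symm.trans ((congrArg (mfderiv J I g (i x)) hvw).trans (e w))

end Immersion

/-! ### Bivectors in a trivialization. -/

section Sharp

variable {E : Type u} [NormedAddCommGroup E] [NormedSpace ℝ E]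
  {H : Type v} [TopologicalSpace H] {I : ModelWithCorners ℝ E H}
  {M : Type w} [TopologicalSpace M] [ChartedSpace H M] [IsManifold I ∞ M]

variable (I) in
/-- A bivector at `x` read in the trivialization near `x₀`. -/
def sharpToModel (x₀ x : M) (s : Cotangent I x →L[ℝ] TangentSpace I x) :
    (E →L[ℝ] ℝ) →L[ℝ] E :=
  ((toModel I x₀ x).comp s).comp
    (ContinuousLinearMap.precomp ℝ (toModel I x₀ x) :
      (E →L[ℝ] ℝ) →L[ℝ] (TangentSpace I x →L[ℝ] ℝ))

theorem sharpToModel_apply (x₀ x : M) (s : Cotangent I x →L[ℝ] TangentSpace I x)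
    (ξ : E →L[ℝ] ℝ) : sharpToModel I x₀ x s ξ =
      toModel I x₀ x (s (ξ.comp (toModel I x₀ x) : TangentSpace I x →L[ℝ] ℝ)) := rfl

theorem symmL_trivializationAt_cotangent {x₀ x : M} (hx : x ∈ (chartAt H x₀).source)
    (ξ : E →L[ℝ] ℝ) :
    (trivializationAt (E →L[ℝ] ℝ) (fun x : M => Cotangent I x) x₀).symmL ℝ x ξ =
      (ξ.comp (toModel I x₀ x) : TangentSpace I x →L[ℝ] ℝ) := by
  have hb : x ∈ (trivializationAt (E →L[ℝ] ℝ) (fun x : M => Cotangent I x) x₀).baseSet := by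
    simpa using hx
  have h1 := (trivializationAt (E →L[ℝ] ℝ)
    (fun x : M => Cotangent I x) x₀).continuousLinearMapAt_apply_of_mem ℝ hb
    (ξ.comp (toModel I x₀ x) : TangentSpace I x →L[ℝ] ℝ)
  have h2 := trivializationAt_cotangent hx (ξ.comp (toModel I x₀ x) : TangentSpace I x →L[ℝ] ℝ)
  rw [covectorToModel_comp_toModel hx] at h2
  have h3 := h1.trans h2
  have h4 := (trivializationAt (E →L[ℝ] ℝ)
    (fun x : M => Cotangent I x) x₀).symmL_continuousLinearMapAt (R := ℝ) hb
    (ξ.comp (toModel I x₀ x) : TangentSpace I x →L[ℝ] ℝ)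
  rw [h3] at h4
  exact h4

theorem contMDiffAt_sharp_iff {s : Π x : M, Cotangent I x →L[ℝ] TangentSpace I x} {x₀ : M} :
    ContMDiffAt I (I.prod 𝓘(ℝ, (E →L[ℝ] ℝ) →L[ℝ] E)) ∞
      (fun x => (⟨x, s x⟩ : TotalSpace ((E →L[ℝ] ℝ) →L[ℝ] E)
        (fun x : M => Cotangent I x →L[ℝ] TangentSpace I x))) x₀ ↔
    ContMDiffAt I 𝓘(ℝ, (E →L[ℝ] ℝ) →L[ℝ] E) ∞ (fun x => sharpToModel I x₀ x (s x)) x₀ := by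
  rw [contMDiffAt_hom_bundle]
  have h : (fun x => ContinuousLinearMap.inCoordinates (E →L[ℝ] ℝ) (fun x : M => Cotangent I x) E
      (TangentSpace I : M → Type u) x₀ x x₀ x (s x)) =ᶠ[𝓝 x₀]
      fun x => sharpToModel I x₀ x (s x) := by
    filter_upwards [chart_source_mem_nhds H x₀] with x hx
    ext ξ
    rw [sharpToModel_apply, ← symmL_trivializationAt_cotangent hx]
    rfl
  constructor
  · rintro ⟨-, h2⟩
    exact h2.congr_of_eventuallyEq h.symm
  · exact fun h2 => ⟨contMDiffAt_id, h2.congr_of_eventuallyEq h⟩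

end Sharp

/-! ### Necessity: the rank of the characteristic distribution is locally constant. -/

section Necessity

variable {E : Type u} [NormedAddCommGroup E] [NormedSpace ℝ E] [FiniteDimensional ℝ E]
  {H : Type v} [TopologicalSpace H] {I : ModelWithCorners ℝ E H} [I.Boundaryless]
  {M : Type w} [TopologicalSpace M] [ChartedSpace H M] [IsManifold I ∞ M]

/-- A combination of frame elements with zero covector part is an element of `L ∩ TM`. This presents
`L ∩ TM` as the kernel of a family with constant source and target. -/
theorem finrank_ker_snd_frame (L : DiracStructure I M) {x₀ x : M}
    (hx : x ∈ (chartAt H x₀).source) {R : Type*} [NormedAddCommGroup R] [NormedSpace ℝ R]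
    {g : R →L[ℝ] E × (E →L[ℝ] ℝ)} (hinj : Function.Injective g)
    (hg : ∀ p, p ∈ L.fiber x ↔ ∃ c, g c = pairToModel I x₀ x p) :
    Module.finrank ℝ (LinearMap.ker
      ((ContinuousLinearMap.snd ℝ E (E →L[ℝ] ℝ)).comp g : R →ₗ[ℝ] (E →L[ℝ] ℝ))) =
      L.charRank x := by
  let f₁ : TangentSpace I x →ₗ[ℝ] E × (E →L[ℝ] ℝ) :=
    pairToModel I x₀ x ∘ₗ LinearMap.inl ℝ (TangentSpace I x) (Cotangent I x)
  have hf₁ : Function.Injective f₁ := (pairToModel_injective hx).comp LinearMap.inl_injective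
  have heq : (LinearMap.ker
      ((ContinuousLinearMap.snd ℝ E (E →L[ℝ] ℝ)).comp g : R →ₗ[ℝ] (E →L[ℝ] ℝ))).map
        (g : R →ₗ[ℝ] E × (E →L[ℝ] ℝ)) = (L.char x).map f₁ := by
    ext p
    constructor
    · rintro ⟨c, hc, rfl⟩
      have hc' : (g c).2 = 0 := hc
      have h1 : f₁ (ofModel I x₀ x (g c).1) = g c := by
        refine Prod.ext (toModel_ofModel hx _) ?_
        rw [hc']
        exact map_zero ((LinearMap.snd ℝ _ _) ∘ₗ pairToModel I x₀ x ∘ₗ LinearMap.inr ℝ _ _)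
      exact ⟨_, (hg _).2 ⟨c, h1.symm⟩, h1⟩
    · rintro ⟨v, hv, rfl⟩
      obtain ⟨c, hc⟩ := (hg _).1 hv
      refine ⟨c, ?_, hc⟩
      have : (g c).2 = 0 := by
        rw [hc]
        exact map_zero ((LinearMap.snd ℝ _ _) ∘ₗ pairToModel I x₀ x ∘ₗ LinearMap.inr ℝ _ _)
      exact this
  rw [(Submodule.equivMapOfInjective (g : R →ₗ[ℝ] E × (E →L[ℝ] ℝ)) hinj _).finrank_eq, heq]
  exact (Submodule.equivMapOfInjective f₁ hf₁ (L.char x)).finrank_eq.symm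

theorem eventually_charRank_le (L : DiracStructure I M) (x₀ : M) :
    ∀ᶠ x in 𝓝 x₀, L.charRank x ≤ L.charRank x₀ := by
  obtain ⟨U, hU, hx₀, hUs, G, hG, hGL, -⟩ := L.exists_frame x₀
  have hc : ContinuousAt (fun x => (ContinuousLinearMap.snd ℝ E (E →L[ℝ] ℝ)).comp (G x)) x₀ := by
    have h1 : Continuous (fun g : (Fin (Module.finrank ℝ E) → ℝ) →L[ℝ] E × (E →L[ℝ] ℝ) =>
        (ContinuousLinearMap.snd ℝ E (E →L[ℝ] ℝ)).comp g) := continuous_const.clm_comp continuous_id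
    exact h1.continuousAt.comp (hG.continuousOn.continuousAt (hU.mem_nhds hx₀))
  filter_upwards [eventually_finrank_ker_le hc, hU.mem_nhds hx₀] with x hx hxU
  rwa [finrank_ker_snd_frame L (hUs hxU) (hGL x hxU).1 (hGL x hxU).2,
    finrank_ker_snd_frame L (hUs hx₀) (hGL x₀ hx₀).1 (hGL x₀ hx₀).2] at hx

variable {E' : Type*} [NormedAddCommGroup E'] [NormedSpace ℝ E'] [FiniteDimensional ℝ E']
  {H' : Type*} [TopologicalSpace H'] {J : ModelWithCorners ℝ E' H'} [J.Boundaryless]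
  {P : Type*} [TopologicalSpace P] [ChartedSpace H' P] [IsManifold J ∞ P]

/-- The differential of `i` identifies `L ∩ TM` with `♯N^*i(M)`, and the rank of an image is lower
semicontinuous. -/
theorem DiracStructure.IsCoisotropicEmbedding.eventually_le_charRank {L : DiracStructure I M}
    {S : PoissonStructure J P} {i : M → P} (h : L.IsCoisotropicEmbedding S i) (x₀ : M) :
    ∀ᶠ x in 𝓝 x₀, L.charRank x₀ ≤ L.charRank x := by
  have hi : ContMDiff I J ∞ i := h.isSmoothEmbedding.contMDiff
  have hinj : ∀ x, Function.Injective (mfderiv I J i x) := fun x =>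
    mfderiv_injective_of_isImmersionAt (h.isSmoothEmbedding.isImmersion.isImmersionAt x)
  -- This reads off the zero-covector part of `i^*L_P = L`; coisotropy is not used yet.
  have hmem : ∀ x v, v ∈ L.char x ↔ ∃ ξ : Cotangent J (i x),
      mfderiv I J i x v = S.sharp (i x) ξ ∧ ξ.comp (mfderiv I J i x) = 0 := by
    intro x v
    have h1 : v ∈ L.char x ↔ (v, (0 : Cotangent I x)) ∈ L.fiber x := Iff.rfl
    rw [h1, ← h.pullback_eq]
    constructor
    · rintro ⟨ξ, ⟨η, hη⟩, h0⟩
      have e1 : S.sharp (i x) η = mfderiv I J i x v := congrArg Prod.fst hη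
      have e2 : η = ξ := congrArg Prod.snd hη
      exact ⟨ξ, by rw [← e1, e2], h0.symm⟩
    · rintro ⟨ξ, h1, h2⟩
      exact ⟨ξ, ⟨ξ, Prod.ext h1.symm rfl⟩, h2.symm⟩
  let A : M → E →L[ℝ] E' := fun x => (toModel J (i x₀) (i x)).comp
    ((mfderiv I J i x : TangentSpace I x →L[ℝ] TangentSpace J (i x)).comp (ofModel I x₀ x))
  have hA : ContinuousAt A x₀ :=
    ((hi.contMDiffAt (x := x₀)).mfderiv_const (m := ∞) (by simp)).continuousAt
  let sh : M → (E' →L[ℝ] ℝ) →L[ℝ] E' := fun x => sharpToModel J (i x₀) (i x) (S.sharp (i x))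
  have hsh : ContinuousAt sh x₀ :=
    ContinuousAt.comp (g := fun q => sharpToModel J (i x₀) q (S.sharp q))
      (contMDiffAt_sharp_iff.1 (S.smooth (i x₀))).continuousAt hi.continuous.continuousAt
  have hsrcP : ∀ᶠ x in 𝓝 x₀, i x ∈ (chartAt H' (i x₀)).source :=
    hi.continuous.continuousAt.eventually (chart_source_mem_nhds H' (i x₀))
  have hA₀ : Function.Injective (A x₀) := by
    intro v w hvw
    have h1 := congrArg (ofModel J (i x₀) (i x₀)) hvw
    simp only [A, ContinuousLinearMap.comp_apply] at h1
    rw [ofModel_toModel (mem_chart_source _ _), ofModel_toModel (mem_chart_source _ _)] at h1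
    have h2 := congrArg (toModel I x₀ x₀) (hinj x₀ h1)
    rwa [toModel_ofModel (mem_chart_source _ _), toModel_ofModel (mem_chart_source _ _)] at h2
  obtain ⟨R, hR⟩ := exists_clm_leftInverse hA₀
  have hRA₀ : R.comp (A x₀) = ContinuousLinearMap.id ℝ E := by ext v; exact hR v
  have hRA : ContinuousAt (fun x => R.comp (A x)) x₀ := continuousAt_const.clm_comp hA
  have hinv₀ : (R.comp (A x₀)).IsInvertible := by
    rw [hRA₀]; exact ⟨ContinuousLinearEquiv.refl ℝ E, rfl⟩
  have hinv : ∀ᶠ x in 𝓝 x₀, (R.comp (A x)).IsInvertible :=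
    hRA.eventually (isOpen_isInvertible.mem_nhds hinv₀)
  -- Near `x₀` the map `Q x` is the projection along the image of `A x`. Hence `η ∘ Q x` is conormal
  -- for every `η`, and `Q x` parametrizes the conormal spaces by a fixed vector space.
  let Q : M → E' →L[ℝ] E' := fun x =>
    ContinuousLinearMap.id ℝ E' - (A x).comp ((R.comp (A x)).inverse.comp R)
  have := FiniteDimensional.complete ℝ E
  have hQ : ContinuousAt Q x₀ := continuousAt_const.sub (hA.clm_comp
    (((hinv₀.contDiffAt_map_inverse (n := 0)).continuousAt.comp (f := fun x => R.comp (A x))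
      hRA).clm_comp continuousAt_const))
  have hQA : ∀ x, (R.comp (A x)).IsInvertible → ∀ v, Q x (A x v) = 0 := by
    intro x hx v
    have h1 := congrArg (fun B => B v) hx.inverse_comp_self
    simp only [ContinuousLinearMap.comp_apply, ContinuousLinearMap.id_apply] at h1
    simp only [Q, sub_apply, ContinuousLinearMap.comp_apply, ContinuousLinearMap.id_apply, h1,
      sub_self]
  let B : M → (E' →L[ℝ] ℝ) →L[ℝ] E' := fun x =>
    (sh x).comp ((ContinuousLinearMap.compL ℝ E' E' ℝ).flip (Q x))
  have hB : ContinuousAt B x₀ := hsh.clm_comp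
    (((ContinuousLinearMap.compL ℝ E' E' ℝ).flip.continuous).continuousAt.comp hQ)
  -- the image of `char` in the model
  let C : ∀ x, TangentSpace I x →ₗ[ℝ] E' := fun x =>
    ((toModel J (i x₀) (i x)).comp (mfderiv I J i x : TangentSpace I x →L[ℝ] TangentSpace J (i x)) :
      TangentSpace I x →L[ℝ] E')
  have hCr : ∀ x, i x ∈ (chartAt H' (i x₀)).source →
      Module.finrank ℝ ((L.char x).map (C x)) = L.charRank x := by
    intro x hx
    have hCinj : Function.Injective (C x) := by
      intro v w hvw
      have h1 := congrArg (ofModel J (i x₀) (i x)) hvw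
      exact hinj x ((ofModel_toModel hx _).symm.trans (h1.trans (ofModel_toModel hx _)))
    exact (Submodule.equivMapOfInjective (C x) hCinj (L.char x)).finrank_eq.symm
  -- At `x₀` a conormal `ξ` satisfies `ξ ∘ Q x₀ = ξ`, so all of `♯N^*` is reached.
  have hle₀ : (L.char x₀).map (C x₀) ≤ LinearMap.range (B x₀ : (E' →L[ℝ] ℝ) →ₗ[ℝ] E') := by
    rintro _ ⟨v, hv, rfl⟩
    obtain ⟨ξ, h1, h2⟩ := (hmem x₀ v).1 hv
    have hs := mem_chart_source H' (i x₀)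
    refine ⟨covectorToModel J (i x₀) (i x₀) ξ, ?_⟩
    have h3 : ∀ w : E, covectorToModel J (i x₀) (i x₀) ξ (A x₀ w) = 0 := by
      intro w
      have e1 : ofModel J (i x₀) (i x₀) (A x₀ w) = mfderiv I J i x₀ (ofModel I x₀ x₀ w) :=
        ofModel_toModel hs _
      exact (congrArg ξ e1).trans
        (congrArg (fun β : TangentSpace I x₀ →L[ℝ] ℝ => β (ofModel I x₀ x₀ w)) h2)
    have h4 : (covectorToModel J (i x₀) (i x₀) ξ).comp (Q x₀) =
        covectorToModel J (i x₀) (i x₀) ξ := by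
      ext w
      simp only [Q, ContinuousLinearMap.comp_apply, sub_apply, ContinuousLinearMap.id_apply,
        map_sub, h3, sub_zero]
    have h5 : B x₀ (covectorToModel J (i x₀) (i x₀) ξ) =
        sh x₀ ((covectorToModel J (i x₀) (i x₀) ξ).comp (Q x₀)) := rfl
    refine h5.trans ?_
    rw [h4]
    have h6 := covectorToModel_toModel hs ξ
    exact congrArg (toModel J (i x₀) (i x₀)) ((congrArg (S.sharp (i x₀)) (ContinuousLinearMap.ext h6)).trans h1.symm)
  -- Coisotropy enters here: `♯` of a conormal covector is tangent to `i(M)`, hence comes from `L ∩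
  -- TM`.
  have hle : ∀ᶠ x in 𝓝 x₀, LinearMap.range (B x : (E' →L[ℝ] ℝ) →ₗ[ℝ] E') ≤
      (L.char x).map (C x) := by
    filter_upwards [hinv, chart_source_mem_nhds H x₀] with x hx hxs
    rintro _ ⟨η, rfl⟩
    let ξ : TangentSpace J (i x) →L[ℝ] ℝ := (η.comp (Q x)).comp (toModel J (i x₀) (i x))
    have h2 : ξ.comp (mfderiv I J i x) = 0 := by
      refine ContinuousLinearMap.ext fun v => ?_
      have e1 : A x (toModel I x₀ x v) = toModel J (i x₀) (i x) (mfderiv I J i x v) :=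
        congrArg (fun w => toModel J (i x₀) (i x) (mfderiv I J i x w)) (ofModel_toModel hxs v)
      have e2 : ξ (mfderiv I J i x v) = η (Q x (A x (toModel I x₀ x v))) :=
        congrArg (fun w => η (Q x w)) e1.symm
      refine e2.trans ?_
      rw [hQA x hx]
      exact map_zero η
    obtain ⟨v, hv⟩ := h.coisotropic x ξ h2
    exact ⟨v, (hmem x v).2 ⟨ξ, hv, h2⟩, congrArg (toModel J (i x₀) (i x)) hv⟩
  -- The chain is `charRank x₀ ≤ rank B x₀ ≤ rank B x ≤ charRank x`; the middle step is
  -- semicontinuity of the kernel dimension combined with rank-nullity.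
  filter_upwards [hle, hsrcP, eventually_finrank_ker_le hB] with x hx hxs hk
  have n1 := LinearMap.finrank_range_add_finrank_ker (B x : (E' →L[ℝ] ℝ) →ₗ[ℝ] E')
  have n2 := LinearMap.finrank_range_add_finrank_ker (B x₀ : (E' →L[ℝ] ℝ) →ₗ[ℝ] E')
  have n3 := Submodule.finrank_mono hx
  have n4 := Submodule.finrank_mono hle₀
  rw [hCr x hxs] at n3
  rw [hCr x₀ (mem_chart_source _ _)] at n4
  omega

theorem DiracStructure.EmbedsCoisotropically.isLocallyConstant_charRank {L : DiracStructure I M}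
    (h : L.EmbedsCoisotropically) : IsLocallyConstant L.charRank := by
  obtain ⟨E', _, _, _, H', _, J, _, P, _, _, _, _, _, S, i, hi⟩ := h
  refine (IsLocallyConstant.iff_eventually_eq _).2 fun x₀ => ?_
  filter_upwards [eventually_charRank_le L x₀, hi.eventually_le_charRank x₀] with x h1 h2
  exact le_antisymm h1 h2

end Necessity

/-! ### Smooth frames of the characteristic distribution. -/

section CharFrame

variable {E : Type u} [NormedAddCommGroup E] [NormedSpace ℝ E] [FiniteDimensional ℝ E]
  {H : Type v} [TopologicalSpace H] {I : ModelWithCorners ℝ E H} [I.Boundaryless]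
  {M : Type w} [TopologicalSpace M] [ChartedSpace H M] [IsManifold I ∞ M]

/-- A smooth frame `Y` of `L ∩ TM` near `x₀`, read in the chart at `x₀`, with a smooth family `Φ` of
left inverses. -/
structure CharFrame (L : DiracStructure I M) (k : ℕ) (x₀ : M) where
  /-- The domain of the frame. -/
  U : Set M
  /-- The frame. -/
  Y : M → EuclideanSpace ℝ (Fin k) →L[ℝ] E
  /-- The left inverses. -/
  Φ : M → E →L[ℝ] EuclideanSpace ℝ (Fin k)
  isOpen : IsOpen U
  mem : x₀ ∈ U
  subset : U ⊆ (chartAt H x₀).source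
  smooth_Y : ContMDiffOn I 𝓘(ℝ, EuclideanSpace ℝ (Fin k) →L[ℝ] E) ∞ Y U
  smooth_Φ : ContMDiffOn I 𝓘(ℝ, E →L[ℝ] EuclideanSpace ℝ (Fin k)) ∞ Φ U
  leftInv : ∀ x ∈ U, ∀ c, Φ x (Y x c) = c
  mem_iff : ∀ x ∈ U, ∀ v : TangentSpace I x, v ∈ L.char x ↔ ∃ c, Y x c = toModel I x₀ x v

/-- A left inverse `R` of `Y x₀` is corrected nearby to `(R Y)⁻¹ R`. -/
theorem exists_smooth_leftInverse {k : ℕ} {U : Set M} {x₀ : M} (hU : IsOpen U) (hx : x₀ ∈ U)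
    {Y : M → EuclideanSpace ℝ (Fin k) →L[ℝ] E}
    (hY : ContMDiffOn I 𝓘(ℝ, EuclideanSpace ℝ (Fin k) →L[ℝ] E) ∞ Y U)
    (hinj : Function.Injective (Y x₀)) :
    ∃ U' ⊆ U, IsOpen U' ∧ x₀ ∈ U' ∧ ∃ Φ : M → E →L[ℝ] EuclideanSpace ℝ (Fin k),
      ContMDiffOn I 𝓘(ℝ, E →L[ℝ] EuclideanSpace ℝ (Fin k)) ∞ Φ U' ∧
      ∀ x ∈ U', ∀ c, Φ x (Y x c) = c := by
  obtain ⟨R, hR⟩ := exists_clm_leftInverse hinj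
  have hRY : ContMDiffOn I 𝓘(ℝ, EuclideanSpace ℝ (Fin k) →L[ℝ] EuclideanSpace ℝ (Fin k)) ∞
      (fun x => R.comp (Y x)) U := contMDiffOn_const.clm_comp hY
  have h0 : (R.comp (Y x₀)).IsInvertible := by
    rw [show R.comp (Y x₀) = ContinuousLinearMap.id ℝ _ by ext1 v; exact hR v]
    exact ⟨ContinuousLinearEquiv.refl ℝ _, rfl⟩
  refine ⟨U ∩ (fun x => R.comp (Y x)) ⁻¹' {B | B.IsInvertible}, inter_subset_left,
    hRY.continuousOn.isOpen_inter_preimage hU isOpen_isInvertible, ⟨hx, h0⟩,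
    fun x => (R.comp (Y x)).inverse.comp R, ?_, ?_⟩
  · intro x hx
    refine ContMDiffAt.contMDiffWithinAt ?_
    exact (contMDiffAt_clm_inverse (hRY.contMDiffAt (hU.mem_nhds hx.1)) hx.2).clm_comp
      contMDiffAt_const
  · intro x hx c
    exact congrArg (fun B => B c) hx.2.inverse_comp_self

/-- A smooth frame `K` of the kernel of the covector component of `G` gives `Y = (G K).1`. No
information is lost in the first component, because the second one vanishes on the range of `K`. -/
theorem DiracStructure.nonempty_charFrame (L : DiracStructure I M) {k : ℕ}
    (hk : ∀ x, L.charRank x = k) (x₀ : M) : Nonempty (CharFrame L k x₀) := by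
  obtain ⟨U, hU, hx₀, hUs, G, hG, hGL, -⟩ := L.exists_frame x₀
  have hA : ContMDiffOn I 𝓘(ℝ, (Fin (Module.finrank ℝ E) → ℝ) →L[ℝ] (E →L[ℝ] ℝ)) ∞
      (fun x => (ContinuousLinearMap.snd ℝ E (E →L[ℝ] ℝ)).comp (G x)) U :=
    contMDiffOn_const.clm_comp hG
  obtain ⟨U₁, hU₁, hoU₁, hx₁, K, hK, hKG⟩ := exists_smooth_kernel_frame hU hx₀ hA
    fun x hx => (finrank_ker_snd_frame L (hUs hx) (hGL x hx).1 (hGL x hx).2).trans (hk x)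
  let Y : M → EuclideanSpace ℝ (Fin k) →L[ℝ] E := fun x =>
    (ContinuousLinearMap.fst ℝ E (E →L[ℝ] ℝ)).comp ((G x).comp (K x))
  have hY : ContMDiffOn I 𝓘(ℝ, EuclideanSpace ℝ (Fin k) →L[ℝ] E) ∞ Y U₁ :=
    contMDiffOn_const.clm_comp ((hG.mono hU₁).clm_comp hK)
  have hsnd : ∀ x ∈ U₁, ∀ c, (G x (K x c)).2 = 0 := fun x hx c => ((hKG x hx).2 _).2 ⟨c, rfl⟩
  have hYinj : ∀ x ∈ U₁, Function.Injective (Y x) := fun x hx c d hcd =>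
    (hKG x hx).1 ((hGL x (hU₁ hx)).1 (Prod.ext hcd ((hsnd x hx c).trans (hsnd x hx d).symm)))
  obtain ⟨U₂, hU₂, hoU₂, hx₂, Φ, hΦ, hl⟩ := exists_smooth_leftInverse hoU₁ hx₁ hY (hYinj x₀ hx₁)
  refine ⟨⟨U₂, Y, Φ, hoU₂, hx₂, hU₂.trans (hU₁.trans hUs), hY.mono hU₂, hΦ, hl, ?_⟩⟩
  intro x hx v
  have h0 : (pairToModel I x₀ x (v, 0)) = (toModel I x₀ x v, (0 : E →L[ℝ] ℝ)) := rfl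
  have h1 : v ∈ L.char x ↔ ∃ c, G x c = pairToModel I x₀ x (v, 0) :=
    (hGL x (hU₁ (hU₂ hx))).2 (v, 0)
  rw [h1, h0]
  constructor
  · rintro ⟨c, hc⟩
    obtain ⟨d, rfl⟩ := ((hKG x (hU₂ hx)).2 c).1 (congrArg Prod.snd hc)
    exact ⟨d, congrArg Prod.fst hc⟩
  · rintro ⟨c, hc⟩
    exact ⟨K x c, Prod.ext hc (hsnd x (hU₂ hx) c)⟩

end CharFrame

/-! ### Fibre coordinates on the dual of the characteristic distribution. -/

section CharDual

variable {E : Type u} [NormedAddCommGroup E] [NormedSpace ℝ E] [FiniteDimensional ℝ E]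
  {H : Type v} [TopologicalSpace H] {I : ModelWithCorners ℝ E H} [I.Boundaryless]
  {M : Type w} [TopologicalSpace M] [ChartedSpace H M] [IsManifold I ∞ M]
  {L : DiracStructure I M} {k : ℕ} {x₀ : M}

/-- A linear isomorphism of `(ℝ^k)^*` with `ℝ^k`. -/
def dualModel (k : ℕ) : (EuclideanSpace ℝ (Fin k) →L[ℝ] ℝ) ≃L[ℝ] EuclideanSpace ℝ (Fin k) :=
  ContinuousLinearEquiv.ofFinrankEq (by
    rw [← (LinearMap.toContinuousLinearMap :
      (EuclideanSpace ℝ (Fin k) →ₗ[ℝ] ℝ) ≃ₗ[ℝ] _).finrank_eq]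
    exact Subspace.dual_finrank_eq)

namespace CharFrame

variable (f : CharFrame L k x₀)

theorem ofModel_Y_mem {x : M} (hx : x ∈ f.U) (c : EuclideanSpace ℝ (Fin k)) :
    ofModel I x₀ x (f.Y x c) ∈ L.char x :=
  (f.mem_iff x hx _).2 ⟨c, (toModel_ofModel (f.subset hx) _).symm⟩

open Classical in
/-- The frame as a map into `L ∩ TM`. -/
def toChar (x : M) : EuclideanSpace ℝ (Fin k) →L[ℝ] L.char x :=
  if hx : x ∈ f.U then ((ofModel I x₀ x).comp (f.Y x)).codRestrict (L.char x) (f.ofModel_Y_mem hx)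
  else 0

theorem coe_toChar {x : M} (hx : x ∈ f.U) (c : EuclideanSpace ℝ (Fin k)) :
    (f.toChar x c : TangentSpace I x) = ofModel I x₀ x (f.Y x c) := by
  rw [toChar, dif_pos hx]; rfl

/-- The coordinates on `L ∩ TM` given by the left inverses. -/
def ofChar (x : M) : L.char x →L[ℝ] EuclideanSpace ℝ (Fin k) :=
  ((f.Φ x).comp (toModel I x₀ x)).comp (L.char x).subtypeL

theorem ofChar_toChar {x : M} (hx : x ∈ f.U) (c : EuclideanSpace ℝ (Fin k)) :
    f.ofChar x (f.toChar x c) = c := by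
  have h1 : f.ofChar x (f.toChar x c) = f.Φ x (toModel I x₀ x (f.toChar x c)) := rfl
  rw [h1, f.coe_toChar hx, toModel_ofModel (f.subset hx), f.leftInv x hx]

theorem toChar_ofChar {x : M} (hx : x ∈ f.U) (v : L.char x) :
    f.toChar x (f.ofChar x v) = v := by
  obtain ⟨c, hc⟩ := (f.mem_iff x hx v).1 v.2
  have h2 : f.toChar x c = v := by
    refine Subtype.ext ?_
    rw [f.coe_toChar hx, hc, ofModel_toModel (f.subset hx)]
  rw [← h2, f.ofChar_toChar hx]

/-- The coordinates on `(L ∩ TM)^*`. -/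
def dualCoord (x : M) : L.CharDual x →L[ℝ] EuclideanSpace ℝ (Fin k) :=
  (dualModel k : _ →L[ℝ] EuclideanSpace ℝ (Fin k)).comp
    (ContinuousLinearMap.precomp ℝ (f.toChar x))

/-- The covector with given coordinates. -/
def dualCoordSymm (x : M) : EuclideanSpace ℝ (Fin k) →L[ℝ] L.CharDual x :=
  (ContinuousLinearMap.precomp ℝ (f.ofChar x)).comp
    ((dualModel k).symm : EuclideanSpace ℝ (Fin k) →L[ℝ] _)

theorem dualCoord_apply (x : M) (e : L.CharDual x) :
    f.dualCoord x e = dualModel k (e.comp (f.toChar x)) := rfl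

theorem dualCoordSymm_apply (x : M) (a : EuclideanSpace ℝ (Fin k)) :
    f.dualCoordSymm x a = ((dualModel k).symm a).comp (f.ofChar x) := rfl

theorem dualCoord_dualCoordSymm {x : M} (hx : x ∈ f.U) (a : EuclideanSpace ℝ (Fin k)) :
    f.dualCoord x (f.dualCoordSymm x a) = a := by
  rw [dualCoord_apply, dualCoordSymm_apply]
  rw [show (((dualModel k).symm a).comp (f.ofChar x)).comp (f.toChar x) = (dualModel k).symm a from
    ContinuousLinearMap.ext fun c => congrArg ((dualModel k).symm a) (f.ofChar_toChar hx c)]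
  exact (dualModel k).apply_symm_apply a

theorem dualCoordSymm_dualCoord {x : M} (hx : x ∈ f.U) (e : L.CharDual x) :
    f.dualCoordSymm x (f.dualCoord x e) = e := by
  rw [dualCoord_apply, dualCoordSymm_apply, ContinuousLinearEquiv.symm_apply_apply]
  exact ContinuousLinearMap.ext fun c => congrArg e (f.toChar_ofChar hx c)

/-- The pretrivialization of `(L ∩ TM)^*` given by a frame of `L ∩ TM`. -/
def pretrivialization : Pretrivialization (EuclideanSpace ℝ (Fin k))
    (TotalSpace.proj : L.CharDualTotal k → M) where
  toFun p := (p.1, f.dualCoord p.1 p.2)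
  invFun p := ⟨p.1, f.dualCoordSymm p.1 p.2⟩
  source := TotalSpace.proj ⁻¹' f.U
  target := f.U ×ˢ univ
  map_source' _ hp := ⟨hp, mem_univ _⟩
  map_target' _ hp := hp.1
  left_inv' p hp := by
    obtain ⟨x, e⟩ := p
    exact congrArg (TotalSpace.mk x) (f.dualCoordSymm_dualCoord hp e)
  right_inv' p hp := Prod.ext rfl (f.dualCoord_dualCoordSymm hp.1 p.2)
  open_target := f.isOpen.prod isOpen_univ
  baseSet := f.U
  open_baseSet := f.isOpen
  source_eq := rfl
  target_eq := rfl
  proj_toFun _ _ := rfl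

theorem pretrivialization_symm {x : M} (hx : x ∈ f.U) (a : EuclideanSpace ℝ (Fin k)) :
    f.pretrivialization.symm x a = f.dualCoordSymm x a := by
  have h := f.pretrivialization.mk_symm hx a
  have h2 : f.pretrivialization.toPartialEquiv.symm (x, a) =
    (⟨x, f.dualCoordSymm x a⟩ : L.CharDualTotal k) := rfl
  rw [h2] at h
  exact eq_of_heq (TotalSpace.mk.inj h).2

variable {x₁ : M} (g : CharFrame L k x₁)

/-- The change of coordinates between two frames. -/
def coordChange (x : M) : EuclideanSpace ℝ (Fin k) →L[ℝ] EuclideanSpace ℝ (Fin k) :=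
  (g.dualCoord x).comp (f.dualCoordSymm x)

end CharFrame

end CharDual

/-! ### The smooth vector bundle structure on the dual. -/

section CharDual

variable {E : Type u} [NormedAddCommGroup E] [NormedSpace ℝ E] [FiniteDimensional ℝ E]
  {H : Type v} [TopologicalSpace H] {I : ModelWithCorners ℝ E H} [I.Boundaryless]
  {M : Type w} [TopologicalSpace M] [ChartedSpace H M] [IsManifold I ∞ M]
  {L : DiracStructure I M} {k : ℕ} {x₀ : M}

theorem contMDiffOn_toModel_comp_ofModel (x₀ x₁ : M) :
    ContMDiffOn I 𝓘(ℝ, E →L[ℝ] E) ∞ (fun x => (toModel I x₀ x).comp (ofModel I x₁ x))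
      ((chartAt H x₁).source ∩ (chartAt H x₀).source) := by
  have h := contMDiffOn_coordChangeL (IB := I) (n := ∞)
    (trivializationAt E (TangentSpace I : M → Type u) x₁)
    (trivializationAt E (TangentSpace I : M → Type u) x₀)
  refine (h.congr fun x hx => ?_).mono ?_
  · ext v
    have h1 := (trivializationAt E (TangentSpace I : M → Type u) x₁).coordChangeL_apply (R := ℝ)
      (trivializationAt E (TangentSpace I : M → Type u) x₀) hx v
    refine Eq.trans ?_ h1.symm
    have h2 : ofModel I x₁ x v =
        (trivializationAt E (TangentSpace I : M → Type u) x₁).symm x v :=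
      (trivializationAt E (TangentSpace I : M → Type u) x₁).symmL_apply (R := ℝ) hx.1 v
    have h3 := (trivializationAt E (TangentSpace I : M → Type u) x₀).continuousLinearMapAt_apply_of_mem
      ℝ hx.2 (ofModel I x₁ x v)
    refine h3.trans ?_
    rw [h2]
  · simp

namespace CharFrame

variable (f : CharFrame L k x₀) {x₁ : M} (g : CharFrame L k x₁)

/-- The transition between the frames of `L ∩ TM` is `Φ` of one frame, the transition map of `TM`,
and `Y` of the other, composed. The coordinate change on the dual is the transpose of this smooth
family. -/
theorem contMDiffOn_coordChange :
    ContMDiffOn I 𝓘(ℝ, EuclideanSpace ℝ (Fin k) →L[ℝ] EuclideanSpace ℝ (Fin k)) ∞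
      (f.coordChange g) (f.U ∩ g.U) := by
  let C : M → EuclideanSpace ℝ (Fin k) →L[ℝ] EuclideanSpace ℝ (Fin k) := fun x =>
    (f.Φ x).comp (((toModel I x₀ x).comp (ofModel I x₁ x)).comp (g.Y x))
  have hC : ContMDiffOn I 𝓘(ℝ, EuclideanSpace ℝ (Fin k) →L[ℝ] EuclideanSpace ℝ (Fin k)) ∞
      C (f.U ∩ g.U) :=
    (f.smooth_Φ.mono inter_subset_left).clm_comp
      (((contMDiffOn_toModel_comp_ofModel x₀ x₁).mono fun x hx =>
        ⟨g.subset hx.2, f.subset hx.1⟩).clm_comp (g.smooth_Y.mono inter_subset_right))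
  have hD : ContDiff ℝ ∞ (fun C : EuclideanSpace ℝ (Fin k) →L[ℝ] EuclideanSpace ℝ (Fin k) =>
      (dualModel k : _ →L[ℝ] EuclideanSpace ℝ (Fin k)).comp
        ((ContinuousLinearMap.precomp ℝ C).comp
          ((dualModel k).symm :
            EuclideanSpace ℝ (Fin k) →L[ℝ] (EuclideanSpace ℝ (Fin k) →L[ℝ] ℝ)))) := by
    rw [contDiff_clm_apply_iff]
    intro a
    exact (dualModel k).contDiff.comp (contDiff_const.clm_comp contDiff_id)
  refine (hD.contMDiff.comp_contMDiffOn hC).congr fun x hx => ?_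
  ext1 a
  have h1 : (f.ofChar x).comp (g.toChar x) = C x := by
    refine ContinuousLinearMap.ext fun c => ?_
    exact congrArg (fun v => f.Φ x (toModel I x₀ x v)) (g.coe_toChar hx.2 c)
  have h2 : f.coordChange g x a =
    dualModel k (((dualModel k).symm a).comp ((f.ofChar x).comp (g.toChar x))) := rfl
  rw [h2, h1]
  rfl

theorem coordChange_apply {x : M} (hx : x ∈ f.U) (a : EuclideanSpace ℝ (Fin k)) :
    f.coordChange g x a = (g.pretrivialization ⟨x, f.pretrivialization.symm x a⟩).2 := by
  rw [f.pretrivialization_symm hx]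
  rfl

theorem isInducing_dualCoord {x : M} (hx : x ∈ f.U) : Topology.IsInducing (f.dualCoord x) :=
  Topology.IsInducing.of_comp (f.dualCoord x).continuous (f.dualCoordSymm x).continuous (by
    rw [show f.dualCoordSymm x ∘ f.dualCoord x = id from
      funext fun e => f.dualCoordSymm_dualCoord hx e]
    exact Topology.IsInducing.id)

end CharFrame

/-- The vector prebundle `(L ∩ TM)^*` given by a family of frames. -/
def charDualPrebundle (f : ∀ x₀, CharFrame L k x₀) :
    VectorPrebundle ℝ (EuclideanSpace ℝ (Fin k)) L.CharDual where
  pretrivializationAtlas := range fun x₀ => (f x₀).pretrivialization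
  pretrivialization_linear' := by
    rintro _ ⟨x₀, rfl⟩
    exact ⟨fun x hx => ⟨fun a b => map_add ((f x₀).dualCoord x) a b,
      fun c a => map_smul ((f x₀).dualCoord x) c a⟩⟩
  pretrivializationAt x₀ := (f x₀).pretrivialization
  mem_base_pretrivializationAt x₀ := (f x₀).mem
  pretrivialization_mem_atlas x₀ := ⟨x₀, rfl⟩
  exists_coordChange := by
    rintro _ ⟨x₀, rfl⟩ _ ⟨x₁, rfl⟩
    exact ⟨(f x₀).coordChange (f x₁), ((f x₀).contMDiffOn_coordChange (f x₁)).continuousOn,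
      fun x hx a => (f x₀).coordChange_apply (f x₁) hx.1 a⟩
  totalSpaceMk_isInducing x :=
    (isInducing_prodMkRight x).comp ((f x).isInducing_dualCoord (f x).mem)

instance (f : ∀ x₀, CharFrame L k x₀) : (charDualPrebundle f).IsContMDiff I ∞ where
  exists_contMDiffCoordChange := by
    rintro _ ⟨x₀, rfl⟩ _ ⟨x₁, rfl⟩
    exact ⟨(f x₀).coordChange (f x₁), (f x₀).contMDiffOn_coordChange (f x₁),
      fun x hx a => (f x₀).coordChange_apply (f x₁) hx.1 a⟩

theorem CharFrame.dualCoord_comp_subtypeL (f : CharFrame L k x₀) {x : M} (hx : x ∈ f.U)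
    (ξ : Cotangent I x) : f.dualCoord x (ξ.comp (L.char x).subtypeL) =
      dualModel k ((covectorToModel I x₀ x ξ).comp (f.Y x)) := by
  rw [CharFrame.dualCoord_apply]
  refine congrArg _ (ContinuousLinearMap.ext fun c => ?_)
  exact congrArg ξ (f.coe_toChar hx c)

theorem contMDiffAt_covectorToModel (p : CotangentBundle I M) :
    ContMDiffAt (I.prod 𝓘(ℝ, E →L[ℝ] ℝ)) 𝓘(ℝ, E →L[ℝ] ℝ) ∞
      (fun q : CotangentBundle I M => covectorToModel I p.1 q.1 q.2) p := by
  have h := ((contMDiffAt_totalSpace (IM := I.prod 𝓘(ℝ, E →L[ℝ] ℝ)) (IB := I) (n := ∞)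
    (f := fun q : CotangentBundle I M => q) (x₀ := p)).1 contMDiffAt_id).2
  refine h.congr_of_eventuallyEq ?_
  have h1 : ∀ᶠ q : CotangentBundle I M in 𝓝 p, q.1 ∈ (chartAt H p.1).source :=
    (FiberBundle.continuous_proj (E →L[ℝ] ℝ)
      (fun x : M => Cotangent I x)).continuousAt.eventually (chart_source_mem_nhds H p.1)
  filter_upwards [h1] with q hq
  exact (trivializationAt_cotangent hq q.2).symm

/-- The vector bundle `(L ∩ TM)^*` given by a family of frames. -/
abbrev charDualBundle (f : ∀ x₀, CharFrame L k x₀) : L.CharDualBundle k :=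
  letI := (charDualPrebundle f).totalSpaceTopology
  letI := (charDualPrebundle f).toFiberBundle
  letI := (charDualPrebundle f).toVectorBundle
  { topology := (charDualPrebundle f).totalSpaceTopology
    fiberBundle := (charDualPrebundle f).toFiberBundle
    vectorBundle := (charDualPrebundle f).toVectorBundle
    contMDiffVectorBundle := (charDualPrebundle f).contMDiffVectorBundle I
    -- In coordinates the restriction of `ξ` is `ξ ∘ Y`, which is smooth in the point and in `ξ`.
    contMDiff_restrict := by
      intro p
      rw [contMDiffAt_totalSpace]
      refine ⟨contMDiffAt_proj _, ?_⟩
      have h1 : ContMDiffAt (I.prod 𝓘(ℝ, E →L[ℝ] ℝ)) I ∞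
        (fun q : CotangentBundle I M => q.1) p := contMDiffAt_proj _
      have h2 : ContMDiffAt (I.prod 𝓘(ℝ, E →L[ℝ] ℝ))
          𝓘(ℝ, EuclideanSpace ℝ (Fin k) →L[ℝ] E) ∞
          (fun q : CotangentBundle I M => (f p.1).Y q.1) p :=
        (((f p.1).smooth_Y).contMDiffAt ((f p.1).isOpen.mem_nhds (f p.1).mem)).comp p h1
      have h3 := (dualModel k).contDiff (n := ∞) |>.contMDiff.contMDiffAt.comp p
        ((contMDiffAt_covectorToModel p).clm_comp h2)
      refine h3.congr_of_eventuallyEq ?_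
      filter_upwards [h1.continuousAt.eventually ((f p.1).isOpen.mem_nhds (f p.1).mem)] with q hq
      exact (f p.1).dualCoord_comp_subtypeL hq q.2 }

/-- The trivializations of `(L ∩ TM)^*` are those given by the frames `f`. -/
def IsFrameFamily [L.CharDualBundle k] (f : ∀ x₀, CharFrame L k x₀) : Prop :=
  ∀ x₀, (trivializationAt (EuclideanSpace ℝ (Fin k)) L.CharDual x₀).baseSet = (f x₀).U ∧
    ∀ x e, (trivializationAt (EuclideanSpace ℝ (Fin k)) L.CharDual x₀ ⟨x, e⟩).2 =
      (f x₀).dualCoord x e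

theorem isFrameFamily_charDualBundle (f : ∀ x₀, CharFrame L k x₀) :
    letI := charDualBundle f
    IsFrameFamily f :=
  fun _ => ⟨rfl, fun _ _ => rfl⟩

end CharDual

/-! ### Existence of a smooth complement. -/

section Complement

variable {E : Type u} [NormedAddCommGroup E] [NormedSpace ℝ E] [FiniteDimensional ℝ E]
  {H : Type v} [TopologicalSpace H] {I : ModelWithCorners ℝ E H} [I.Boundaryless]
  {M : Type w} [TopologicalSpace M] [ChartedSpace H M] [IsManifold I ∞ M]
  {L : DiracStructure I M} {k : ℕ} {x₀ : M}

theorem contMDiffOn_end_iff {P : Π x : M, TangentSpace I x →L[ℝ] TangentSpace I x} {U : Set M}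
    (hU : IsOpen U) (hUs : U ⊆ (chartAt H x₀).source) :
    ContMDiffOn I (I.prod 𝓘(ℝ, E →L[ℝ] E)) ∞ (fun x => (⟨x, P x⟩ :
      TotalSpace (E →L[ℝ] E) (fun x : M => TangentSpace I x →L[ℝ] TangentSpace I x))) U ↔
    ContMDiffOn I 𝓘(ℝ, E →L[ℝ] E) ∞
      (fun x => ((toModel I x₀ x).comp ((P x).comp (ofModel I x₀ x)) : E →L[ℝ] E)) U := by
  have h := (trivializationAt (E →L[ℝ] E)
    (fun x : M => TangentSpace I x →L[ℝ] TangentSpace I x) x₀).contMDiffOn_section_iff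
    (IB := I) (n := ∞) (s := P) (a := U) hU (by simpa using hUs)
  exact h

/-- The projections onto a fixed subspace form a convex set, since both conditions are affine. The
local projections `Y Φ` can thus be glued by a partition of unity. -/
theorem exists_smooth_projection [T2Space M] [SigmaCompactSpace M]
    (f : ∀ x₀, CharFrame L k x₀) :
    ∃ P : Π x : M, TangentSpace I x →L[ℝ] TangentSpace I x,
      ContMDiff I (I.prod 𝓘(ℝ, E →L[ℝ] E)) ∞ (fun x => (⟨x, P x⟩ :
        TotalSpace (E →L[ℝ] E) (fun x : M => TangentSpace I x →L[ℝ] TangentSpace I x))) ∧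
      ∀ x, (∀ v, P x v ∈ L.char x) ∧ ∀ v ∈ L.char x, P x v = v := by
  suffices h : ∃ s : ContMDiffSection I (E →L[ℝ] E) ∞
      (fun x : M => TangentSpace I x →L[ℝ] TangentSpace I x),
      ∀ x, s x ∈ {P : TangentSpace I x →L[ℝ] TangentSpace I x |
        (∀ v, P v ∈ L.char x) ∧ ∀ v ∈ L.char x, P v = v} by
    obtain ⟨s, hs⟩ := h
    exact ⟨s, s.contMDiff, hs⟩
  refine exists_contMDiffSection_forall_mem_convex_of_local (I := I) (n := ⊤)
    (F_fiber := E →L[ℝ] E) (fun x : M => TangentSpace I x →L[ℝ] TangentSpace I x)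
    (fun x => {P | (∀ v, P v ∈ L.char x) ∧ ∀ v ∈ L.char x, P v = v}) ?_ ?_
  · intro x P hP Q hQ a b ha hb hab
    refine ⟨fun v => (L.char x).add_mem ((L.char x).smul_mem _ (hP.1 v))
      ((L.char x).smul_mem _ (hQ.1 v)), fun v hv => ?_⟩
    have h1 : (a • P + b • Q) v = a • P v + b • Q v := rfl
    rw [h1, hP.2 v hv, hQ.2 v hv, ← add_smul, hab, one_smul]
  · intro x₀
    let g := f x₀
    refine ⟨g.U, g.isOpen.mem_nhds g.mem, fun x =>
      (ofModel I x₀ x).comp (((g.Y x).comp (g.Φ x)).comp (toModel I x₀ x)), ?_, ?_⟩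
    · refine (contMDiffOn_end_iff g.isOpen g.subset).2 ?_
      refine (g.smooth_Y.clm_comp g.smooth_Φ).congr fun x hx => ?_
      ext v
      have h1 := toModel_ofModel (I := I) (g.subset hx) v
      have h2 := toModel_ofModel (I := I) (g.subset hx)
        (g.Y x (g.Φ x (toModel I x₀ x (ofModel I x₀ x v))))
      rw [h1] at h2
      refine Eq.trans ?_ h2
      exact congrArg (fun w => toModel I x₀ x (ofModel I x₀ x (g.Y x (g.Φ x w)))) h1
    · intro x hx
      refine ⟨fun v => g.ofModel_Y_mem hx _, fun v hv => ?_⟩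
      obtain ⟨c, hc⟩ := (g.mem_iff x hx v).1 hv
      have h1 : g.Y x (g.Φ x (toModel I x₀ x v)) = toModel I x₀ x v := by
        rw [← hc, g.leftInv x hx]
      exact (congrArg (ofModel I x₀ x) h1).trans (ofModel_toModel (g.subset hx) v)

/-- The complement is the kernel of a smooth projection onto `L ∩ TM`. Its rank is constant, so it
has local smooth frames. -/
theorem exists_isSmoothComplement [T2Space M] [SigmaCompactSpace M]
    (f : ∀ x₀, CharFrame L k x₀) (hk : ∀ x, L.charRank x = k) :
    ∃ V : Π x : M, Submodule ℝ (TangentSpace I x), L.IsSmoothComplement V := by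
  obtain ⟨P, hP, hPm⟩ := exists_smooth_projection f
  refine ⟨fun x => LinearMap.ker (P x : TangentSpace I x →ₗ[ℝ] TangentSpace I x), ?_, ?_⟩
  · intro x₀
    have hA := (contMDiffOn_end_iff (P := P) (x₀ := x₀) (chartAt H x₀).open_source subset_rfl).1
      hP.contMDiffOn
    have hker : ∀ x ∈ (chartAt H x₀).source, Module.finrank ℝ (LinearMap.ker
        ((((toModel I x₀ x).comp ((P x).comp (ofModel I x₀ x)) : E →L[ℝ] E)) : E →ₗ[ℝ] E)) =
        Module.finrank ℝ E - k := by
      intro x hx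
      let A : E →ₗ[ℝ] E := ((toModel I x₀ x).comp ((P x).comp (ofModel I x₀ x)) : E →L[ℝ] E)
      let T : TangentSpace I x →ₗ[ℝ] E := (toModel I x₀ x : TangentSpace I x →L[ℝ] E)
      have hT : Function.Injective T := fun v w hvw =>
        (ofModel_toModel hx v).symm.trans
          ((congrArg (ofModel I x₀ x) hvw).trans (ofModel_toModel hx w))
      have h1 : LinearMap.range A = (L.char x).map T := by
        ext v
        constructor
        · rintro ⟨w, rfl⟩
          exact ⟨_, (hPm x).1 _, rfl⟩
        · rintro ⟨w, hw, rfl⟩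
          refine ⟨toModel I x₀ x w, ?_⟩
          have e1 := (congrArg (P x) (ofModel_toModel hx w)).trans ((hPm x).2 w hw)
          exact congrArg (toModel I x₀ x) e1
      have h2 : Module.finrank ℝ (LinearMap.range A) = k := by
        rw [h1, ← hk x]
        exact (Submodule.equivMapOfInjective T hT (L.char x)).finrank_eq.symm
      have h3 := LinearMap.finrank_range_add_finrank_ker A
      rw [h2] at h3
      exact Nat.eq_sub_of_add_eq' h3
    obtain ⟨U, hU, hoU, hx₀, K, hK, hKA⟩ := exists_smooth_kernel_frame
      (k := Module.finrank ℝ E - k) (chartAt H x₀).open_source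
      (mem_chart_source H x₀) hA hker
    · refine ⟨U, hoU, hx₀, _, fun i x => ofModel I x₀ x (K x (EuclideanSpace.single i 1)),
        fun i => ?_, fun x hx => ?_⟩
      · refine (smoothVectorFieldOn_iff hoU hU).2 ?_
        refine (hK.clm_apply (contMDiffOn_const (c := EuclideanSpace.single i (1 : ℝ)))).congr
          fun x hx => toModel_ofModel (hU hx) _
      · let g : EuclideanSpace ℝ (Fin (Module.finrank ℝ E - k)) →ₗ[ℝ] TangentSpace I x :=
          ((ofModel I x₀ x).comp (K x) : EuclideanSpace ℝ (Fin _) →L[ℝ] TangentSpace I x)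
        have hg : Function.Injective g := by
          intro c d hcd
          refine (hKA x hx).1 ?_
          have h1 := congrArg (toModel I x₀ x) hcd
          exact (toModel_ofModel (hU hx) _).symm.trans (h1.trans (toModel_ofModel (hU hx) _))
        let b := (EuclideanSpace.basisFun (Fin (Module.finrank ℝ E - k)) ℝ).toBasis
        have hb : (fun i => ofModel I x₀ x (K x (EuclideanSpace.single i 1))) = g ∘ b := by
          funext i
          simp [b, g]
        refine ⟨?_, ?_⟩
        · rw [hb]
          exact b.linearIndependent.map' g (LinearMap.ker_eq_bot.2 hg)
        · rw [hb, range_comp, ← Submodule.map_span, b.span_eq, Submodule.map_top]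
          ext v
          constructor
          · intro hv
            have h1 : toModel I x₀ x (P x (ofModel I x₀ x (toModel I x₀ x v))) = 0 := by
              rw [ofModel_toModel (hU hx)]
              exact (congrArg (toModel I x₀ x) hv).trans (map_zero _)
            obtain ⟨c, hc⟩ := ((hKA x hx).2 _).1 h1
            exact ⟨c, (congrArg (ofModel I x₀ x) hc).trans (ofModel_toModel (hU hx) v)⟩
          · rintro ⟨c, rfl⟩
            have h1 : toModel I x₀ x (P x (ofModel I x₀ x (K x c))) = 0 :=
              ((hKA x hx).2 _).2 ⟨c, rfl⟩
            have h2 := congrArg (ofModel I x₀ x) h1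
            exact (ofModel_toModel (hU hx) _).symm.trans (h2.trans (map_zero _))
  · intro x
    refine ⟨?_, ?_⟩
    · rw [Submodule.disjoint_def]
      intro v hv hv'
      exact ((hPm x).2 v hv).symm.trans hv'
    · rw [Submodule.codisjoint_iff_exists_add_eq]
      intro v
      refine ⟨P x v, v - P x v, (hPm x).1 v, ?_, add_sub_cancel _ _⟩
      have h1 : P x (v - P x v) = P x v - P x (P x v) := map_sub _ _ _
      exact h1.trans (sub_eq_zero.2 ((hPm x).2 _ ((hPm x).1 v)).symm)

end Complement

/-! ### Charts of a vector bundle and the canonical 1-form. -/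

section BundleCharts

variable {E : Type u} [NormedAddCommGroup E] [NormedSpace ℝ E]
  {H : Type v} [TopologicalSpace H] {I : ModelWithCorners ℝ E H} [I.Boundaryless]
  {M : Type w} [TopologicalSpace M] [ChartedSpace H M] [IsManifold I ∞ M]
  {F : Type*} [NormedAddCommGroup F] [NormedSpace ℝ F]
  {Z : M → Type*} [∀ x, AddCommMonoid (Z x)] [∀ x, Module ℝ (Z x)] [∀ x, TopologicalSpace (Z x)]
  [TopologicalSpace (TotalSpace F Z)] [FiberBundle F Z] [VectorBundle ℝ F Z]
  [ContMDiffVectorBundle ∞ F Z I]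

theorem mem_chart_source_totalSpace {p₀ p : TotalSpace F Z} :
    p ∈ (chartAt (ModelProd H F) p₀).source ↔
      p.1 ∈ (trivializationAt F Z p₀.1).baseSet ∧ p.1 ∈ (chartAt H p₀.1).source := by
  rw [FiberBundle.chartedSpace_chartAt]
  simp only [mfld_simps]
  rw [(trivializationAt F Z p₀.1).mem_source]
  constructor
  · rintro ⟨h1, h2⟩
    refine ⟨h1, ?_⟩
    rwa [(trivializationAt F Z p₀.1).coe_fst' h1] at h2
  · rintro ⟨h1, h2⟩
    refine ⟨h1, ?_⟩
    rwa [(trivializationAt F Z p₀.1).coe_fst' h1]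

theorem extChartAt_totalSpace {p₀ p : TotalSpace F Z}
    (hp : p.1 ∈ (trivializationAt F Z p₀.1).baseSet) :
    extChartAt (I.prod 𝓘(ℝ, F)) p₀ p =
      (extChartAt I p₀.1 p.1, (trivializationAt F Z p₀.1 p).2) := by
  rw [FiberBundle.extChartAt]
  simp only [PartialEquiv.coe_trans, Function.comp_apply, PartialEquiv.prod_coe,
    PartialEquiv.refl_coe, id_eq]
  refine Prod.ext ?_ rfl
  exact congrArg (extChartAt I p₀.1) ((trivializationAt F Z p₀.1).coe_fst' hp)

theorem toModel_mfderiv_proj {p₀ p : TotalSpace F Z}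
    (hp : p ∈ (chartAt (ModelProd H F) p₀).source) (X : TangentSpace (I.prod 𝓘(ℝ, F)) p) :
    toModel I p₀.1 p.1 (mfderiv (I.prod 𝓘(ℝ, F)) I (TotalSpace.proj : TotalSpace F Z → M) p X) =
      (toModel (I.prod 𝓘(ℝ, F)) p₀ p X).1 := by
  have hp' := mem_chart_source_totalSpace.1 hp
  have h1 : MDifferentiableAt (I.prod 𝓘(ℝ, F)) I (TotalSpace.proj : TotalSpace F Z → M) p :=
    (contMDiffAt_proj Z (n := ∞)).mdifferentiableAt (by simp)
  have h2 := mfderiv_comp p (mdifferentiableAt_extChartAt (I := I) hp'.2) h1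
  have h3 := mdifferentiableAt_extChartAt (I := I.prod 𝓘(ℝ, F)) hp
  have h4 := mfderiv_comp (I'' := 𝓘(ℝ, E)) p
    ((ContinuousLinearMap.fst ℝ E F).differentiableAt.mdifferentiableAt) h3
  have h5 : (extChartAt I p₀.1 ∘ (TotalSpace.proj : TotalSpace F Z → M)) =ᶠ[𝓝 p]
      (ContinuousLinearMap.fst ℝ E F ∘ extChartAt (I.prod 𝓘(ℝ, F)) p₀) := by
    have : ∀ᶠ q : TotalSpace F Z in 𝓝 p, q.1 ∈ (trivializationAt F Z p₀.1).baseSet :=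
      (FiberBundle.continuous_proj F Z).continuousAt.eventually
        ((trivializationAt F Z p₀.1).open_baseSet.mem_nhds hp'.1)
    filter_upwards [this] with q hq
    exact (congrArg Prod.fst (extChartAt_totalSpace hq)).symm
  have h6 := h5.mfderiv_eq (I := I.prod 𝓘(ℝ, F)) (I' := 𝓘(ℝ, E))
  rw [h2, h4] at h6
  rw [toModel_eq_mfderiv hp, toModel_eq_mfderiv hp'.2]
  have h7 := congrArg (fun A => A X) h6
  refine Eq.trans h7 ?_
  rw [mfderiv_eq_fderiv, (ContinuousLinearMap.fst ℝ E F).fderiv]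
  rfl

theorem mfderiv_proj_ofModel {p₀ p : TotalSpace F Z}
    (hp : p ∈ (chartAt (ModelProd H F) p₀).source) (v : E × F) :
    mfderiv (I.prod 𝓘(ℝ, F)) I (TotalSpace.proj : TotalSpace F Z → M) p
      (ofModel (I.prod 𝓘(ℝ, F)) p₀ p v) = ofModel I p₀.1 p.1 v.1 := by
  have h1 := toModel_mfderiv_proj hp (ofModel (I.prod 𝓘(ℝ, F)) p₀ p v)
  have h2 := toModel_ofModel (I := I.prod 𝓘(ℝ, F)) hp v
  have h3 := congrArg (ofModel I p₀.1 p.1) (h1.trans (congrArg Prod.fst h2))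
  exact (ofModel_toModel (mem_chart_source_totalSpace.1 hp).2 _).symm.trans h3

/-- This is the coordinate formula `∑ pᵢ dqᵢ`: at `y = (q, p)` the form is `p` composed with the
projection to the base directions. -/
theorem oneFormInChart_canonicalOneForm (q : CotangentBundle I M) :
    oneFormInChart (I.prod 𝓘(ℝ, E →L[ℝ] ℝ)) (canonicalOneForm I) q =ᶠ[
      𝓝 (extChartAt (I.prod 𝓘(ℝ, E →L[ℝ] ℝ)) q q)]
      fun y => y.2.comp (ContinuousLinearMap.fst ℝ E (E →L[ℝ] ℝ)) := by
  filter_upwards [oneFormInChart_eq (I := I.prod 𝓘(ℝ, E →L[ℝ] ℝ)) (canonicalOneForm I) q,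
    eventually_extChartAt_symm_mem_source (I := I.prod 𝓘(ℝ, E →L[ℝ] ℝ)) q] with y h1 h2
  rw [h1]
  have h3 := mem_chart_source_totalSpace.1 h2.1
  have h4 := (congrArg Prod.snd (extChartAt_totalSpace (I := I) h3.1)).symm.trans
    (congrArg Prod.snd h2.2)
  rw [trivializationAt_cotangent h3.2] at h4
  refine ContinuousLinearMap.ext fun v => ?_
  have h5 := mfderiv_proj_ofModel (I := I) h2.1 v
  have h6 := congrArg (((extChartAt (I.prod 𝓘(ℝ, E →L[ℝ] ℝ)) q).symm y).2) h5
  exact h6.trans (congrArg (fun ξ => ξ v.1) h4)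

theorem differentiableAt_canonicalOneForm (q : CotangentBundle I M) :
    DifferentiableAt ℝ (oneFormInChart (I.prod 𝓘(ℝ, E →L[ℝ] ℝ)) (canonicalOneForm I) q)
      (extChartAt (I.prod 𝓘(ℝ, E →L[ℝ] ℝ)) q q) := by
  refine DifferentiableAt.congr_of_eventuallyEq ?_ (oneFormInChart_canonicalOneForm q)
  exact differentiableAt_snd.clm_comp (differentiableAt_const _)

end BundleCharts

/-! ### Frames adapted to a complement. -/

section Splitting

variable {E : Type u} [NormedAddCommGroup E] [NormedSpace ℝ E] [FiniteDimensional ℝ E]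
  {H : Type v} [TopologicalSpace H] {I : ModelWithCorners ℝ E H} [I.Boundaryless]
  {M : Type w} [TopologicalSpace M] [ChartedSpace H M] [IsManifold I ∞ M]
  {L : DiracStructure I M} {k : ℕ} {x₀ : M}

/-- The left inverse of a frame of `L ∩ TM` can be chosen to vanish on a given complement. -/
theorem DiracStructure.IsSmoothComplement.exists_charFrame
    {V : Π x : M, Submodule ℝ (TangentSpace I x)} (hV : L.IsSmoothComplement V)
    (f : CharFrame L k x₀) :
    ∃ g : CharFrame L k x₀, g.Y = f.Y ∧ g.U ⊆ f.U ∧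
      ∀ x ∈ g.U, ∀ v ∈ V x, g.Φ x (toModel I x₀ x v) = 0 := by
  obtain ⟨U₁, hU₁, hx₁, r, X, hX, hXV⟩ := hV.smooth x₀
  have hU := hU₁.inter f.isOpen
  set U := U₁ ∩ f.U with hUdef
  have hUs : U ⊆ (chartAt H x₀).source := inter_subset_right.trans f.subset
  let W : M → (Fin r → ℝ) →L[ℝ] E := fun x => frameCLM fun i => toModel I x₀ x (X i x)
  have hW : ContMDiffOn I 𝓘(ℝ, (Fin r → ℝ) →L[ℝ] E) ∞ W U := by
    refine (contDiff_frameCLM (S := E)).contMDiff.comp_contMDiffOn ?_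
    rw [contMDiffOn_pi_space]
    exact fun i => (smoothVectorFieldOn_iff hU hUs).1 ((hX i).mono inter_subset_left)
  have hWX : ∀ x d, W x d = toModel I x₀ x (∑ i, d i • X i x) := by
    intro x d
    rw [map_sum]
    simp only [map_smul]
    rfl
  -- `A` joins the frame of `L ∩ TM` with a frame of `V`, so it is invertible. The first component
  -- of its inverse is the required left inverse: it kills `V`.
  let A : M → (EuclideanSpace ℝ (Fin k) × (Fin r → ℝ)) →L[ℝ] E := fun x =>
    (f.Y x).comp (ContinuousLinearMap.fst ℝ _ _) + (W x).comp (ContinuousLinearMap.snd ℝ _ _)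
  have hA : ContMDiffOn I 𝓘(ℝ, (EuclideanSpace ℝ (Fin k) × (Fin r → ℝ)) →L[ℝ] E) ∞ A U :=
    ((f.smooth_Y.mono inter_subset_right).clm_comp contMDiffOn_const).add
      (hW.clm_comp contMDiffOn_const)
  have hAapp : ∀ x c d, A x (c, d) = f.Y x c + W x d := fun x c d => rfl
  have hAi : ∀ x ∈ U, (A x).IsInvertible := by
    intro x hx
    have hYm : ∀ c, ofModel I x₀ x (f.Y x c) ∈ L.char x := f.ofModel_Y_mem hx.2
    have hWm : ∀ d : Fin r → ℝ, (∑ i, d i • X i x) ∈ V x := fun d => by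
      rw [(hXV x hx.1).2]
      exact Submodule.sum_mem _ fun i _ => Submodule.smul_mem _ _ (Submodule.subset_span ⟨i, rfl⟩)
    have hY : ∀ c, toModel I x₀ x (ofModel I x₀ x (f.Y x c)) = f.Y x c :=
      fun c => toModel_ofModel (hUs hx) _
    refine isInvertible_of_bijective ⟨?_, ?_⟩
    · rw [injective_iff_map_eq_zero]
      rintro ⟨c, d⟩ h0
      rw [hAapp, ← hY, hWX, ← map_add] at h0
      have h1 := (ofModel_toModel (hUs hx) _).symm.trans
        ((congrArg (ofModel I x₀ x) h0).trans (map_zero _))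
      have h2 : ofModel I x₀ x (f.Y x c) = -(∑ i, d i • X i x) := eq_neg_of_add_eq_zero_left h1
      have h3 : ofModel I x₀ x (f.Y x c) = 0 :=
        Submodule.disjoint_def.1 (hV.isCompl x).disjoint _ (hYm c)
          (h2 ▸ (V x).neg_mem (hWm d))
      have h4 : f.Y x c = 0 := by rw [← hY, h3]; exact map_zero _
      have h5 : (∑ i, d i • X i x) = 0 := neg_eq_zero.1 (h2.symm.trans h3)
      refine Prod.ext ?_ (funext fun i => Fintype.linearIndependent_iff.1 (hXV x hx.1).1 d h5 i)
      exact (f.leftInv x hx.2 c).symm.trans ((congrArg (f.Φ x) h4).trans (map_zero _))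
    · intro v
      obtain ⟨y, z, hy, hz, hyz⟩ := Submodule.codisjoint_iff_exists_add_eq.1
        (hV.isCompl x).codisjoint (ofModel I x₀ x v)
      obtain ⟨c, hc⟩ := (f.mem_iff x hx.2 y).1 hy
      rw [(hXV x hx.1).2, Submodule.mem_span_range_iff_exists_fun] at hz
      obtain ⟨d, hd⟩ := hz
      refine ⟨(c, d), ?_⟩
      rw [hAapp, hc, hWX, hd, ← map_add, hyz]
      exact toModel_ofModel (hUs hx) v
  have hinv : ∀ x ∈ U, ∀ c d, (A x).inverse (A x (c, d)) = (c, d) := fun x hx c d =>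
    congrArg (fun B => B (c, d)) (hAi x hx).inverse_comp_self
  have hinvY : ∀ x ∈ U, ∀ c, (A x).inverse (f.Y x c) = (c, 0) := by
    intro x hx c
    rw [← hinv x hx, hAapp, map_zero, add_zero]
  refine ⟨⟨U, f.Y, fun x => (ContinuousLinearMap.fst ℝ _ _).comp (A x).inverse, hU,
    ⟨hx₁, f.mem⟩, hUs, f.smooth_Y.mono inter_subset_right, ?_, ?_, fun x hx => f.mem_iff x hx.2⟩,
    rfl, inter_subset_right, ?_⟩
  · intro x hx
    exact (contMDiffAt_const.clm_comp (contMDiffAt_clm_inverse (hA.contMDiffAt (hU.mem_nhds hx))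
      (hAi x hx))).contMDiffWithinAt
  · intro x hx c
    exact congrArg Prod.fst (hinvY x hx c)
  · intro x hx v hv
    rw [(hXV x hx.1).2, Submodule.mem_span_range_iff_exists_fun] at hv
    obtain ⟨d, hd⟩ := hv
    have h1 : A x (0, d) = toModel I x₀ x v := by
      rw [hAapp, map_zero, zero_add, hWX, hd]
    rw [← h1]
    exact congrArg Prod.fst (hinv x hx 0 d)

end Splitting

/-! ### Frames of gauged pullbacks on a product of vector spaces. -/

section Frames

variable {F : Type*} [NormedAddCommGroup F] [NormedSpace ℝ F] [FiniteDimensional ℝ F]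
  {R : Type*} [NormedAddCommGroup R] [NormedSpace ℝ R] [FiniteDimensional ℝ R]
  {K : Type*} [NormedAddCommGroup K] [NormedSpace ℝ K] [FiniteDimensional ℝ K]

/-- A frame of the gauge transform by `B` of the pullback to `F × K` of the subspace of `F ⊕ F^*`
with frame `a`. -/
def gaugedFrame (a : R →L[ℝ] F × (F →L[ℝ] ℝ)) (B : F × K →L[ℝ] (F × K →L[ℝ] ℝ)) :
    (R × K) →L[ℝ] (F × K) × (F × K →L[ℝ] ℝ) :=
  (((ContinuousLinearMap.fst ℝ F (F →L[ℝ] ℝ)).comp a).prodMap (ContinuousLinearMap.id ℝ K)).prod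
    ((ContinuousLinearMap.precomp ℝ (ContinuousLinearMap.fst ℝ F K)).comp
        (((ContinuousLinearMap.snd ℝ F (F →L[ℝ] ℝ)).comp a).comp (ContinuousLinearMap.fst ℝ R K)) +
      B.comp (((ContinuousLinearMap.fst ℝ F (F →L[ℝ] ℝ)).comp a).prodMap
        (ContinuousLinearMap.id ℝ K)))

theorem gaugedFrame_apply (a : R →L[ℝ] F × (F →L[ℝ] ℝ)) (B : F × K →L[ℝ] (F × K →L[ℝ] ℝ))
    (c : R × K) : gaugedFrame a B c = (((a c.1).1, c.2),
      (a c.1).2.comp (ContinuousLinearMap.fst ℝ F K) + B ((a c.1).1, c.2)) := rfl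

theorem contDiffAt_gaugedFrame {n : WithTop ℕ∞} {G : F → R →L[ℝ] F × (F →L[ℝ] ℝ)}
    {B : F × K → F × K →L[ℝ] (F × K →L[ℝ] ℝ)} {z : F × K} (hG : ContDiffAt ℝ n G z.1)
    (hB : ContDiffAt ℝ n B z) : ContDiffAt ℝ n (fun y => gaugedFrame (G y.1) (B y)) z := by
  rw [contDiffAt_clm_apply_iff]
  intro c
  simp only [gaugedFrame_apply]
  have h1 : ContDiffAt ℝ n (fun y : F × K => G y.1 c.1) z :=
    (hG.comp z contDiffAt_fst).clm_apply contDiffAt_const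
  have h2 : ContDiffAt ℝ n (fun y : F × K => ((G y.1 c.1).1, c.2)) z := h1.fst.prodMk contDiffAt_const
  exact h2.prodMk ((h1.snd.clm_comp contDiffAt_const).add (hB.clm_apply h2))

/-- The frame with `B = 0` is the plain pullback, and the gauge by the closed form `vecD1 θ` does
not alter its tensor. -/
theorem courantTensor_gaugedFrame {G : F → R →L[ℝ] F × (F →L[ℝ] ℝ)}
    {θ : F × K → (F × K →L[ℝ] ℝ)} {z : F × K} (hG : ContDiffAt ℝ ∞ G z.1)
    (hθ : ContDiffAt ℝ ∞ θ z) (hT : ∀ a b c, courantTensor G z.1 a b c = 0) (a b c : R × K) :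
    courantTensor (fun y => gaugedFrame (G y.1) (vecD1 θ y)) z a b c = 0 := by
  have hB : ContDiffAt ℝ ∞ (vecD1 θ) z := contDiffAt_vecD1 hθ (by simp)
  have h0 : ContDiffAt ℝ ∞ (fun y : F × K => gaugedFrame (G y.1)
      (0 : F × K →L[ℝ] (F × K →L[ℝ] ℝ))) z := contDiffAt_gaugedFrame hG contDiffAt_const
  have h1 := contDiffAt_gaugedFrame hG hB
  rw [courantTensor_gauge (G := fun y : F × K => gaugedFrame (G y.1)
      (0 : F × K →L[ℝ] (F × K →L[ℝ] ℝ))) (B := vecD1 θ) (h0.differentiableAt (by simp))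
    (h1.differentiableAt (by simp)) (hB.differentiableAt (by simp)) (.of_forall fun y c => ?_)
    (fun v w => ?_) (fderiv_vecD1_cyclic (hθ.of_le ENat.LEInfty.out)),
    courantTensor_pullback (hG.differentiableAt (by simp)) (h0.differentiableAt (by simp))
      (.of_forall fun y c => ?_), hT]
  · rw [gaugedFrame_apply]
    simp
  · rw [gaugedFrame_apply, gaugedFrame_apply]
    simp
  · rw [vecD1_apply, vecD1_apply]
    ring

end Frames

/-! ### The gauge form and the gauged Dirac structure in coordinates. -/

section Splitting

open DiracStructure

variable {E : Type u} [NormedAddCommGroup E] [NormedSpace ℝ E] [FiniteDimensional ℝ E]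
  {H : Type v} [TopologicalSpace H] {I : ModelWithCorners ℝ E H} [I.Boundaryless]
  {M : Type w} [TopologicalSpace M] [ChartedSpace H M] [IsManifold I ∞ M]
  {L : DiracStructure I M} {k : ℕ} {x₀ : M} [L.CharDualBundle k]

/-- The frame `g` has the vectors of the frame of the family `f`, and its left inverses vanish on
the complement `V`. -/
structure IsAdaptedFrame (V : Π x : M, Submodule ℝ (TangentSpace I x))
    (f g : CharFrame L k x₀) : Prop where
  Y_eq : g.Y = f.Y
  subset : g.U ⊆ f.U
  vanish : ∀ x ∈ g.U, ∀ v ∈ V x, g.Φ x (toModel I x₀ x v) = 0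

/-- The local primitive of the gauge form. -/
def CharFrame.primitive (g : CharFrame L k x₀) (z : E × EuclideanSpace ℝ (Fin k)) :
    E × EuclideanSpace ℝ (Fin k) →L[ℝ] ℝ :=
  (((dualModel k).symm z.2).comp (g.Φ ((extChartAt I x₀).symm z.1))).comp
    (ContinuousLinearMap.fst ℝ E (EuclideanSpace ℝ (Fin k)))

theorem CharFrame.primitive_apply (g : CharFrame L k x₀) (z v : E × EuclideanSpace ℝ (Fin k)) :
    g.primitive z v = (dualModel k).symm z.2 (g.Φ ((extChartAt I x₀).symm z.1) v.1) := rfl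

theorem CharFrame.contDiffAt_primitive (g : CharFrame L k x₀)
    {z : E × EuclideanSpace ℝ (Fin k)} (hz : z.1 = extChartAt I x₀ x₀) :
    ContDiffAt ℝ ∞ g.primitive z := by
  have h1 : ContDiffAt ℝ ∞ (fun u => g.Φ ((extChartAt I x₀).symm u)) z.1 := by
    rw [hz]
    exact contDiffAt_comp_extChartAt_symm (g.smooth_Φ.contMDiffAt (g.isOpen.mem_nhds g.mem))
  have h2 : ContDiffAt ℝ ∞ (fun z : E × EuclideanSpace ℝ (Fin k) => (dualModel k).symm z.2) z :=
    (dualModel k).symm.contDiff.contDiffAt.comp z contDiffAt_snd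
  exact (h2.clm_comp (h1.comp z contDiffAt_fst)).clm_comp contDiffAt_const

variable {V : Π x : M, Submodule ℝ (TangentSpace I x)} (hV : L.IsSmoothComplement V)
  {f : ∀ x₀, CharFrame L k x₀}

/-- Since `g.Φ` vanishes on `V` and inverts the frame, it gives the frame coordinates of the
projection onto `L ∩ TM` along `V`. The frames `f x₀` and `g` share `Y`, so these coordinates match
those of the bundle trivialization. -/
theorem splittingMap_apply (hf : IsFrameFamily f) {g : CharFrame L k x₀} (hg : IsAdaptedFrame V (f x₀) g)
    (p : L.CharDualTotal k) (hp : p.1 ∈ g.U) (v : TangentSpace I p.1) :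
    (splittingMap k hV p).2 v =
      (dualModel k).symm ((trivializationAt (EuclideanSpace ℝ (Fin k)) L.CharDual x₀ p).2)
        (g.Φ p.1 (toModel I x₀ p.1 v)) := by
  obtain ⟨x, e⟩ := p
  rw [(hf x₀).2 x e, CharFrame.dualCoord_apply, ContinuousLinearEquiv.symm_apply_apply]
  obtain ⟨y, z, hy, hz, hyz⟩ := Submodule.codisjoint_iff_exists_add_eq.1
    (hV.isCompl x).codisjoint v
  obtain ⟨c, hc⟩ := (g.mem_iff x hp y).1 hy
  have h1 : (splittingMap k hV ⟨x, e⟩).2 v =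
    e ((L.char x).projectionOnto (V x) (hV.isCompl x) v) := rfl
  have h2 : (L.char x).projectionOnto (V x) (hV.isCompl x) v = ⟨y, hy⟩ := by
    rw [← hyz, map_add]
    have e1 := Submodule.projectionOnto_apply_left (hV.isCompl x) ⟨y, hy⟩
    have e2 := Submodule.projectionOnto_apply_right (hV.isCompl x) ⟨z, hz⟩
    rw [show (L.char x).projectionOnto (V x) (hV.isCompl x) y = ⟨y, hy⟩ from e1,
      show (L.char x).projectionOnto (V x) (hV.isCompl x) z = 0 from e2, add_zero]
  have h3 : g.Φ x (toModel I x₀ x v) = c := by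
    rw [← hyz]
    have e1 : g.Φ x (toModel I x₀ x (y + z)) =
        g.Φ x (toModel I x₀ x y) + g.Φ x (toModel I x₀ x z) := by
      rw [map_add, map_add]
    rw [e1, hg.vanish x hp z hz, add_zero, ← hc, g.leftInv x hp]
  have h4 : (f x₀).toChar x c = ⟨y, hy⟩ := by
    refine Subtype.ext ?_
    rw [(f x₀).coe_toChar (hg.subset hp), ← hg.Y_eq, hc]
    exact ofModel_toModel (g.subset hp) y
  rw [h1, h2, ← h4]
  exact congrArg (fun c => e ((f x₀).toChar x c)) h3.symm

theorem covectorToModel_splittingMap (hf : IsFrameFamily f) {g : CharFrame L k x₀} (hg : IsAdaptedFrame V (f x₀) g)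
    (p : L.CharDualTotal k) (hp : p.1 ∈ g.U) :
    covectorToModel I x₀ p.1 (splittingMap k hV p).2 =
      ((dualModel k).symm ((trivializationAt (EuclideanSpace ℝ (Fin k)) L.CharDual x₀ p).2)).comp
        (g.Φ p.1) := by
  refine ContinuousLinearMap.ext fun v => ?_
  refine (splittingMap_apply hV hf hg p hp (ofModel I x₀ p.1 v)).trans ?_
  rw [toModel_ofModel (g.subset hp)]
  rfl

theorem exists_isAdaptedFrame (hV : L.IsSmoothComplement V) (f : CharFrame L k x₀) :
    ∃ g : CharFrame L k x₀, IsAdaptedFrame V f g :=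
  let ⟨g, h1, h2, h3⟩ := hV.exists_charFrame f
  ⟨g, h1, h2, h3⟩

theorem contMDiff_splittingMap (hf : IsFrameFamily f) :
    ContMDiff (I.prod 𝓘(ℝ, EuclideanSpace ℝ (Fin k))) (I.prod 𝓘(ℝ, E →L[ℝ] ℝ)) ∞
      (splittingMap k hV) := by
  intro p
  obtain ⟨g, hg⟩ := exists_isAdaptedFrame hV (f p.1)
  have h1 : ContMDiffAt (I.prod 𝓘(ℝ, EuclideanSpace ℝ (Fin k))) I ∞
    (fun q : L.CharDualTotal k => q.1) p := contMDiffAt_proj _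
  refine contMDiffAt_totalSpace.2 ⟨h1, ?_⟩
  have h2 := ((contMDiffAt_totalSpace (IM := I.prod 𝓘(ℝ, EuclideanSpace ℝ (Fin k))) (IB := I)
    (n := ∞) (f := fun q : L.CharDualTotal k => q) (x₀ := p)).1 contMDiffAt_id).2
  have h3 := ((dualModel k).symm.contDiff (n := ∞) |>.contMDiff.contMDiffAt.comp p h2).clm_comp
    ((g.smooth_Φ.contMDiffAt (g.isOpen.mem_nhds g.mem)).comp p h1)
  refine h3.congr_of_eventuallyEq ?_
  filter_upwards [h1.continuousAt.eventually (g.isOpen.mem_nhds g.mem)] with q hq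
  exact (trivializationAt_cotangent (g.subset hq) _).trans (covectorToModel_splittingMap hV hf hg q hq)

/-- The gauge form on `(L ∩ TM)^*`. -/
def gaugeForm (p : L.CharDualTotal k) :
    TangentSpace (I.prod 𝓘(ℝ, EuclideanSpace ℝ (Fin k))) p →ₗ[ℝ]
      Cotangent (I.prod 𝓘(ℝ, EuclideanSpace ℝ (Fin k))) p :=
  pullbackTensor
    (mfderiv (I.prod 𝓘(ℝ, EuclideanSpace ℝ (Fin k))) (I.prod 𝓘(ℝ, E →L[ℝ] ℝ))
      (splittingMap k hV) p)
    (canonicalSymplecticForm I (splittingMap k hV p))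

/-- The splitting map covers the identity of `M`; this is what is needed to pull back `p ∘ dπ`. -/
theorem mfderiv_proj_splittingMap (hf : IsFrameFamily f) (p : L.CharDualTotal k)
    (X : TangentSpace (I.prod 𝓘(ℝ, EuclideanSpace ℝ (Fin k))) p) :
    (mfderiv (I.prod 𝓘(ℝ, E →L[ℝ] ℝ)) I (TotalSpace.proj : CotangentBundle I M → M)
      (splittingMap k hV p)
      (mfderiv (I.prod 𝓘(ℝ, EuclideanSpace ℝ (Fin k))) (I.prod 𝓘(ℝ, E →L[ℝ] ℝ))
        (splittingMap k hV) p X) : E) =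
    (mfderiv (I.prod 𝓘(ℝ, EuclideanSpace ℝ (Fin k))) I
      (TotalSpace.proj : L.CharDualTotal k → M) p X : E) := by
  have h1 : MDifferentiableAt (I.prod 𝓘(ℝ, E →L[ℝ] ℝ)) I
      (TotalSpace.proj : CotangentBundle I M → M) (splittingMap k hV p) :=
    (contMDiffAt_proj _ (n := ∞)).mdifferentiableAt (by simp)
  have h2 := mfderiv_comp p h1 ((contMDiff_splittingMap hV hf p).mdifferentiableAt (by simp))
  exact (congrArg (fun A : E × EuclideanSpace ℝ (Fin k) →L[ℝ] E => A X) h2).symm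

/-- The exterior derivative commutes with pullback, so `i_V^*ω` is the differential of `i_V^*θ`,
with `θ` the canonical 1-form. In the chart, `i_V^*θ` is `g.primitive`. -/
theorem eventually_gaugeForm (hf : IsFrameFamily f) (p₀ : L.CharDualTotal k) {g : CharFrame L k p₀.1}
    (hg : IsAdaptedFrame V (f p₀.1) g) :
    ∀ᶠ z in 𝓝 (extChartAt (I.prod 𝓘(ℝ, EuclideanSpace ℝ (Fin k))) p₀ p₀),
      ∀ v w : E × EuclideanSpace ℝ (Fin k),
      gaugeForm hV ((extChartAt (I.prod 𝓘(ℝ, EuclideanSpace ℝ (Fin k))) p₀).symm z)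
        (ofModel (I.prod 𝓘(ℝ, EuclideanSpace ℝ (Fin k))) p₀
          ((extChartAt (I.prod 𝓘(ℝ, EuclideanSpace ℝ (Fin k))) p₀).symm z) v)
        (ofModel (I.prod 𝓘(ℝ, EuclideanSpace ℝ (Fin k))) p₀
          ((extChartAt (I.prod 𝓘(ℝ, EuclideanSpace ℝ (Fin k))) p₀).symm z) w) =
        vecD1 g.primitive z v w := by
  let IN := I.prod 𝓘(ℝ, EuclideanSpace ℝ (Fin k))
  let ψ := (extChartAt IN p₀).symm
  let Q : E × EuclideanSpace ℝ (Fin k) → Prop := fun y => y ∈ (extChartAt IN p₀).target ∧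
    (ψ y ∈ (chartAt (ModelProd H (EuclideanSpace ℝ (Fin k))) p₀).source ∧
      extChartAt IN p₀ (ψ y) = y) ∧ (ψ y).1 ∈ g.U
  have hQ : ∀ᶠ y in 𝓝 (extChartAt IN p₀ p₀), Q y := by
    have h1 : {p : L.CharDualTotal k | p.1 ∈ g.U} ∈ 𝓝 p₀ :=
      (FiberBundle.continuous_proj (EuclideanSpace ℝ (Fin k)) L.CharDual).continuousAt
        (g.isOpen.mem_nhds g.mem)
    filter_upwards [extChartAt_target_mem_nhds (I := IN) p₀,
      eventually_extChartAt_symm_mem_source (I := IN) p₀,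
      eventually_extChartAt_symm_mem (I := IN) h1] with y h1 h2 h3
    exact ⟨h1, h2, h3⟩
  have hψ : ∀ y, Q y → ContMDiffAt 𝓘(ℝ, E × EuclideanSpace ℝ (Fin k)) IN ∞ ψ y := fun y hy =>
    (contMDiffOn_extChartAt_symm p₀).contMDiffAt ((isOpen_extChartAt_target p₀).mem_nhds hy.1)
  have hs := contMDiff_splittingMap hV hf
  have hd : ∀ y, Q y → ∀ v : E × EuclideanSpace ℝ (Fin k),
      (mfderiv 𝓘(ℝ, E × EuclideanSpace ℝ (Fin k)) (I.prod 𝓘(ℝ, E →L[ℝ] ℝ))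
        (splittingMap k hV ∘ ψ) y v : E × (E →L[ℝ] ℝ)) =
      mfderiv IN (I.prod 𝓘(ℝ, E →L[ℝ] ℝ)) (splittingMap k hV) (ψ y) (ofModel IN p₀ (ψ y) v) := by
    intro y hy v
    have h1 := ofModel_eq_mfderiv (I := IN) hy.2.1.1
    rw [hy.2.1.2] at h1
    rw [h1]
    have h2 := mfderiv_comp y ((hs (ψ y)).mdifferentiableAt (by simp))
      ((hψ y hy).mdifferentiableAt (by simp))
    exact congrArg (fun A : E × EuclideanSpace ℝ (Fin k) →L[ℝ] E × (E →L[ℝ] ℝ) => A v) h2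
  -- At `y` the pulled-back canonical form is the covector `i_V(p)` composed with the projection to
  -- the base, which `splittingMap_apply` expresses through `Φ`.
  have hform : ∀ y, Q y → (canonicalOneForm I ((splittingMap k hV ∘ ψ) y)).comp
      (mfderiv 𝓘(ℝ, E × EuclideanSpace ℝ (Fin k)) (I.prod 𝓘(ℝ, E →L[ℝ] ℝ))
        (splittingMap k hV ∘ ψ) y) = (g.primitive y : E × EuclideanSpace ℝ (Fin k) →L[ℝ] ℝ) := by
    intro y hy
    refine ContinuousLinearMap.ext fun v => ?_
    have h1 := mem_chart_source_totalSpace.1 hy.2.1.1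
    have h2 := (extChartAt_totalSpace (I := I) h1.1).symm.trans hy.2.1.2
    have h3 : (extChartAt I p₀.1).symm y.1 = (ψ y).1 := by
      rw [← congrArg Prod.fst h2]
      exact (extChartAt I p₀.1).left_inv (by simpa using h1.2)
    have e1 := (mfderiv_proj_splittingMap hV hf (ψ y) (ofModel IN p₀ (ψ y) v)).trans
      (mfderiv_proj_ofModel hy.2.1.1 v)
    have e2 : (splittingMap k hV (ψ y)).2
        (mfderiv (I.prod 𝓘(ℝ, E →L[ℝ] ℝ)) I (TotalSpace.proj : CotangentBundle I M → M)
          (splittingMap k hV (ψ y))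
          (mfderiv IN (I.prod 𝓘(ℝ, E →L[ℝ] ℝ)) (splittingMap k hV) (ψ y)
            (ofModel IN p₀ (ψ y) v))) =
        (splittingMap k hV (ψ y)).2 (ofModel I p₀.1 (ψ y).1 v.1) :=
      congrArg (fun w : E => ((splittingMap k hV (ψ y)).2 : E →L[ℝ] ℝ) w) e1
    have e3 := splittingMap_apply hV hf hg (ψ y) hy.2.2 (ofModel I p₀.1 (ψ y).1 v.1)
    rw [toModel_ofModel h1.2, congrArg Prod.snd h2] at e3
    have e5 : g.primitive y v = (dualModel k).symm y.2 (g.Φ (ψ y).1 v.1) :=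
      (CharFrame.primitive_apply g y v).trans (by rw [h3])
    have e4 : canonicalOneForm I ((splittingMap k hV ∘ ψ) y)
        (mfderiv 𝓘(ℝ, E × EuclideanSpace ℝ (Fin k)) (I.prod 𝓘(ℝ, E →L[ℝ] ℝ))
          (splittingMap k hV ∘ ψ) y v) = canonicalOneForm I (splittingMap k hV (ψ y))
        (mfderiv IN (I.prod 𝓘(ℝ, E →L[ℝ] ℝ)) (splittingMap k hV) (ψ y)
            (ofModel IN p₀ (ψ y) v)) :=
      congrArg (fun w : E × (E →L[ℝ] ℝ) => (canonicalOneForm I (splittingMap k hV (ψ y)) :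
        E × (E →L[ℝ] ℝ) →L[ℝ] ℝ) w) (hd y hy v)
    exact e4.trans (e2.trans (e3.trans e5.symm))
  -- The 1-forms must agree around `z`, and not only at `z`, for their exterior derivatives at `z`
  -- to agree.
  filter_upwards [eventually_eventually_nhds.2 hQ] with z hz v w
  have hz' := hz.self_of_nhds
  have h1 := d1_comp (I := I.prod 𝓘(ℝ, E →L[ℝ] ℝ)) (f := splittingMap k hV ∘ ψ) (z := z)
    (((hs (ψ z)).comp z (hψ z hz')).of_le ENat.LEInfty.out)
    (differentiableAt_canonicalOneForm _) v w
  have h2 : vecD1 (fun y => ((canonicalOneForm I ((splittingMap k hV ∘ ψ) y)).comp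
      (mfderiv 𝓘(ℝ, E × EuclideanSpace ℝ (Fin k)) (I.prod 𝓘(ℝ, E →L[ℝ] ℝ))
        (splittingMap k hV ∘ ψ) y) : E × EuclideanSpace ℝ (Fin k) →L[ℝ] ℝ)) z =
      vecD1 g.primitive z := by
    rw [vecD1, vecD1, Filter.EventuallyEq.fderiv_eq (hz.mono hform)]
  rw [← h2]
  refine Eq.trans ?_ h1
  have h3 : ∀ X Y X' Y' : E × (E →L[ℝ] ℝ), X = X' → Y = Y' →
      (canonicalSymplecticForm I (splittingMap k hV (ψ z)) :
        E × (E →L[ℝ] ℝ) →ₗ[ℝ] (E × (E →L[ℝ] ℝ) →L[ℝ] ℝ)) X' Y' =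
      (canonicalSymplecticForm I (splittingMap k hV (ψ z)) :
        E × (E →L[ℝ] ℝ) →ₗ[ℝ] (E × (E →L[ℝ] ℝ) →L[ℝ] ℝ)) X Y := by
    rintro X Y _ _ rfl rfl
    rfl
  exact h3 _ _ _ _ (hd z hz' v) (hd z hz' w)

theorem mem_gaugedDirac_iff (p : L.CharDualTotal k)
    (q : TangentSpace (I.prod 𝓘(ℝ, EuclideanSpace ℝ (Fin k))) p ×
      Cotangent (I.prod 𝓘(ℝ, EuclideanSpace ℝ (Fin k))) p) :
    q ∈ gaugedDirac k hV p ↔ ∃ ζ : Cotangent I p.1,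
      (mfderiv (I.prod 𝓘(ℝ, EuclideanSpace ℝ (Fin k))) I
        (TotalSpace.proj : L.CharDualTotal k → M) p q.1, ζ) ∈ L.fiber p.1 ∧
      q.2 = ζ.comp (mfderiv (I.prod 𝓘(ℝ, EuclideanSpace ℝ (Fin k))) I
        (TotalSpace.proj : L.CharDualTotal k → M) p) + gaugeForm hV p q.1 := by
  constructor
  · rintro ⟨⟨X, η⟩, ⟨ζ, h1, h2⟩, rfl⟩
    exact ⟨ζ, h1, congrArg (· + gaugeForm hV p X) h2⟩
  · rintro ⟨ζ, h1, h2⟩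
    exact ⟨(q.1, ζ.comp (mfderiv (I.prod 𝓘(ℝ, EuclideanSpace ℝ (Fin k))) I
        (TotalSpace.proj : L.CharDualTotal k → M) p)), ⟨ζ, h1, rfl⟩, Prod.ext rfl h2.symm⟩

theorem eventually_mem_gaugedDirac (hf : IsFrameFamily f) (p₀ : L.CharDualTotal k)
    {g : CharFrame L k p₀.1} (hg : IsAdaptedFrame V (f p₀.1) g)
    {R : Type*} [NormedAddCommGroup R] [NormedSpace ℝ R] [FiniteDimensional ℝ R]
    {U : Set M} (hU : IsOpen U) (hx₀ : p₀.1 ∈ U) {G : M → R →L[ℝ] E × (E →L[ℝ] ℝ)}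
    (hGL : ∀ x ∈ U, ∀ p, p ∈ L.fiber x ↔ ∃ c, G x c = pairToModel I p₀.1 x p) :
    ∀ᶠ z in 𝓝 (extChartAt (I.prod 𝓘(ℝ, EuclideanSpace ℝ (Fin k))) p₀ p₀),
      ∀ q, q ∈ gaugedDirac k hV
        ((extChartAt (I.prod 𝓘(ℝ, EuclideanSpace ℝ (Fin k))) p₀).symm z) ↔
      ∃ c, gaugedFrame (G ((extChartAt I p₀.1).symm z.1)) (vecD1 g.primitive z) c =
        pairToModel (I.prod 𝓘(ℝ, EuclideanSpace ℝ (Fin k))) p₀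
          ((extChartAt (I.prod 𝓘(ℝ, EuclideanSpace ℝ (Fin k))) p₀).symm z) q := by
  have h0 : {p : L.CharDualTotal k | p.1 ∈ U} ∈ 𝓝 p₀ :=
    (FiberBundle.continuous_proj (EuclideanSpace ℝ (Fin k)) L.CharDual).continuousAt
      (hU.mem_nhds hx₀)
  filter_upwards [eventually_gaugeForm hV hf p₀ hg, eventually_extChartAt_symm_mem
    (I := I.prod 𝓘(ℝ, EuclideanSpace ℝ (Fin k))) h0, eventually_extChartAt_symm_mem_source
    (I := I.prod 𝓘(ℝ, EuclideanSpace ℝ (Fin k))) p₀] with z hB hzU hz q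
  have h1 := mem_chart_source_totalSpace.1 hz.1
  have h2 := (extChartAt_totalSpace (I := I) h1.1).symm.trans hz.2
  have hx : (extChartAt I p₀.1).symm z.1 =
      ((extChartAt (I.prod 𝓘(ℝ, EuclideanSpace ℝ (Fin k))) p₀).symm z).1 := by
    rw [← congrArg Prod.fst h2]
    exact (extChartAt I p₀.1).left_inv (by simpa using h1.2)
  rw [hx]
  generalize ((extChartAt (I.prod 𝓘(ℝ, EuclideanSpace ℝ (Fin k))) p₀).symm z) = p at *
  -- An element of the gauged space is determined by a base element, with coordinates `c`, and the
  -- fibre component of `X`. These two are its coordinates in the gauged frame.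
  have key : ∀ (X : TangentSpace (I.prod 𝓘(ℝ, EuclideanSpace ℝ (Fin k))) p)
      (ζ : Cotangent I p.1) (c : R), G p.1 c = pairToModel I p₀.1 p.1
        (mfderiv (I.prod 𝓘(ℝ, EuclideanSpace ℝ (Fin k))) I
          (TotalSpace.proj : L.CharDualTotal k → M) p X, ζ) →
      gaugedFrame (G p.1) (vecD1 g.primitive z)
        (c, (toModel (I.prod 𝓘(ℝ, EuclideanSpace ℝ (Fin k))) p₀ p X).2) =
      pairToModel (I.prod 𝓘(ℝ, EuclideanSpace ℝ (Fin k))) p₀ p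
        (X, ζ.comp (mfderiv (I.prod 𝓘(ℝ, EuclideanSpace ℝ (Fin k))) I
          (TotalSpace.proj : L.CharDualTotal k → M) p) + gaugeForm hV p X) := by
    intro X ζ c hc
    have e1 : ((G p.1 c).1, (toModel (I.prod 𝓘(ℝ, EuclideanSpace ℝ (Fin k))) p₀ p X).2) =
        toModel (I.prod 𝓘(ℝ, EuclideanSpace ℝ (Fin k))) p₀ p X :=
      Prod.ext ((congrArg Prod.fst hc).trans (toModel_mfderiv_proj hz.1 X)) rfl
    rw [gaugedFrame_apply]
    simp only [e1]
    refine Prod.ext rfl (ContinuousLinearMap.ext fun v => ?_)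
    have e2 := hB (toModel (I.prod 𝓘(ℝ, EuclideanSpace ℝ (Fin k))) p₀ p X) v
    rw [ofModel_toModel hz.1] at e2
    have e3 : (G p.1 c).2 v.1 = ζ (ofModel I p₀.1 p.1 v.1) :=
      congrArg (fun η : E × (E →L[ℝ] ℝ) => η.2 v.1) hc
    have e4 := congrArg (ζ : E →L[ℝ] ℝ) (mfderiv_proj_ofModel (I := I) hz.1 v)
    exact congrArg₂ (· + ·) (e3.trans e4.symm) e2.symm
  rw [mem_gaugedDirac_iff]
  constructor
  · rintro ⟨ζ, hζ, hq⟩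
    obtain ⟨c, hc⟩ := (hGL _ hzU _).1 hζ
    refine ⟨_, (key q.1 ζ c hc).trans ?_⟩
    rw [← hq]
  · rintro ⟨⟨c, w⟩, hc⟩
    let ζ : TangentSpace I p.1 →L[ℝ] ℝ := (G p.1 c).2.comp (toModel I p₀.1 p.1)
    have e0 : ((G p.1 c).1, w) = toModel (I.prod 𝓘(ℝ, EuclideanSpace ℝ (Fin k))) p₀ p q.1 :=
      congrArg Prod.fst hc
    have e1 : G p.1 c = pairToModel I p₀.1 p.1
        (mfderiv (I.prod 𝓘(ℝ, EuclideanSpace ℝ (Fin k))) I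
          (TotalSpace.proj : L.CharDualTotal k → M) p q.1, ζ) := by
      refine Prod.ext ?_ (covectorToModel_comp_toModel h1.2 _).symm
      exact (congrArg Prod.fst e0).trans (toModel_mfderiv_proj hz.1 q.1).symm
    refine ⟨ζ, (hGL _ hzU _).2 ⟨c, e1⟩, ?_⟩
    have e2 := key q.1 ζ c e1
    rw [← congrArg Prod.snd e0] at e2
    exact congrArg Prod.snd (pairToModel_injective hz.1 (hc.symm.trans e2))

end Splitting

/-! ### From a transversal Courant frame to a Poisson structure. -/

section Family

variable {F : Type u} [NormedAddCommGroup F] [NormedSpace ℝ F] [FiniteDimensional ℝ F]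
  {H : Type v} [TopologicalSpace H] {I : ModelWithCorners ℝ F H} [I.Boundaryless]
  {N : Type w} [TopologicalSpace N] [ChartedSpace H N] [IsManifold I ∞ N]
  {R : Type*} [NormedAddCommGroup R] [NormedSpace ℝ R] [FiniteDimensional ℝ R]

theorem eventually_of_eventually_chart {p₀ : N} {Q : N → Prop}
    (h : ∀ᶠ z in 𝓝 (extChartAt I p₀ p₀), Q ((extChartAt I p₀).symm z)) : ∀ᶠ p in 𝓝 p₀, Q p := by
  filter_upwards [(continuousAt_extChartAt (I := I) p₀).eventually h,
    chart_source_mem_nhds H p₀] with p h1 h2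
  rwa [(extChartAt I p₀).left_inv (by simpa using h2)] at h1

/-- The map `G`, defined near the image of `p₀` in the chart at `p₀`, is a smooth frame of the
family of subspaces `D` of `TN ⊕ T^*N`, and its Courant tensor vanishes at the image of `p₀`. -/
structure IsCourantFrameAt (D : Π p : N, Submodule ℝ (TangentSpace I p × Cotangent I p)) (p₀ : N)
    (G : F → R →L[ℝ] F × (F →L[ℝ] ℝ)) : Prop where
  contDiffAt : ContDiffAt ℝ ∞ G (extChartAt I p₀ p₀)
  injective : Function.Injective (G (extChartAt I p₀ p₀))
  mem_iff : ∀ᶠ z in 𝓝 (extChartAt I p₀ p₀), ∀ q, q ∈ D ((extChartAt I p₀).symm z) ↔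
    ∃ c, G z c = pairToModel I p₀ ((extChartAt I p₀).symm z) q
  courantTensor_eq_zero : ∀ a b c, courantTensor G (extChartAt I p₀ p₀) a b c = 0

variable {D : Π p : N, Submodule ℝ (TangentSpace I p × Cotangent I p)}

namespace IsCourantFrameAt

variable {p₀ : N} {G : F → R →L[ℝ] F × (F →L[ℝ] ℝ)}

theorem mem_iff_self (hG : IsCourantFrameAt D p₀ G) (q : TangentSpace I p₀ × Cotangent I p₀) :
    q ∈ D p₀ ↔ ∃ c, G (extChartAt I p₀ p₀) c = pairToModel I p₀ p₀ q := by
  have h := hG.mem_iff.self_of_nhds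
  rw [extChartAt_to_inv] at h
  exact h q

/-- Transversality makes the covector component of the frame injective, and the dimensions of the
source and of the cotangent space agree. -/
theorem isInvertible_snd (hG : IsCourantFrameAt D p₀ G)
    (hR : Module.finrank ℝ R = Module.finrank ℝ F)
    (hp : ∀ X : TangentSpace I p₀, (X, (0 : Cotangent I p₀)) ∈ D p₀ → X = 0) :
    ((ContinuousLinearMap.snd ℝ F (F →L[ℝ] ℝ)).comp (G (extChartAt I p₀ p₀))).IsInvertible := by
  have hinj : Function.Injective
      ((ContinuousLinearMap.snd ℝ F (F →L[ℝ] ℝ)).comp (G (extChartAt I p₀ p₀)) :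
        R →ₗ[ℝ] (F →L[ℝ] ℝ)) := by
    rw [injective_iff_map_eq_zero]
    intro c hc
    have hc' : (G (extChartAt I p₀ p₀) c).2 = 0 := hc
    have h1 : G (extChartAt I p₀ p₀) c = pairToModel I p₀ p₀
        (ofModel I p₀ p₀ (G (extChartAt I p₀ p₀) c).1, 0) :=
      Prod.ext (toModel_ofModel (mem_chart_source H p₀) _).symm hc'
    have h2 := hp _ ((hG.mem_iff_self _).2 ⟨c, h1⟩)
    rw [h2] at h1
    exact hG.injective ((h1.trans (map_zero (pairToModel I p₀ p₀))).trans (map_zero _).symm)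
  refine isInvertible_of_bijective ⟨hinj, ?_⟩
  refine (LinearMap.injective_iff_surjective_of_finrank_eq_finrank ?_).1 hinj
  rw [hR, ← (LinearMap.toContinuousLinearMap : (F →ₗ[ℝ] ℝ) ≃ₗ[ℝ] _).finrank_eq]
  exact Subspace.dual_finrank_eq.symm

theorem eventually_isInvertible_snd (hG : IsCourantFrameAt D p₀ G)
    (hR : Module.finrank ℝ R = Module.finrank ℝ F)
    (hp : ∀ X : TangentSpace I p₀, (X, (0 : Cotangent I p₀)) ∈ D p₀ → X = 0) :
    ∀ᶠ z in 𝓝 (extChartAt I p₀ p₀),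
      ((ContinuousLinearMap.snd ℝ F (F →L[ℝ] ℝ)).comp (G z)).IsInvertible := by
  have h1 : ContinuousAt (fun z => (ContinuousLinearMap.snd ℝ F (F →L[ℝ] ℝ)).comp (G z))
      (extChartAt I p₀ p₀) := continuousAt_const.clm_comp hG.contDiffAt.continuousAt
  exact h1.eventually (isOpen_isInvertible.mem_nhds (hG.isInvertible_snd hR hp))

end IsCourantFrameAt

/-- Transversality at `p₀` makes the covector component invertible there, and invertibility persists
nearby. -/
theorem isOpen_transversal {G : N → F → R →L[ℝ] F × (F →L[ℝ] ℝ)}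
    (hG : ∀ p₀, IsCourantFrameAt D p₀ (G p₀))
    (hR : Module.finrank ℝ R = Module.finrank ℝ F) :
    IsOpen {p : N | ∀ X : TangentSpace I p, (X, (0 : Cotangent I p)) ∈ D p → X = 0} := by
  rw [isOpen_iff_mem_nhds]
  intro p₀ hp₀
  refine eventually_of_eventually_chart (I := I) ?_
  filter_upwards [(hG p₀).eventually_isInvertible_snd hR hp₀, (hG p₀).mem_iff,
    eventually_extChartAt_symm_mem_source (I := I) p₀] with z h1 h2 h3 X hX
  obtain ⟨c, hc⟩ := (h2 _).1 hX
  have h4 : ((ContinuousLinearMap.snd ℝ F (F →L[ℝ] ℝ)).comp (G p₀ z)) c = 0 := congrArg Prod.snd hc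
  have h5 : c = 0 := h1.injective (h4.trans (map_zero _).symm)
  rw [h5, map_zero] at hc
  exact congrArg Prod.fst (pairToModel_injective h3.1
    (hc.symm.trans (map_zero (pairToModel I p₀ ((extChartAt I p₀).symm z))).symm))

theorem covectorToModel_d0 {p₀ : N} {z : F} (hz : z ∈ (extChartAt I p₀).target) {f : N → ℝ}
    (hf : MDifferentiableAt I 𝓘(ℝ, ℝ) f ((extChartAt I p₀).symm z)) :
    covectorToModel I p₀ ((extChartAt I p₀).symm z) (d0 I f ((extChartAt I p₀).symm z)) =
      fderiv ℝ (fun y => f ((extChartAt I p₀).symm y)) z := by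
  have hs : (extChartAt I p₀).symm z ∈ (chartAt H p₀).source := by
    simpa using (extChartAt I p₀).map_target hz
  have h1 := ofModel_eq_mfderiv (I := I) hs
  rw [(extChartAt I p₀).right_inv hz] at h1
  have h2 : MDifferentiableAt 𝓘(ℝ, F) I (extChartAt I p₀).symm z :=
    ((contMDiffOn_extChartAt_symm (I := I) (n := ∞) p₀).contMDiffAt
      ((isOpen_extChartAt_target p₀).mem_nhds hz)).mdifferentiableAt (by simp)
  rw [covectorToModel, h1, ← mfderiv_eq_fderiv]
  exact (mfderiv_comp z hf h2).symm

theorem bracketOf_chart {p₀ : N} {z : F} (hz : z ∈ (extChartAt I p₀).target) {f g : N → ℝ}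
    (s : Π p : N, Cotangent I p →L[ℝ] TangentSpace I p)
    (hf : MDifferentiableAt I 𝓘(ℝ, ℝ) f ((extChartAt I p₀).symm z))
    (hg : MDifferentiableAt I 𝓘(ℝ, ℝ) g ((extChartAt I p₀).symm z)) :
    bracketOf I s f g ((extChartAt I p₀).symm z) =
      fderiv ℝ (fun y => g ((extChartAt I p₀).symm y)) z
        (sharpToModel I p₀ ((extChartAt I p₀).symm z) (s ((extChartAt I p₀).symm z))
          (fderiv ℝ (fun y => f ((extChartAt I p₀).symm y)) z)) := by
  have hs : (extChartAt I p₀).symm z ∈ (chartAt H p₀).source := by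
    simpa using (extChartAt I p₀).map_target hz
  rw [← covectorToModel_d0 hz hf, ← covectorToModel_d0 hz hg, sharpToModel_apply,
    covectorToModel_toModel hs]
  rw [show ((covectorToModel I p₀ ((extChartAt I p₀).symm z)
    (d0 I f ((extChartAt I p₀).symm z))).comp (toModel I p₀ ((extChartAt I p₀).symm z)) :
      TangentSpace I ((extChartAt I p₀).symm z) →L[ℝ] ℝ) = d0 I f ((extChartAt I p₀).symm z) from
    ContinuousLinearMap.ext fun v => covectorToModel_toModel hs _ v]
  rfl

/-- An isotropic family of subspaces with frames whose Courant tensor vanishes, transversal to the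
tangent bundle, is the graph of a Poisson structure. -/
theorem exists_poissonStructure {G : N → F → R →L[ℝ] F × (F →L[ℝ] ℝ)}
    (hG : ∀ p₀, IsCourantFrameAt D p₀ (G p₀)) (hR : Module.finrank ℝ R = Module.finrank ℝ F)
    (hiso : ∀ p, ∀ a ∈ D p, ∀ b ∈ D p, (a.2 b.1 + b.2 a.1 : ℝ) = 0)
    (htr : ∀ p, ∀ X : TangentSpace I p, (X, (0 : Cotangent I p)) ∈ D p → X = 0) :
    ∃ S : PoissonStructure I N, ∀ p, S.graph p = D p := by
  -- The inverse of the covector component presents each `D p` as the graph of a map `s` from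
  -- covectors to vectors.
  have hex : ∀ p, ∃ s : Cotangent I p →L[ℝ] TangentSpace I p, ∀ q, q ∈ D p ↔ q.1 = s q.2 := by
    intro p
    have hs := mem_chart_source H p
    set A := G p (extChartAt I p p) with hA
    have hi := (hG p).isInvertible_snd hR (htr p)
    let s : (F →L[ℝ] ℝ) →L[ℝ] F := (ContinuousLinearMap.fst ℝ F (F →L[ℝ] ℝ)).comp
      (A.comp ((ContinuousLinearMap.snd ℝ F (F →L[ℝ] ℝ)).comp A).inverse)
    have hs1 : ∀ c, s (A c).2 = (A c).1 := by
      intro c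
      have h1 := congrArg (fun B => B c) hi.inverse_comp_self
      exact congrArg (fun c => (A c).1) h1
    have hs2 : ∀ ξ, ∃ c, (A c).2 = ξ := fun ξ => hi.surjective ξ
    refine ⟨((ofModel I p p).comp s).comp (ContinuousLinearMap.precomp ℝ (ofModel I p p) :
      (TangentSpace I p →L[ℝ] ℝ) →L[ℝ] (F →L[ℝ] ℝ)), fun q => ?_⟩
    have hq : (((ofModel I p p).comp s).comp (ContinuousLinearMap.precomp ℝ (ofModel I p p) :
      (TangentSpace I p →L[ℝ] ℝ) →L[ℝ] (F →L[ℝ] ℝ))) q.2 =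
      ofModel I p p (s (covectorToModel I p p q.2)) := rfl
    rw [hq, (hG p).mem_iff_self]
    constructor
    · rintro ⟨c, hc⟩
      have e2 : (A c).2 = covectorToModel I p p q.2 := congrArg Prod.snd hc
      have e1 : (A c).1 = toModel I p p q.1 := congrArg Prod.fst hc
      rw [← e2, hs1, e1, ofModel_toModel hs]
    · intro h
      obtain ⟨c, hc⟩ := hs2 (covectorToModel I p p q.2)
      refine ⟨c, Prod.ext ?_ hc⟩
      have h1 : toModel I p p q.1 = s (covectorToModel I p p q.2) := by
        rw [h]
        exact toModel_ofModel hs _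
      exact (hs1 c).symm.trans ((congrArg s hc).trans h1.symm)
  choose s hs using hex
  let P : ∀ p₀ : N, F → (F →L[ℝ] ℝ) →L[ℝ] F := fun p₀ z =>
    sharpToModel I p₀ ((extChartAt I p₀).symm z) (s ((extChartAt I p₀).symm z))
  have hgr : ∀ p₀, ∀ᶠ z in 𝓝 (extChartAt I p₀ p₀), ∀ c,
      (G p₀ z c).1 = P p₀ z (G p₀ z c).2 := by
    intro p₀
    filter_upwards [(hG p₀).mem_iff, eventually_extChartAt_symm_mem_source (I := I) p₀]
      with z h1 h2 c
    let q : TangentSpace I ((extChartAt I p₀).symm z) × Cotangent I ((extChartAt I p₀).symm z) :=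
      (ofModel I p₀ _ (G p₀ z c).1,
        ((G p₀ z c).2.comp (toModel I p₀ _) : TangentSpace I ((extChartAt I p₀).symm z) →L[ℝ] ℝ))
    have h3 : G p₀ z c = pairToModel I p₀ ((extChartAt I p₀).symm z) q :=
      Prod.ext (toModel_ofModel h2.1 _).symm (covectorToModel_comp_toModel h2.1 _).symm
    have h4 := (hs _ q).1 ((h1 q).2 ⟨c, h3⟩)
    have h5 := congrArg (toModel I p₀ ((extChartAt I p₀).symm z)) h4
    exact (toModel_ofModel h2.1 _).symm.trans h5
  -- Near the centre `P` is the vector component of the frame composed with the inverse of the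
  -- covector component, hence smooth.
  have hPs : ∀ p₀, ContDiffAt ℝ ∞ (P p₀) (extChartAt I p₀ p₀) := by
    intro p₀
    have := FiniteDimensional.complete ℝ R
    have h1 : ContDiffAt ℝ ∞ (fun z => (ContinuousLinearMap.snd ℝ F (F →L[ℝ] ℝ)).comp (G p₀ z))
        (extChartAt I p₀ p₀) := contDiffAt_const.clm_comp (hG p₀).contDiffAt
    have h2 : ContDiffAt ℝ ∞ (fun z => ((ContinuousLinearMap.snd ℝ F (F →L[ℝ] ℝ)).comp
        (G p₀ z)).inverse) (extChartAt I p₀ p₀) :=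
      ContDiffAt.comp (g := ContinuousLinearMap.inverse) (extChartAt I p₀ p₀)
        ((hG p₀).isInvertible_snd hR (htr p₀)).contDiffAt_map_inverse h1
    have h3 : ContDiffAt ℝ ∞ (fun z => (ContinuousLinearMap.fst ℝ F (F →L[ℝ] ℝ)).comp
        ((G p₀ z).comp ((ContinuousLinearMap.snd ℝ F (F →L[ℝ] ℝ)).comp (G p₀ z)).inverse))
        (extChartAt I p₀ p₀) :=
      contDiffAt_const.clm_comp ((hG p₀).contDiffAt.clm_comp h2)
    refine h3.congr_of_eventuallyEq ?_
    filter_upwards [hgr p₀, (hG p₀).eventually_isInvertible_snd hR (htr p₀)] with z h4 h5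
    refine ContinuousLinearMap.ext fun ξ => ?_
    have h6 := congrArg (fun B => B ξ) h5.self_comp_inverse
    have h7 := h4 (((ContinuousLinearMap.snd ℝ F (F →L[ℝ] ℝ)).comp (G p₀ z)).inverse ξ)
    exact (congrArg (P p₀ z) h6).symm.trans h7.symm
  have hskew : ∀ p (ξ η : Cotangent I p), (η (s p ξ) : ℝ) = - ξ (s p η) := by
    intro p ξ η
    have h1 := hiso p (s p ξ, ξ) ((hs p _).2 rfl) (s p η, η) ((hs p _).2 rfl)
    have h1' : (ξ (s p η) : ℝ) + η (s p ξ) = 0 := h1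
    linarith
  refine ⟨⟨s, hskew, fun p₀ => ?_, fun f g h hf hg hh p₀ => ?_⟩, fun p => ?_⟩
  · rw [contMDiffAt_sharp_iff]
    have h1 : ContMDiffAt I 𝓘(ℝ, (F →L[ℝ] ℝ) →L[ℝ] F) ∞ (P p₀ ∘ extChartAt I p₀) p₀ :=
      (hPs p₀).contMDiffAt.comp p₀ contMDiffAt_extChartAt
    refine h1.congr_of_eventuallyEq ?_
    filter_upwards [chart_source_mem_nhds H p₀] with p hp
    have h2 := (extChartAt I p₀).left_inv (x := p) (by simpa using hp)
    exact (congrArg (fun p => sharpToModel I p₀ p (s p)) h2).symm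
  · set z := extChartAt I p₀ p₀ with hz
    have hzt : z ∈ (extChartAt I p₀).target := mem_extChartAt_target p₀
    have hz0 : (extChartAt I p₀).symm z = p₀ := extChartAt_to_inv p₀
    have hbr : ∀ f g : N → ℝ, ContMDiff I 𝓘(ℝ, ℝ) ∞ f → ContMDiff I 𝓘(ℝ, ℝ) ∞ g →
        (fun y => bracketOf I s f g ((extChartAt I p₀).symm y)) =ᶠ[𝓝 z] fun y =>
          fderiv ℝ (fun y => g ((extChartAt I p₀).symm y)) y
            (P p₀ y (fderiv ℝ (fun y => f ((extChartAt I p₀).symm y)) y)) := by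
      intro f g hf hg
      filter_upwards [extChartAt_target_mem_nhds (I := I) p₀] with y hy
      exact bracketOf_chart hy s ((hf _).mdifferentiableAt (by simp))
        ((hg _).mdifferentiableAt (by simp))
    have hc : ∀ f : N → ℝ, ContMDiff I 𝓘(ℝ, ℝ) ∞ f →
        ContDiffAt ℝ ∞ (fun y => f ((extChartAt I p₀).symm y)) z := fun f hf =>
      contDiffAt_comp_extChartAt_symm (hf p₀)
    -- The outer bracket differentiates the inner one. Differentiability is required for its
    -- differential on `N` to be the derivative computed in the chart.
    have hbd : ∀ f g : N → ℝ, ContMDiff I 𝓘(ℝ, ℝ) ∞ f → ContMDiff I 𝓘(ℝ, ℝ) ∞ g →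
        MDifferentiableAt I 𝓘(ℝ, ℝ) (bracketOf I s f g) p₀ := by
      intro f g hf hg
      refine mdifferentiableAt_of_comp_symm (DifferentiableAt.congr_of_eventuallyEq ?_
        (hbr f g hf hg))
      have e1 : ContDiffAt ℝ ∞ (fderiv ℝ fun y => f ((extChartAt I p₀).symm y)) z :=
        (hc f hf).fderiv_right (by simp)
      have e2 : ContDiffAt ℝ ∞ (fderiv ℝ fun y => g ((extChartAt I p₀).symm y)) z :=
        (hc g hg).fderiv_right (by simp)
      exact (e2.clm_apply ((hPs p₀).clm_apply e1)).differentiableAt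
        (by simp)
    have hbb : ∀ f g h : N → ℝ, ContMDiff I 𝓘(ℝ, ℝ) ∞ f → ContMDiff I 𝓘(ℝ, ℝ) ∞ g →
        ContMDiff I 𝓘(ℝ, ℝ) ∞ h → bracketOf I s f (bracketOf I s g h) p₀ =
        fderiv ℝ (fun y => fderiv ℝ (fun y => h ((extChartAt I p₀).symm y)) y
            (P p₀ y (fderiv ℝ (fun y => g ((extChartAt I p₀).symm y)) y))) z
          (P p₀ z (fderiv ℝ (fun y => f ((extChartAt I p₀).symm y)) z)) := by
      intro f g h hf hg hh
      have e1 := bracketOf_chart (f := f) (g := bracketOf I s g h) hzt s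
        ((hf _).mdifferentiableAt (by simp)) (by rw [hz0]; exact hbd g h hg hh)
      rw [(hbr g h hg hh).fderiv_eq, hz0] at e1
      rw [e1]
      simp only [P]
      rw [hz0]
    rw [hbb f g h hf hg hh, hbb g h f hg hh hf, hbb h f g hh hf hg]
    refine jacobi_of_courantTensor_eq_zero ((hG p₀).contDiffAt.differentiableAt (by simp))
      ((hPs p₀).differentiableAt (by simp)) (hgr p₀) (fun ξ η => ?_)
      (fun ξ => ((hG p₀).isInvertible_snd hR (htr p₀)).surjective ξ)
      (hG p₀).courantTensor_eq_zero ((hc f hf).of_le ENat.LEInfty.out)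
      ((hc g hg).of_le ENat.LEInfty.out) ((hc h hh).of_le ENat.LEInfty.out)
    exact hskew ((extChartAt I p₀).symm z) (ξ.comp (toModel I p₀ _) :
      TangentSpace I ((extChartAt I p₀).symm z) →L[ℝ] ℝ) (η.comp (toModel I p₀ _) :
      TangentSpace I ((extChartAt I p₀).symm z) →L[ℝ] ℝ)
  · ext q
    rw [hs]
    constructor
    · rintro ⟨ξ, rfl⟩
      rfl
    · intro h
      exact ⟨q.2, Prod.ext h.symm rfl⟩

end Family

/-! ### Restriction to an open subset. -/

section Opens

variable {F : Type u} [NormedAddCommGroup F] [NormedSpace ℝ F] [FiniteDimensional ℝ F]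
  {H : Type v} [TopologicalSpace H] {I : ModelWithCorners ℝ F H} [I.Boundaryless]
  {N : Type w} [TopologicalSpace N] [ChartedSpace H N] [IsManifold I ∞ N]
  {R : Type*} [NormedAddCommGroup R] [NormedSpace ℝ R] [FiniteDimensional ℝ R]
  {U : Opens N}

theorem mem_chart_source_opens {p₀ p : U} :
    p ∈ (chartAt H p₀).source ↔ p.1 ∈ (chartAt H p₀.1).source := by
  change p ∈ ((chartAt H p₀.1).subtypeRestr ⟨p₀⟩).source ↔ _
  rw [OpenPartialHomeomorph.subtypeRestr_source]
  rfl

theorem extChartAt_opens (p₀ p : U) : extChartAt I p₀ p = extChartAt I p₀.1 p.1 := rfl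

theorem toModel_mfderiv_val {p₀ p : U} (hp : p ∈ (chartAt H p₀).source) (X : TangentSpace I p) :
    toModel I p₀.1 p.1 (mfderiv I I (Subtype.val : U → N) p X) = toModel I p₀ p X := by
  have h1 : MDifferentiableAt I I (Subtype.val : U → N) p :=
    (contMDiff_subtype_val (n := ∞) p).mdifferentiableAt (by simp)
  have h2 := mfderiv_comp p
    (mdifferentiableAt_extChartAt (I := I) (mem_chart_source_opens.1 hp)) h1
  rw [toModel_eq_mfderiv (mem_chart_source_opens.1 hp), toModel_eq_mfderiv hp]
  exact (congrArg (fun A : F →L[ℝ] F => A X) h2).symm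

theorem eventually_extChartAt_opens_symm (p₀ : U) : ∀ᶠ z in 𝓝 (extChartAt I p₀ p₀),
    (((extChartAt I p₀).symm z : U) : N) = (extChartAt I p₀.1).symm z := by
  filter_upwards [eventually_extChartAt_symm_mem_source (I := I) p₀] with z hz
  have h1 := mem_chart_source_opens.1 hz.1
  have h2 := (extChartAt I p₀.1).left_inv (x := ((extChartAt I p₀).symm z).1) (by simpa using h1)
  rw [← h2]
  exact congrArg _ hz.2

variable {D : Π p : N, Submodule ℝ (TangentSpace I p × Cotangent I p)}

/-- The charts of an open subset are restrictions of the ambient ones, and the differential of the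
inclusion is the identity in them. The same `G` serves as a frame. -/
theorem IsCourantFrameAt.restrict {p₀ : U} {G : F → R →L[ℝ] F × (F →L[ℝ] ℝ)}
    (hG : IsCourantFrameAt D p₀.1 G) :
    IsCourantFrameAt (fun p : U => pullbackDirac (mfderiv I I (Subtype.val : U → N) p) (D p.1))
      p₀ G := by
  refine ⟨hG.contDiffAt, hG.injective, ?_, hG.courantTensor_eq_zero⟩
  filter_upwards [hG.mem_iff, eventually_extChartAt_opens_symm (I := I) p₀,
    eventually_extChartAt_symm_mem_source (I := I) p₀] with z h1 h2 h3
  rw [← h2] at h1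
  generalize (extChartAt I p₀).symm z = p at *
  have hp := mem_chart_source_opens.1 h3.1
  intro q
  constructor
  · rintro ⟨η, hη, hq⟩
    obtain ⟨c, hc⟩ := (h1 _).1 hη
    refine ⟨c, hc.trans (Prod.ext (toModel_mfderiv_val h3.1 q.1) ?_)⟩
    refine ContinuousLinearMap.ext fun v => ?_
    have e1 : covectorToModel I p₀ p q.2 v =
        η (mfderiv I I (Subtype.val : U → N) p (ofModel I p₀ p v)) :=
      congrArg (fun ξ : F →L[ℝ] ℝ => ξ (ofModel I p₀ p v)) hq
    refine Eq.trans ?_ e1.symm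
    have e2 := covectorToModel_toModel hp η
      (mfderiv I I (Subtype.val : U → N) p (ofModel I p₀ p v))
    rw [toModel_mfderiv_val h3.1, toModel_ofModel h3.1] at e2
    exact e2
  · rintro ⟨c, hc⟩
    let η : TangentSpace I p.1 →L[ℝ] ℝ := (G z c).2.comp (toModel I p₀.1 p.1)
    refine ⟨η, (h1 _).2 ⟨c, Prod.ext ?_ (covectorToModel_comp_toModel hp _).symm⟩, ?_⟩
    · exact (congrArg Prod.fst hc).trans (toModel_mfderiv_val h3.1 q.1).symm
    · refine ContinuousLinearMap.ext fun v => ?_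
      have e1 : η (mfderiv I I (Subtype.val : U → N) p v) = (G z c).2 (toModel I p₀ p v) :=
        congrArg (G z c).2 (toModel_mfderiv_val h3.1 v)
      refine Eq.trans ?_ e1.symm
      rw [← covectorToModel_toModel h3.1]
      exact (congrArg (fun x : F × (F →L[ℝ] ℝ) => x.2 (toModel I p₀ p v)) hc).symm

theorem mfderiv_val_injective (p : U) :
    Function.Injective (mfderiv I I (Subtype.val : U → N) p) := by
  intro v w h
  have hp := mem_chart_source H p
  have h1 := congrArg (toModel I p.1 p.1) h
  rw [toModel_mfderiv_val hp, toModel_mfderiv_val hp] at h1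
  exact (ofModel_toModel hp v).symm.trans ((congrArg _ h1).trans (ofModel_toModel hp w))

theorem mfderiv_val_surjective (p : U) :
    Function.Surjective (mfderiv I I (Subtype.val : U → N) p) := by
  intro v
  have hp := mem_chart_source H p
  refine ⟨ofModel I p p (toModel I p.1 p.1 v), ?_⟩
  have h1 := toModel_mfderiv_val hp (ofModel I p p (toModel I p.1 p.1 v))
  rw [toModel_ofModel hp] at h1
  have h2 := mem_chart_source H p.1
  exact (ofModel_toModel h2 _).symm.trans ((congrArg _ h1).trans (ofModel_toModel h2 v))

theorem exists_poissonStructure_opens {G : N → F → R →L[ℝ] F × (F →L[ℝ] ℝ)}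
    (hG : ∀ p₀, IsCourantFrameAt D p₀ (G p₀)) (hR : Module.finrank ℝ R = Module.finrank ℝ F)
    (hiso : ∀ p, ∀ a ∈ D p, ∀ b ∈ D p, (a.2 b.1 + b.2 a.1 : ℝ) = 0)
    (htr : ∀ p ∈ U, ∀ X : TangentSpace I p, (X, (0 : Cotangent I p)) ∈ D p → X = 0) :
    ∃ S : PoissonStructure I U, ∀ p : U,
      S.graph p = pullbackDirac (mfderiv I I (Subtype.val : U → N) p) (D p.1) := by
  refine exists_poissonStructure (fun p₀ => (hG p₀.1).restrict) hR ?_ ?_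
  · rintro p a ⟨ξ, hξ, ha⟩ b ⟨η, hη, hb⟩
    rw [ha, hb]
    exact hiso p.1 _ hξ _ hη
  · rintro p X ⟨ξ, hξ, h0⟩
    have h1 : ξ = 0 := by
      refine ContinuousLinearMap.ext fun v => ?_
      obtain ⟨w, rfl⟩ := mfderiv_val_surjective p v
      exact (congrArg (fun η : F →L[ℝ] ℝ => η w) h0).symm
    rw [h1] at hξ
    exact mfderiv_val_injective p ((htr p.1 p.2 _ hξ).trans (map_zero _).symm)

end Opens

/-! ### Isotropy and Courant frames of the gauged Dirac structure. -/

section GaugedDirac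

open DiracStructure

variable {E : Type u} [NormedAddCommGroup E] [NormedSpace ℝ E] [FiniteDimensional ℝ E]
  {H : Type v} [TopologicalSpace H] {I : ModelWithCorners ℝ E H} [I.Boundaryless]
  {M : Type w} [TopologicalSpace M] [ChartedSpace H M] [IsManifold I ∞ M]
  {L : DiracStructure I M} {k : ℕ} [L.CharDualBundle k]
  {V : Π x : M, Submodule ℝ (TangentSpace I x)} (hV : L.IsSmoothComplement V)
  {f : ∀ x₀, CharFrame L k x₀}

theorem gaugedFrame_injective {F : Type*} [NormedAddCommGroup F] [NormedSpace ℝ F]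
    [FiniteDimensional ℝ F] {R : Type*} [NormedAddCommGroup R] [NormedSpace ℝ R]
    [FiniteDimensional ℝ R] {K : Type*} [NormedAddCommGroup K] [NormedSpace ℝ K]
    [FiniteDimensional ℝ K] {a : R →L[ℝ] F × (F →L[ℝ] ℝ)} (ha : Function.Injective a)
    (B : F × K →L[ℝ] (F × K →L[ℝ] ℝ)) : Function.Injective (gaugedFrame a B) := by
  intro c d h
  rw [gaugedFrame_apply, gaugedFrame_apply] at h
  have h1 := congrArg Prod.fst h
  simp only at h1
  have h2 := congrArg Prod.snd h
  simp only [h1, add_left_inj] at h2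
  refine Prod.ext (ha (Prod.ext (Prod.ext_iff.1 h1).1 (ContinuousLinearMap.ext fun v => ?_)))
    (Prod.ext_iff.1 h1).2
  exact congrArg (fun η => η (v, 0)) h2

theorem gaugeForm_antisymm (p : L.CharDualTotal k)
    (X Y : TangentSpace (I.prod 𝓘(ℝ, EuclideanSpace ℝ (Fin k))) p) :
    gaugeForm hV p X Y = (-gaugeForm hV p Y X : ℝ) := by
  have h : ∀ v w : E × (E →L[ℝ] ℝ), (canonicalSymplecticForm I (splittingMap k hV p) :
      E × (E →L[ℝ] ℝ) →ₗ[ℝ] (E × (E →L[ℝ] ℝ) →L[ℝ] ℝ)) v w =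
      -(canonicalSymplecticForm I (splittingMap k hV p) :
        E × (E →L[ℝ] ℝ) →ₗ[ℝ] (E × (E →L[ℝ] ℝ) →L[ℝ] ℝ)) w v := by
    intro v w
    have e1 := d1_apply (I := I.prod 𝓘(ℝ, E →L[ℝ] ℝ)) (canonicalOneForm I) (splittingMap k hV p)
    refine (e1 v w).trans ?_
    refine Eq.trans ?_ (congrArg Neg.neg (e1 w v).symm)
    rw [vecD1_apply, vecD1_apply]
    ring
  exact h _ _

/-- The pairing of two elements is that of their images in `L`, which is zero, plus two gauge terms
that cancel by antisymmetry. -/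
theorem isotropic_gaugedDirac (p : L.CharDualTotal k) (a) (ha : a ∈ gaugedDirac k hV p)
    (b) (hb : b ∈ gaugedDirac k hV p) : (a.2 b.1 + b.2 a.1 : ℝ) = 0 := by
  obtain ⟨ζ, h1, h2⟩ := (mem_gaugedDirac_iff hV p a).1 ha
  obtain ⟨η, h3, h4⟩ := (mem_gaugedDirac_iff hV p b).1 hb
  rw [h2, h4]
  have e1 := L.isotropic p.1 _ h1 _ h3
  have e2 := gaugeForm_antisymm hV p a.1 b.1
  have e3 : ∀ s t x y : ℝ, s + t = 0 → x = -y → s + x + (t + y) = 0 := by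
    intro s t x y h h'
    linarith
  exact e3 _ _ _ _ e1 e2

theorem exists_isCourantFrameAt_gaugedDirac (hf : IsFrameFamily f) (p₀ : L.CharDualTotal k) :
    ∃ G : E × EuclideanSpace ℝ (Fin k) →
        ((Fin (Module.finrank ℝ E) → ℝ) × EuclideanSpace ℝ (Fin k)) →L[ℝ]
        (E × EuclideanSpace ℝ (Fin k)) × (E × EuclideanSpace ℝ (Fin k) →L[ℝ] ℝ),
      IsCourantFrameAt (gaugedDirac k hV) p₀ G := by
  obtain ⟨g, hg⟩ := exists_isAdaptedFrame hV (f p₀.1)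
  obtain ⟨U, hU, hx₀, hUs, G, hG, hGL, hT⟩ := L.exists_frame p₀.1
  have hz : extChartAt (I.prod 𝓘(ℝ, EuclideanSpace ℝ (Fin k))) p₀ p₀ = (extChartAt I p₀.1 p₀.1,
      (trivializationAt (EuclideanSpace ℝ (Fin k)) L.CharDual p₀.1 p₀).2) :=
    extChartAt_totalSpace (FiberBundle.mem_baseSet_trivializationAt' p₀.1)
  have hG' : ContDiffAt ℝ ∞ (fun u => G ((extChartAt I p₀.1).symm u)) (extChartAt I p₀.1 p₀.1) :=
    contDiffAt_comp_extChartAt_symm (hG.contMDiffAt (hU.mem_nhds hx₀))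
  refine ⟨fun z => gaugedFrame (G ((extChartAt I p₀.1).symm z.1)) (vecD1 g.primitive z),
    ?_, ?_, eventually_mem_gaugedDirac hV hf p₀ hg hU hx₀ fun x hx => (hGL x hx).2, ?_⟩
  · rw [hz]
    exact contDiffAt_gaugedFrame (G := fun u => G ((extChartAt I p₀.1).symm u)) hG'
      (contDiffAt_vecD1 (g.contDiffAt_primitive rfl) (by simp))
  · rw [hz]
    refine gaugedFrame_injective ?_ _
    simp only [extChartAt_to_inv]
    exact (hGL _ hx₀).1
  · rw [hz]
    exact courantTensor_gaugedFrame (G := fun u => G ((extChartAt I p₀.1).symm u)) hG'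
      (g.contDiffAt_primitive rfl) hT

end GaugedDirac

/-! ### The gauge form along the zero section and transversality there. -/

section ZeroSection

open DiracStructure

variable {E : Type u} [NormedAddCommGroup E] [NormedSpace ℝ E] [FiniteDimensional ℝ E]
  {H : Type v} [TopologicalSpace H] {I : ModelWithCorners ℝ E H} [I.Boundaryless]
  {M : Type w} [TopologicalSpace M] [ChartedSpace H M] [IsManifold I ∞ M]
  {L : DiracStructure I M} {k : ℕ} [L.CharDualBundle k]
  {V : Π x : M, Submodule ℝ (TangentSpace I x)} (hV : L.IsSmoothComplement V)
  {f : ∀ x₀, CharFrame L k x₀}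

variable (L k) in
/-- The zero section of `(L ∩ TM)^*`. -/
abbrev zeroSec (x : M) : L.CharDualTotal k := zeroSection (EuclideanSpace ℝ (Fin k)) L.CharDual x

variable (L k) in
theorem contMDiff_zeroSec : ContMDiff I (I.prod 𝓘(ℝ, EuclideanSpace ℝ (Fin k))) ∞ (zeroSec L k) :=
  Bundle.contMDiff_zeroSection ℝ L.CharDual

variable (L k) in
/-- The differential of the zero section. -/
def dZero (x : M) : TangentSpace I x →L[ℝ]
    TangentSpace (I.prod 𝓘(ℝ, EuclideanSpace ℝ (Fin k))) (zeroSec L k x) :=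
  mfderiv I (I.prod 𝓘(ℝ, EuclideanSpace ℝ (Fin k))) (zeroSec L k) x

variable (L k) in
/-- The differential of the projection of `(L ∩ TM)^*`. -/
def dProj (p : L.CharDualTotal k) :
    TangentSpace (I.prod 𝓘(ℝ, EuclideanSpace ℝ (Fin k))) p →L[ℝ] TangentSpace I p.1 :=
  mfderiv (I.prod 𝓘(ℝ, EuclideanSpace ℝ (Fin k))) I (TotalSpace.proj : L.CharDualTotal k → M) p

theorem trivializationAt_zero (hf : IsFrameFamily f) (x₀ x : M) :
    (trivializationAt (EuclideanSpace ℝ (Fin k)) L.CharDual x₀ ⟨x, 0⟩).2 = 0 := by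
  rw [(hf x₀).2 x 0]
  exact map_zero _

theorem dProj_dZero (x : M) (v : TangentSpace I x) : dProj L k (zeroSec L k x) (dZero L k x v) = v := by
  have h1 : MDifferentiableAt (I.prod 𝓘(ℝ, EuclideanSpace ℝ (Fin k))) I
      (TotalSpace.proj : L.CharDualTotal k → M) (zeroSec L k x) :=
    (contMDiffAt_proj _ (n := ∞)).mdifferentiableAt (by simp)
  have h2 := mfderiv_comp x h1 ((contMDiff_zeroSec L k x).mdifferentiableAt (by simp))
  have h3 : mfderiv I I (TotalSpace.proj ∘ zeroSec L k : M → M) x =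
      ContinuousLinearMap.id ℝ (TangentSpace I x) := mfderiv_id
  exact (congrArg (fun A : E →L[ℝ] E => A v) (h2.symm.trans h3))

theorem toModel_dZero (hf : IsFrameFamily f) (x : M) (v : TangentSpace I x) :
    toModel (I.prod 𝓘(ℝ, EuclideanSpace ℝ (Fin k))) (zeroSec L k x) (zeroSec L k x)
      (dZero L k x v) = (toModel I x x v, 0) := by
  have hx := mem_chart_source H x
  have h1 := mfderiv_comp x (mdifferentiableAt_extChartAt
      (I := I.prod 𝓘(ℝ, EuclideanSpace ℝ (Fin k))) (mem_chart_source _ (zeroSec L k x)))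
    ((contMDiff_zeroSec L k x).mdifferentiableAt (by simp))
  have h2 : (extChartAt (I.prod 𝓘(ℝ, EuclideanSpace ℝ (Fin k))) (zeroSec L k x) ∘ zeroSec L k)
      =ᶠ[𝓝 x] (ContinuousLinearMap.inl ℝ E (EuclideanSpace ℝ (Fin k)) ∘ extChartAt I x) := by
    filter_upwards [(trivializationAt (EuclideanSpace ℝ (Fin k)) L.CharDual x).open_baseSet.mem_nhds
      (FiberBundle.mem_baseSet_trivializationAt' x)] with y hy
    exact (extChartAt_totalSpace (p₀ := zeroSec L k x) (p := zeroSec L k y) hy).trans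
      (Prod.ext rfl (trivializationAt_zero hf x y))
  have h3 := h2.mfderiv_eq (I := I) (I' := 𝓘(ℝ, E × EuclideanSpace ℝ (Fin k)))
  have h4 := mfderiv_comp (I'' := 𝓘(ℝ, E × EuclideanSpace ℝ (Fin k))) x
    ((ContinuousLinearMap.inl ℝ E (EuclideanSpace ℝ (Fin k))).differentiableAt.mdifferentiableAt)
    (mdifferentiableAt_extChartAt (I := I) hx)
  rw [h1, h4] at h3
  rw [toModel_eq_mfderiv (mem_chart_source _ (zeroSec L k x)), toModel_eq_mfderiv hx]
  refine (congrArg (fun A : E →L[ℝ] E × EuclideanSpace ℝ (Fin k) => A v) h3).trans ?_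
  rw [mfderiv_eq_fderiv, (ContinuousLinearMap.inl ℝ E (EuclideanSpace ℝ (Fin k))).fderiv]
  rfl

/-- The primitive is linear in the fibre coordinate. At zero fibre coordinate the derivative of `Φ`
drops out, and only the pairing of fibre directions with `Φ` of base directions is left. -/
theorem gaugeForm_zeroSec (hf : IsFrameFamily f) {x : M} {g : CharFrame L k x}
    (hg : IsAdaptedFrame V (f x) g)
    (X Y : TangentSpace (I.prod 𝓘(ℝ, EuclideanSpace ℝ (Fin k))) (zeroSec L k x)) :
    (gaugeForm hV (zeroSec L k x) X Y : ℝ) =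
      (dualModel k).symm (toModel (I.prod 𝓘(ℝ, EuclideanSpace ℝ (Fin k)))
          (zeroSec L k x) (zeroSec L k x) X).2
        (g.Φ x (toModel I x x (dProj L k (zeroSec L k x) Y))) -
      (dualModel k).symm (toModel (I.prod 𝓘(ℝ, EuclideanSpace ℝ (Fin k)))
          (zeroSec L k x) (zeroSec L k x) Y).2
        (g.Φ x (toModel I x x (dProj L k (zeroSec L k x) X))) := by
  have hp := mem_chart_source (ModelProd H (EuclideanSpace ℝ (Fin k))) (zeroSec L k x)
  have h1 := (eventually_gaugeForm hV hf (zeroSec L k x) hg).self_of_nhds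
  rw [extChartAt_to_inv] at h1
  have h2 := h1 (toModel (I.prod 𝓘(ℝ, EuclideanSpace ℝ (Fin k))) (zeroSec L k x) _ X)
    (toModel (I.prod 𝓘(ℝ, EuclideanSpace ℝ (Fin k))) (zeroSec L k x) _ Y)
  rw [ofModel_toModel hp, ofModel_toModel hp] at h2
  refine h2.trans ?_
  have hz : extChartAt (I.prod 𝓘(ℝ, EuclideanSpace ℝ (Fin k))) (zeroSec L k x) (zeroSec L k x) =
      (extChartAt I x x, 0) :=
    (extChartAt_totalSpace (FiberBundle.mem_baseSet_trivializationAt' x)).trans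
      (Prod.ext rfl (trivializationAt_zero hf x x))
  rw [hz]
  have h3 : ∀ v w : E × EuclideanSpace ℝ (Fin k),
      fderiv ℝ g.primitive (extChartAt I x x, 0) v w = (dualModel k).symm v.2 (g.Φ x w.1) := by
    intro v w
    have hd := (g.contDiffAt_primitive (z := (extChartAt I x x, 0)) rfl).differentiableAt (by simp)
    have hΦ : DifferentiableAt ℝ (fun u => g.Φ ((extChartAt I x).symm u))
        (extChartAt I x x, (0 : EuclideanSpace ℝ (Fin k))).1 :=
      (contDiffAt_comp_extChartAt_symm (g.smooth_Φ.contMDiffAt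
        (g.isOpen.mem_nhds g.mem))).differentiableAt (by simp)
    have e1 : HasFDerivAt (fun z : E × EuclideanSpace ℝ (Fin k) =>
        g.Φ ((extChartAt I x).symm z.1) w.1) _ (extChartAt I x x, 0) :=
      HasFDerivAt.comp (extChartAt I x x, (0 : EuclideanSpace ℝ (Fin k)))
        (hasFDerivAt_apply_const hΦ w.1) hasFDerivAt_fst
    have e2 : HasFDerivAt (fun z : E × EuclideanSpace ℝ (Fin k) => (dualModel k).symm z.2) _
        (extChartAt I x x, 0) := HasFDerivAt.comp (extChartAt I x x, (0 : EuclideanSpace ℝ (Fin k)))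
      (dualModel k).symm.hasFDerivAt hasFDerivAt_snd
    have e3 := (hasFDerivAt_apply_const hd w).unique (e2.clm_apply e1)
    have e4 := congrArg (fun A => A v) e3
    simpa [extChartAt_to_inv] using e4
  have h4 : ∀ v w : E × EuclideanSpace ℝ (Fin k),
      vecD1 g.primitive (extChartAt I x x, 0) v w =
        (dualModel k).symm v.2 (g.Φ x w.1) - (dualModel k).symm w.2 (g.Φ x v.1) := by
    intro v w
    rw [vecD1_apply, h3, h3]
  refine (h4 _ _).trans ?_
  exact congrArg₂ (fun a b : E => ((dualModel k).symm (toModel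
      (I.prod 𝓘(ℝ, EuclideanSpace ℝ (Fin k))) (zeroSec L k x) (zeroSec L k x) X).2 (g.Φ x a) -
    (dualModel k).symm (toModel (I.prod 𝓘(ℝ, EuclideanSpace ℝ (Fin k)))
      (zeroSec L k x) (zeroSec L k x) Y).2 (g.Φ x b) : ℝ))
    (toModel_mfderiv_proj hp Y).symm (toModel_mfderiv_proj hp X).symm

theorem gaugeForm_dZero_right (hf : IsFrameFamily f) {x : M} {g : CharFrame L k x}
    (hg : IsAdaptedFrame V (f x) g)
    (X : TangentSpace (I.prod 𝓘(ℝ, EuclideanSpace ℝ (Fin k))) (zeroSec L k x))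
    (v : TangentSpace I x) :
    (gaugeForm hV (zeroSec L k x) X (dZero L k x v) : ℝ) =
      (dualModel k).symm (toModel (I.prod 𝓘(ℝ, EuclideanSpace ℝ (Fin k)))
          (zeroSec L k x) (zeroSec L k x) X).2 (g.Φ x (toModel I x x v)) := by
  rw [gaugeForm_zeroSec hV hf hg, toModel_dZero hf, dProj_dZero, map_zero]
  exact sub_zero _

/-- Vectors tangent to the zero section have no fibre component. For this reason the gauge does not
affect the pullback of the structure to `M`. -/
theorem gaugeForm_dZero_dZero (hf : IsFrameFamily f) (x : M) (v w : TangentSpace I x) :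
    (gaugeForm hV (zeroSec L k x) (dZero L k x v) (dZero L k x w) : ℝ) = 0 := by
  obtain ⟨g, hg⟩ := exists_isAdaptedFrame hV (f x)
  rw [gaugeForm_dZero_right hV hf hg, toModel_dZero hf, map_zero]
  rfl

/-- The hypothesis `h0` says that the covector part of a gauged element annihilates the zero
section. The conclusion that `X` is tangent to the zero section is coisotropy, and it is also half
of transversality. -/
theorem eq_dZero_of_gaugeForm (hf : IsFrameFamily f) {x : M}
    (X : TangentSpace (I.prod 𝓘(ℝ, EuclideanSpace ℝ (Fin k))) (zeroSec L k x))
    (ζ : Cotangent I x) (hL : (dProj L k (zeroSec L k x) X, ζ) ∈ L.fiber x)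
    (h0 : ∀ v : TangentSpace I x, (ζ v : ℝ) + gaugeForm hV (zeroSec L k x) X (dZero L k x v) = 0) :
    X = dZero L k x (dProj L k (zeroSec L k x) X) ∧ ζ = 0 := by
  obtain ⟨g, hg⟩ := exists_isAdaptedFrame hV (f x)
  have hs := mem_chart_source H x
  have hp := mem_chart_source (ModelProd H (EuclideanSpace ℝ (Fin k))) (zeroSec L k x)
  set w := (toModel (I.prod 𝓘(ℝ, EuclideanSpace ℝ (Fin k))) (zeroSec L k x) (zeroSec L k x) X).2
    with hw
  have h1 : ∀ v : TangentSpace I x,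
      (ζ v : ℝ) + (dualModel k).symm w (g.Φ x (toModel I x x v)) = 0 := by
    intro v
    rw [hw, ← gaugeForm_dZero_right hV hf hg]
    exact h0 v
  -- Evaluate on `L ∩ TM`. There `ζ` vanishes by isotropy, since `(v, 0) ∈ L`, and `Φ` inverts the
  -- frame, so the fibre component `w` of `X` is zero.
  have h2 : (dualModel k).symm w = 0 := by
    refine ContinuousLinearMap.ext fun c => ?_
    have e1 : (ofModel I x x (g.Y x c), (0 : Cotangent I x)) ∈ L.fiber x := g.ofModel_Y_mem g.mem c
    have e2 : (ζ (ofModel I x x (g.Y x c)) : ℝ) = 0 := by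
      have := L.isotropic x _ hL _ e1
      exact (add_zero _).symm.trans this
    have e3 := h1 (ofModel I x x (g.Y x c))
    rw [e2, zero_add, toModel_ofModel hs, g.leftInv x g.mem] at e3
    exact e3
  have h3 : w = 0 := by
    rw [← (dualModel k).apply_symm_apply w, h2, map_zero]
  constructor
  · have e1 : toModel (I.prod 𝓘(ℝ, EuclideanSpace ℝ (Fin k))) (zeroSec L k x) (zeroSec L k x) X =
        toModel (I.prod 𝓘(ℝ, EuclideanSpace ℝ (Fin k))) (zeroSec L k x) (zeroSec L k x)
          (dZero L k x (dProj L k (zeroSec L k x) X)) := by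
      refine Eq.trans ?_ (toModel_dZero hf x _).symm
      exact Prod.ext (toModel_mfderiv_proj hp X).symm h3
    exact (ofModel_toModel hp _).symm.trans ((congrArg _ e1).trans (ofModel_toModel hp _))
  · refine ContinuousLinearMap.ext fun v => ?_
    have e1 := h1 v
    rw [h2] at e1
    exact (add_zero _).symm.trans e1

/-- By `eq_dZero_of_gaugeForm` the vector `X` is tangent to the zero section and comes from some `v
∈ L ∩ TM`. Pairing it with all fibre directions by the gauge form then gives `v = 0`. -/
theorem zeroSec_transversal (hf : IsFrameFamily f) (x : M)
    (X : TangentSpace (I.prod 𝓘(ℝ, EuclideanSpace ℝ (Fin k))) (zeroSec L k x))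
    (hX : (X, (0 : Cotangent (I.prod 𝓘(ℝ, EuclideanSpace ℝ (Fin k))) (zeroSec L k x))) ∈
      gaugedDirac k hV (zeroSec L k x)) : X = 0 := by
  obtain ⟨g, hg⟩ := exists_isAdaptedFrame hV (f x)
  have hs := mem_chart_source H x
  obtain ⟨ζ, h1, h2⟩ := (mem_gaugedDirac_iff hV _ _).1 hX
  have h3 : ∀ Y : TangentSpace (I.prod 𝓘(ℝ, EuclideanSpace ℝ (Fin k))) (zeroSec L k x),
      (ζ (dProj L k (zeroSec L k x) Y) : ℝ) + gaugeForm hV (zeroSec L k x) X Y = 0 := fun Y =>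
    (congrArg (fun η : E × EuclideanSpace ℝ (Fin k) →L[ℝ] ℝ => η Y) h2).symm
  obtain ⟨h4, h5⟩ := eq_dZero_of_gaugeForm hV hf X ζ h1 fun v => by
    have := h3 (dZero L k x v)
    rw [dProj_dZero] at this
    exact this
  set v : TangentSpace I x := dProj L k (zeroSec L k x) X with hv
  have h6 : v ∈ L.char x := by
    have h1' : (v, ζ) ∈ L.fiber x := h1
    rw [h5] at h1'
    exact h1'
  obtain ⟨c, hc⟩ := (g.mem_iff x g.mem v).1 h6
  have h7 : c = 0 := by
    have e1 : ∀ a : EuclideanSpace ℝ (Fin k), (dualModel k).symm a c = 0 := by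
      intro a
      -- `Y` is the vertical vector with fibre component `a`.
      let Y := ofModel (I.prod 𝓘(ℝ, EuclideanSpace ℝ (Fin k))) (zeroSec L k x) (zeroSec L k x) (0, a)
      have e2 := h3 Y
      rw [h5, gaugeForm_antisymm, h4, gaugeForm_dZero_right hV hf hg, toModel_ofModel
        (mem_chart_source _ (zeroSec L k x)), ← hc, g.leftInv x g.mem] at e2
      have e3 : (0 : ℝ) + -((dualModel k).symm a c) = 0 := e2
      linarith
    by_contra hne
    obtain ⟨η, hη⟩ := SeparatingDual.exists_ne_zero (R := ℝ) hne
    exact hη (by simpa using e1 (dualModel k η))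
  rw [h7, map_zero] at hc
  have h8 : v = 0 := (ofModel_toModel hs v).symm.trans ((congrArg _ hc.symm).trans (map_zero _))
  rw [h4, h8]
  exact map_zero _

end ZeroSection

/-! ### The Poisson neighbourhood and the coisotropic embedding. -/

section Neighbourhood

open DiracStructure

variable {E : Type u} [NormedAddCommGroup E] [NormedSpace ℝ E] [FiniteDimensional ℝ E]
  {H : Type v} [TopologicalSpace H] {I : ModelWithCorners ℝ E H} [I.Boundaryless]
  {M : Type w} [TopologicalSpace M] [ChartedSpace H M] [IsManifold I ∞ M]
  {L : DiracStructure I M} {k : ℕ} [L.CharDualBundle k]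
  {V : Π x : M, Submodule ℝ (TangentSpace I x)} (hV : L.IsSmoothComplement V)
  {f : ∀ x₀, CharFrame L k x₀}

theorem isSmoothEmbedding_zeroSec (hf : IsFrameFamily f) {U : Opens (L.CharDualTotal k)}
    (h0 : ∀ x, zeroSec L k x ∈ U) :
    Manifold.IsSmoothEmbedding I (I.prod 𝓘(ℝ, EuclideanSpace ℝ (Fin k))) ∞
      (fun x => (⟨zeroSec L k x, h0 x⟩ : U)) := by
  have hc : Continuous (fun x => (⟨zeroSec L k x, h0 x⟩ : U)) :=
    (contMDiff_zeroSec L k).continuous.subtype_mk h0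
  refine ⟨?_, ?_⟩
  · suffices h : Manifold.IsImmersionOfComplement (EuclideanSpace ℝ (Fin k)) I
        (I.prod 𝓘(ℝ, EuclideanSpace ℝ (Fin k))) ∞ (fun x => (⟨zeroSec L k x, h0 x⟩ : U)) from
      h.isImmersion
    intro x
    have key : ∀ y ∈ (trivializationAt (EuclideanSpace ℝ (Fin k)) L.CharDual x).baseSet,
        extChartAt (I.prod 𝓘(ℝ, EuclideanSpace ℝ (Fin k))) (⟨zeroSec L k x, h0 x⟩ : U)
          ⟨zeroSec L k y, h0 y⟩ = (extChartAt I x y, 0) := fun y hy =>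
      (extChartAt_opens _ _).trans
        ((extChartAt_totalSpace (p₀ := zeroSec L k x) (p := zeroSec L k y) hy).trans
          (Prod.ext rfl (trivializationAt_zero hf x y)))
    -- The chart of `M` is cut down to the base set of the trivialization, where the zero section
    -- reads `u ↦ (u, 0)`.
    refine .mk_of_continuousAt hc.continuousAt
      (ContinuousLinearEquiv.refl ℝ (E × EuclideanSpace ℝ (Fin k)))
      ((chartAt H x).restr (trivializationAt (EuclideanSpace ℝ (Fin k)) L.CharDual x).baseSet)
      (chartAt (ModelProd H (EuclideanSpace ℝ (Fin k))) (⟨zeroSec L k x, h0 x⟩ : U))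
      ?_ (mem_chart_source _ _) ?_ (IsManifold.chart_mem_maximalAtlas _) ?_
    · rw [OpenPartialHomeomorph.restr_source' _ _
        (trivializationAt (EuclideanSpace ℝ (Fin k)) L.CharDual x).open_baseSet]
      exact ⟨mem_chart_source H x, FiberBundle.mem_baseSet_trivializationAt' x⟩
    · exact restr_mem_maximalAtlas (contDiffGroupoid ∞ I)
        (IsManifold.chart_mem_maximalAtlas x)
        (trivializationAt (EuclideanSpace ℝ (Fin k)) L.CharDual x).open_baseSet
    · intro u hu
      have h1 := (((chartAt H x).restr (trivializationAt (EuclideanSpace ℝ (Fin k))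
        L.CharDual x).baseSet).extend I).map_target hu
      rw [OpenPartialHomeomorph.extend_source, OpenPartialHomeomorph.restr_source' _ _
        (trivializationAt (EuclideanSpace ℝ (Fin k)) L.CharDual x).open_baseSet] at h1
      have h2 := (((chartAt H x).restr (trivializationAt (EuclideanSpace ℝ (Fin k))
        L.CharDual x).baseSet).extend I).right_inv hu
      exact (key _ h1.2).trans (congrArg (fun e : E => (e, (0 : EuclideanSpace ℝ (Fin k)))) h2)
  · exact Topology.IsEmbedding.of_leftInverse (f := fun p : U => p.1.1) (fun x => rfl)
      ((FiberBundle.continuous_proj _ _).comp continuous_subtype_val) hc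

theorem mem_gaugedDirac_zeroSec_iff (x : M)
    (X : TangentSpace (I.prod 𝓘(ℝ, EuclideanSpace ℝ (Fin k))) (zeroSec L k x))
    (η : Cotangent (I.prod 𝓘(ℝ, EuclideanSpace ℝ (Fin k))) (zeroSec L k x)) :
    (X, η) ∈ gaugedDirac k hV (zeroSec L k x) ↔ ∃ ζ : Cotangent I x,
      (dProj L k (zeroSec L k x) X, ζ) ∈ L.fiber x ∧
        ∀ Y, (η Y : ℝ) = ζ (dProj L k (zeroSec L k x) Y) + gaugeForm hV (zeroSec L k x) X Y := by
  refine (mem_gaugedDirac_iff hV _ _).trans (exists_congr fun ζ => and_congr Iff.rfl ?_)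
  constructor
  · intro h Y
    exact congrArg (fun η : E × EuclideanSpace ℝ (Fin k) →L[ℝ] ℝ => η Y) h
  · intro h
    exact ContinuousLinearMap.ext h

theorem exists_isPoissonNeighbourhood (hf : IsFrameFamily f) :
    ∃ U : Opens (L.CharDualTotal k), IsPoissonNeighbourhood k hV U := by
  choose G hG using fun p₀ => exists_isCourantFrameAt_gaugedDirac hV hf p₀
  have hR : Module.finrank ℝ ((Fin (Module.finrank ℝ E) → ℝ) × EuclideanSpace ℝ (Fin k)) =
      Module.finrank ℝ (E × EuclideanSpace ℝ (Fin k)) := by simp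
  -- `U` is the set of all points where the gauged structure is transversal to the tangent bundle.
  let U : Opens (L.CharDualTotal k) := ⟨_, isOpen_transversal hG hR⟩
  have h0 : ∀ x, zeroSec L k x ∈ U := fun x => zeroSec_transversal hV hf x
  obtain ⟨S, hS⟩ := exists_poissonStructure_opens (U := U) hG hR
    (fun p a ha b hb => isotropic_gaugedDirac hV p a ha b hb) (fun p hp => hp)
  have hi := isSmoothEmbedding_zeroSec hf h0
  have hd : ∀ x (v : TangentSpace I x),
      mfderiv (I.prod 𝓘(ℝ, EuclideanSpace ℝ (Fin k))) (I.prod 𝓘(ℝ, EuclideanSpace ℝ (Fin k)))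
        (Subtype.val : U → L.CharDualTotal k) ⟨zeroSec L k x, h0 x⟩
        (mfderiv I (I.prod 𝓘(ℝ, EuclideanSpace ℝ (Fin k)))
          (fun x => (⟨zeroSec L k x, h0 x⟩ : U)) x v) = dZero L k x v := by
    intro x v
    have h1 := mfderiv_comp (g := (Subtype.val : U → L.CharDualTotal k)) x
      ((contMDiff_subtype_val (n := ∞) _).mdifferentiableAt (by simp))
      ((hi.contMDiff x).mdifferentiableAt (by simp))
    exact (congrArg (fun A : E →L[ℝ] E × EuclideanSpace ℝ (Fin k) => A v) h1).symm
  refine ⟨U, h0, S, hS, hi, ?_, ?_⟩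
  -- A conormal `ξ` and its image `♯ξ` form an element of the gauged structure whose covector part
  -- kills the zero section, so `♯ξ` is tangent to it.
  · intro x ξ hξ
    have h1 : (S.sharp _ ξ, ξ) ∈ S.graph ⟨zeroSec L k x, h0 x⟩ := ⟨ξ, rfl⟩
    rw [hS] at h1
    obtain ⟨η, h2, h3⟩ := h1
    obtain ⟨ζ, h4, h5⟩ := (mem_gaugedDirac_zeroSec_iff hV x _ η).1 h2
    have h6 : ∀ v : TangentSpace I x, (η (dZero L k x v) : ℝ) = 0 := by
      intro v
      rw [← hd]
      exact (congrArg (fun α : E × EuclideanSpace ℝ (Fin k) →L[ℝ] ℝ => α (mfderiv I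
        (I.prod 𝓘(ℝ, EuclideanSpace ℝ (Fin k))) (fun x => (⟨zeroSec L k x, h0 x⟩ : U)) x v))
          h3).symm.trans (congrArg (fun α : E →L[ℝ] ℝ => α v) hξ)
    have h7 := (eq_dZero_of_gaugeForm hV hf _ ζ h4 fun v => by
      have := (h5 (dZero L k x v)).symm.trans (h6 v)
      rw [dProj_dZero] at this
      exact this).1
    exact ⟨_, mfderiv_val_injective _ ((hd x _).trans h7.symm)⟩
  · intro x
    rw [hS]
    refine Submodule.ext fun q => ?_
    obtain ⟨v, ζ⟩ := q
    constructor
    · rintro ⟨ξ, ⟨η, h1, h2⟩, h3⟩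
      have h1' : (dZero L k x v, η) ∈ gaugedDirac k hV (zeroSec L k x) := by
        rw [← hd]
        exact h1
      obtain ⟨ζ', h4, h5⟩ := (mem_gaugedDirac_zeroSec_iff hV x _ η).1 h1'
      rw [dProj_dZero] at h4
      -- On vectors tangent to the zero section the gauge term vanishes, so the pulled-back covector
      -- is the one given by `L`.
      have h6 : ζ = ζ' := by
        refine ContinuousLinearMap.ext fun w => ?_
        have e1 := h5 (dZero L k x w)
        rw [dProj_dZero, gaugeForm_dZero_dZero hV hf, ← hd x w] at e1
        refine Eq.trans ?_ (e1.trans (add_zero _))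
        exact (congrArg (fun α : E →L[ℝ] ℝ => α w) h3).trans
          (congrArg (fun α : E × EuclideanSpace ℝ (Fin k) →L[ℝ] ℝ => α (mfderiv I
            (I.prod 𝓘(ℝ, EuclideanSpace ℝ (Fin k))) (fun x => (⟨zeroSec L k x, h0 x⟩ : U)) x w))
            h2)
      rw [h6]
      exact h4
    · intro h
      -- The covector `π^*ζ + i_X B`, with `X` the image of `v`, is the gauged lift of `(v, ζ)`.
      let η : Cotangent (I.prod 𝓘(ℝ, EuclideanSpace ℝ (Fin k))) (zeroSec L k x) :=
        (show E × EuclideanSpace ℝ (Fin k) →L[ℝ] ℝ from ζ.comp (dProj L k (zeroSec L k x))) +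
          (show E × EuclideanSpace ℝ (Fin k) →L[ℝ] ℝ from
            gaugeForm hV (zeroSec L k x) (dZero L k x v))
      have h1 : (dZero L k x v, η) ∈ gaugedDirac k hV (zeroSec L k x) := by
        refine (mem_gaugedDirac_zeroSec_iff hV x _ η).2 ⟨ζ, ?_, fun Y => rfl⟩
        rw [dProj_dZero]
        exact h
      refine ⟨η.comp (mfderiv (I.prod 𝓘(ℝ, EuclideanSpace ℝ (Fin k)))
        (I.prod 𝓘(ℝ, EuclideanSpace ℝ (Fin k))) (Subtype.val : U → L.CharDualTotal k)
        ⟨zeroSec L k x, h0 x⟩), ⟨η, ?_, rfl⟩, ?_⟩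
      · rw [← hd] at h1
        exact h1
      · refine ContinuousLinearMap.ext fun w => ?_
        have e1 : (η (dZero L k x w) : ℝ) = ζ w := by
          have e2 : (η (dZero L k x w) : ℝ) = ζ (dProj L k (zeroSec L k x) (dZero L k x w)) +
            gaugeForm hV (zeroSec L k x) (dZero L k x v) (dZero L k x w) := rfl
          rw [dProj_dZero, gaugeForm_dZero_dZero hV hf] at e2
          exact e2.trans (add_zero _)
        rw [← hd x w] at e1
        exact e1.symm

end Neighbourhood

/-! ### Separation and countability of the total space. -/

section BundleTopology

variable {B : Type*} [TopologicalSpace B] {F : Type*} [TopologicalSpace F] {Z : B → Type*}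
  [∀ x, TopologicalSpace (Z x)] [TopologicalSpace (TotalSpace F Z)] [FiberBundle F Z]

variable (F Z) in
theorem t2Space_totalSpace [T2Space B] [T2Space F] : T2Space (TotalSpace F Z) := by
  refine ⟨fun p q hpq => ?_⟩
  by_cases h : p.1 = q.1
  · let e := trivializationAt F Z p.1
    have hp : p ∈ e.source := e.mem_source.2 (FiberBundle.mem_baseSet_trivializationAt' p.1)
    have hq : q ∈ e.source :=
      e.mem_source.2 (h ▸ FiberBundle.mem_baseSet_trivializationAt' p.1)
    have hne : e p ≠ e q := fun he => hpq (e.injOn hp hq he)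
    obtain ⟨u, v, hu, hv, hpu, hqv, huv⟩ := t2_separation hne
    exact ⟨e.source ∩ e ⁻¹' u, e.source ∩ e ⁻¹' v,
      e.continuousOn_toFun.isOpen_inter_preimage e.open_source hu,
      e.continuousOn_toFun.isOpen_inter_preimage e.open_source hv, ⟨hp, hpu⟩, ⟨hq, hqv⟩,
      (huv.preimage e).mono inter_subset_right inter_subset_right⟩
  · exact separated_by_continuous (FiberBundle.continuous_proj F Z) h

variable (F Z) in
theorem secondCountableTopology_totalSpace [SecondCountableTopology B]
    [SecondCountableTopology F] : SecondCountableTopology (TotalSpace F Z) := by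
  obtain ⟨s, hs, hsU⟩ := _root_.countable_cover_nhds fun x : B =>
    (trivializationAt F Z x).open_baseSet.mem_nhds (FiberBundle.mem_baseSet_trivializationAt' x)
  have := hs.to_subtype
  have hc (x : s) : SecondCountableTopology (trivializationAt F Z x.1).source :=
    (trivializationAt F Z x.1).toOpenPartialHomeomorph.secondCountableTopology_source
  refine secondCountableTopology_of_countable_cover
    (U := fun x : s => (trivializationAt F Z x.1).source)
    (fun x => (trivializationAt F Z x.1).open_source) ?_
  refine eq_univ_of_forall fun p => ?_
  have h : p.1 ∈ ⋃ x ∈ s, (trivializationAt F Z x).baseSet := hsU ▸ mem_univ _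
  simp only [mem_iUnion] at h ⊢
  obtain ⟨x, hx, hpx⟩ := h
  exact ⟨⟨x, hx⟩, (Trivialization.mem_source _).2 hpx⟩

end BundleTopology

/-! ### A Poisson neighbourhood as an ambient Poisson manifold. -/

section Sufficiency

open DiracStructure

variable {E : Type} [NormedAddCommGroup E] [NormedSpace ℝ E] [FiniteDimensional ℝ E]
  {H : Type} [TopologicalSpace H] {I : ModelWithCorners ℝ E H} [I.Boundaryless]
  {M : Type w} [TopologicalSpace M] [T2Space M] [SecondCountableTopology M] [ChartedSpace H M]
  [IsManifold I ∞ M] {L : DiracStructure I M} {k : ℕ} [L.CharDualBundle k]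
  {V : Π x : M, Submodule ℝ (TangentSpace I x)} {hV : L.IsSmoothComplement V}

theorem IsPoissonNeighbourhood.embedsCoisotropically {U : Opens (L.CharDualTotal k)}
    (hU : IsPoissonNeighbourhood k hV U) : L.EmbedsCoisotropically := by
  obtain ⟨h0, S, -, hS⟩ := hU
  have := t2Space_totalSpace (EuclideanSpace ℝ (Fin k)) L.CharDual
  have := secondCountableTopology_totalSpace (EuclideanSpace ℝ (Fin k)) L.CharDual
  exact ⟨E × EuclideanSpace ℝ (Fin k), inferInstance, inferInstance, inferInstance,
    ModelProd H (EuclideanSpace ℝ (Fin k)), inferInstance,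
    I.prod 𝓘(ℝ, EuclideanSpace ℝ (Fin k)), inferInstance, U, inferInstance, inferInstance,
    inferInstance, inferInstance, inferInstance, S, _, hS⟩

end Sufficiency

end DiracGeom

end

/-! ### The main theorem. -/

theorem mainTheorem3 {n : ℕ} {M : Type*} [TopologicalSpace M] [T2Space M]
    [SecondCountableTopology M] [ChartedSpace (EuclideanSpace ℝ (Fin n)) M] [IsManifold (𝓡 n) ∞ M]
    (L : DiracGeom.DiracStructure (𝓡 n) M) :
    (PreconnectedSpace M → (L.EmbedsCoisotropically ↔ ∃ k : ℕ, ∀ x, L.charRank x = k)) ∧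
    (L.EmbedsCoisotropically → IsLocallyConstant L.charRank) ∧
    (∀ k : ℕ, (∀ x, L.charRank x = k) →
      L.EmbedsCoisotropically ∧
      (∃ V : Π x : M, Submodule ℝ (TangentSpace (𝓡 n) x), L.IsSmoothComplement V) ∧
      ∃ _ : L.CharDualBundle k,
        ∀ (V : Π x : M, Submodule ℝ (TangentSpace (𝓡 n) x)) (hV : L.IsSmoothComplement V),
          ∃ U : TopologicalSpace.Opens (L.CharDualTotal k),
            DiracGeom.DiracStructure.IsPoissonNeighbourhood k hV U) := by
  have key : ∀ k : ℕ, (∀ x, L.charRank x = k) →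
      L.EmbedsCoisotropically ∧
      (∃ V : Π x : M, Submodule ℝ (TangentSpace (𝓡 n) x), L.IsSmoothComplement V) ∧
      ∃ _ : L.CharDualBundle k,
        ∀ (V : Π x : M, Submodule ℝ (TangentSpace (𝓡 n) x)) (hV : L.IsSmoothComplement V),
          ∃ U : TopologicalSpace.Opens (L.CharDualTotal k),
            DiracGeom.DiracStructure.IsPoissonNeighbourhood k hV U := by
    intro k hk
    -- With second countability this gives σ-compactness, hence the partitions of unity used for the
    -- complement.
    have := ChartedSpace.locallyCompactSpace (EuclideanSpace ℝ (Fin n)) M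
    have f := fun x₀ => (L.nonempty_charFrame hk x₀).some
    obtain ⟨V₀, hV₀⟩ := DiracGeom.exists_isSmoothComplement f hk
    let hb : L.CharDualBundle k := DiracGeom.charDualBundle f
    have hf : DiracGeom.IsFrameFamily f := DiracGeom.isFrameFamily_charDualBundle f
    have hU := fun V (hV : L.IsSmoothComplement V) =>
      DiracGeom.exists_isPoissonNeighbourhood hV hf
    obtain ⟨U, hU₀⟩ := hU V₀ hV₀
    exact ⟨DiracGeom.IsPoissonNeighbourhood.embedsCoisotropically hU₀, ⟨V₀, hV₀⟩, hb, hU⟩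
  refine ⟨fun hM => ⟨fun h => ?_, fun ⟨k, hk⟩ => (key k hk).1⟩,
    fun h => h.isLocallyConstant_charRank, key⟩
  -- A preconnected space may be empty, and then any constant serves as the rank.
  rcases isEmpty_or_nonempty M with hM' | ⟨⟨x₀⟩⟩
  · exact ⟨0, fun x => (IsEmpty.false x).elim⟩
  · exact ⟨L.charRank x₀, fun x => h.isLocallyConstant_charRank.apply_eq_of_preconnectedSpace x x₀⟩
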